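/- Let $n,m\ge 1$ and write $F^{(k,l)}$ for the $k\times l$ matrices over $F$, ${}^tX$ for the transpose and $\sigma$ for the trace. Let $\mathbb H_n$ be the Siegel upper half plane of degree $n$, $\mathbb H_{n,m}=\mathbb H_n\times\mathbb C^{(m,n)}$, and $\Gamma_n=Sp(n,\mathbb Z)$. For $g=\begin{pmatrix}A&B\\C&D\end{pmatrix}\in Sp(n,\mathbb R)$ put $g\cdot\Omega=(A\Omega+B)(C\Omega+D)^{-1}$, $J(g,\Omega)=C\Omega+D$, $\alpha(g)=\det J(g,iI_n)/|\det J(g,iI_n)|$ and $$\varepsilon(g;\Omega',\Omega)=\det{}^{-1/2}\Big(\tfrac{g\cdot\Omega'-\overline{g\cdot\Omega}}{2i}\Big)\det{}^{1/2}\Big(\tfrac{\Omega'-\overline{\Omega}}{2i}\Big)|\det J(g,\Omega')|^{-1/2}|\det J(g,\Omega)|^{-1/2},$$ where $\det^{1/2}$ is the holomorphic square root of $\det$ on the symmetric complex matrices with positive definite real part that is positive on real matrices. Let $G_*=\{(g,\epsilon)\in Sp(n,\mathbb R)\times\mathbb C : |\epsilon|=1,\ \epsilon^2=\alpha(g)^{-1}\}$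 be the two-fold cover of $Sp(n,\mathbb R)$ with product $(g,\epsilon)(h,\eta)=(gh,\ \epsilon\eta\,\varepsilon(g;iI_n,h\cdot iI_n))$, let $\pi_*:G_*\to Sp(n,\mathbb R)$ be the projection, and let $J_{1/2}((g,\epsilon),\Omega)=\epsilon^{-1}\varepsilon(g;\Omega,iI_n)|\det J(g,\Omega)|^{1/2}$, so that $J_{1/2}^2=\det(C\Omega+D)$. Let $H_{\mathbb R}^{(n,m)}$ be the Heisenberg group of triples $(\lambda,\mu;\kappa)$ with $\lambda,\mu\in\mathbb R^{(m,n)}$, $\kappa\in\mathbb R^{(m,m)}$ and $\kappa+\mu\,{}^t\lambda$ symmetric, and $H_{\mathbb Z}^{(n,m)}$ its subgroup of integral triples. The group $G^J_*=G_*\ltimes H_{\mathbb R}^{(n,m)}$, with product $$\big(g_*,(\lambda,\mu;\kappa)\big)\big(g'_*,(\lambda',\mu';\kappa')\big)=\big(g_*g'_*,(\tilde\lambda+\lambda',\tilde\mu+\mu';\kappa+\kappa'+\tilde\lambda\,{}^t\mu'-\tilde\mu\,{}^t\lambda')\big),\quad (\tilde\lambda,\tilde\mu)=(\lambda,\mu)g',$$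 acts on $\mathbb H_{n,m}$ by $\big((g,\epsilon),(\lambda,\mu;\kappa)\big)\cdot(\Omega,Z)=\big(g\cdot\Omega,(Z+\lambda\Omega+\mu)(C\Omega+D)^{-1}\big)$. For a symmetric matrix $\mathcal M$ of degree $m$ and $\tilde g=(g_*,(\lambda,\mu;\kappa))\in G^J_*$, $g_*=(g,\epsilon)$, put $$J^*_{\mathcal M}(\tilde g,(\Omega,Z))=e^{\pi i\,\sigma(\mathcal M(Z+\lambda\Omega+\mu)(C\Omega+D)^{-1}C\,{}^t(Z+\lambda\Omega+\mu))}\,e^{-\pi i\,\sigma(\mathcal M(\lambda\Omega\,{}^t\lambda+2\lambda\,{}^tZ+\kappa+\mu\,{}^t\lambda))}\,J_{1/2}(g_*,\Omega)^m .$$ For a subgroup $\Gamma\subset\Gamma_n$ put $\Gamma_*=\pi_*^{-1}(\Gamma)$. For $k\in\mathbb Z$, let $J_{k,\mathcal M}$ be defined like $J^*_{\mathcal M}$, with $2\pi i$ in place of $\pi i$ and $J_{1/2}^k$ in place of $J_{1/2}^m$. For a positive semidefinite half-integral $\mathcal M$ (diagonal entries in $\mathbb Z$, $2\mathcal M$ integral),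 a Jacobi form of weight $k/2$ and index $\mathcal M$ with level $\Gamma$ (of finite index in $\Gamma_n$), for a unitary character $\chi$ of finite order of $\Gamma_*$, is a holomorphic function $f:\mathbb H_{n,m}\to\mathbb C$ with $f(\tilde\gamma\cdot(\Omega,Z))=\chi(\gamma_*)\,J_{k,\mathcal M}(\tilde\gamma,(\Omega,Z))\,f(\Omega,Z)$ for all $\tilde\gamma=(\gamma_*,(\lambda,\mu;\kappa))\in\Gamma_*\ltimes H_{\mathbb Z}^{(n,m)}$. **Theorem.** Let $\mathcal M$ be a positive definite symmetric integral matrix of degree $m$. The series $$\Theta_{\mathcal M}(\Omega,Z)=\sum_{\xi\in\mathbb Z^{(m,n)}}e^{\pi i\,\sigma(\mathcal M(\xi\,\Omega\,{}^t\xi+2\,\xi\,{}^tZ))}$$ converges absolutely at every point of $\mathbb H_{n,m}$ and is holomorphic on $\mathbb H_{n,m}$. There are a subgroup $\Gamma_{\mathcal M}$ of finite index in $\Gamma_n$, such that $\Gamma_{\mathcal M,*}\ltimes H_{\mathbb Z}^{(n,m)}$ is discrete in $G^J_*$, where $\Gamma_{\mathcal M,*}=\pi_*^{-1}(\Gamma_{\mathcal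 M})$, and a unitary character $\rho_{\mathcal M}$ of finite order of $\Gamma_{\mathcal M,*}$, such that $$\Theta_{\mathcal M}(\tilde\gamma\cdot(\Omega,Z))=\rho_{\mathcal M}(\gamma_*)\,e^{\pi i\,\sigma(\mathcal M(\kappa+\mu\,{}^t\lambda))}\,J^*_{\mathcal M}(\tilde\gamma,(\Omega,Z))\,\Theta_{\mathcal M}(\Omega,Z)$$ for all $\tilde\gamma=(\gamma_*,(\lambda,\mu;\kappa))\in\Gamma_{\mathcal M,*}\ltimes H_{\mathbb Z}^{(n,m)}$ and all $(\Omega,Z)\in\mathbb H_{n,m}$. If all diagonal entries of $\mathcal M$ are even (equivalently, if $\tfrac12\mathcal M$ is half-integral), then moreover, with the same $\Gamma_{\mathcal M}$ and $\rho_{\mathcal M}$, $$\Theta_{\mathcal M}(\tilde\gamma\cdot(\Omega,Z))=\rho_{\mathcal M}(\gamma_*)\,J^*_{\mathcal M}(\tilde\gamma,(\Omega,Z))\,\Theta_{\mathcal M}(\Omega,Z)$$ for all such $\tilde\gamma$ and $(\Omega,Z)$, and $\Theta_{\mathcal M}$ is a Jacobi form of weight $m/2$ and index $\tfrac12\mathcal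 M$ with level $\Gamma_{\mathcal M}$ for the character $\rho_{\mathcal M}$. -/

import Mathlib

open Matrix
namespace JacobiTheta
noncomputable section

/-- The domain of symmetric complex matrices with positive definite real part. -/
def posRe (n : ℕ) : Set (Matrix (Fin n) (Fin n) ℂ) :=
  {S | S.IsSymm ∧ (S.map Complex.re).PosDef}

theorem posRe_re_pos {n : ℕ} {S : Matrix (Fin n) (Fin n) ℂ} (hS : S ∈ posRe n)
    {x : Fin n → ℂ} (hx : x ≠ 0) : 0 < (star x ⬝ᵥ (S *ᵥ x)).re := by
  have hsym : ∀ i j, S j i = S i j := fun i j => by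
    have := hS.1.apply i j; exact this
  have key : (star x ⬝ᵥ (S *ᵥ x)).re =
      (star (fun i => (x i).re) ⬝ᵥ ((S.map Complex.re) *ᵥ (fun i => (x i).re))) +
      (star (fun i => (x i).im) ⬝ᵥ ((S.map Complex.re) *ᵥ (fun i => (x i).im))) := by
    have h0 : ∑ i, ∑ j, ((x i).im * (x j).re - (x i).re * (x j).im) * (S i j).im = 0 := by
      have : ∑ i, ∑ j, ((x i).im * (x j).re - (x i).re * (x j).im) * (S i j).im
          = -∑ i, ∑ j, ((x i).im * (x j).re - (x i).re * (x j).im) * (S i j).im := by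
        conv_lhs => rw [Finset.sum_comm]
        rw [← Finset.sum_neg_distrib]
        refine Finset.sum_congr rfl fun i _ => ?_
        rw [← Finset.sum_neg_distrib]
        refine Finset.sum_congr rfl fun j _ => ?_
        rw [hsym i j]; ring
      linarith
    simp only [dotProduct, mulVec, Pi.star_apply, Matrix.map_apply, Finset.mul_sum,
      Complex.re_sum, star_trivial]
    rw [← Finset.sum_add_distrib]
    rw [← sub_eq_zero, ← Finset.sum_sub_distrib, ← h0]
    refine Finset.sum_congr rfl fun i _ => ?_
    rw [← Finset.sum_add_distrib, ← Finset.sum_sub_distrib]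
    refine Finset.sum_congr rfl fun j _ => ?_
    simp [Complex.mul_re, Complex.mul_im]
    ring
  rw [key]
  have hp := hS.2
  by_cases h1 : (fun i => (x i).re) = 0
  · have h2 : (fun i => (x i).im) ≠ 0 := by
      intro h2; apply hx; funext i
      exact Complex.ext (congrFun h1 i) (congrFun h2 i)
    have := hp.dotProduct_mulVec_pos h2
    rw [h1]; simpa using this
  · have a := hp.dotProduct_mulVec_pos h1
    have b := hp.posSemidef.dotProduct_mulVec_nonneg (fun i => (x i).im)
    linarith

theorem posRe_det_ne_zero {n : ℕ} {S : Matrix (Fin n) (Fin n) ℂ} (hS : S ∈ posRe n) :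
    S.det ≠ 0 := by
  intro h
  obtain ⟨x, hx, h0⟩ := Matrix.exists_mulVec_eq_zero_iff.2 h
  have := posRe_re_pos hS hx
  simp [h0] at this

theorem posRe_submatrix {n : ℕ} {S : Matrix (Fin (n + 1)) (Fin (n + 1)) ℂ} (hS : S ∈ posRe (n + 1)) :
    S.submatrix Fin.castSucc Fin.castSucc ∈ posRe n :=
  ⟨hS.1.submatrix _, hS.2.submatrix (Fin.castSucc_injective n)⟩

theorem posRe_pivot {n : ℕ} {S : Matrix (Fin (n + 1)) (Fin (n + 1)) ℂ} (hS : S ∈ posRe (n + 1)) :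
    0 < (S.det / (S.submatrix Fin.castSucc Fin.castSucc).det).re := by
  have hd := posRe_det_ne_zero hS
  have hu : IsUnit S.det := hd.isUnit
  have hd' := posRe_det_ne_zero (posRe_submatrix hS)
  set e : Fin (n + 1) → ℂ := Pi.single (Fin.last n) 1 with he
  have hy : S *ᵥ (S⁻¹ *ᵥ e) = e := by
    rw [mulVec_mulVec, mul_nonsing_inv _ hu, one_mulVec]
  have hy0 : S⁻¹ *ᵥ e ≠ 0 := by
    intro h
    rw [h, mulVec_zero] at hy
    have := congrFun hy (Fin.last n)
    simp [he] at this
  have h1 := posRe_re_pos hS hy0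
  rw [hy] at h1
  have h2 : (S⁻¹ *ᵥ e) (Fin.last n) = (S.submatrix Fin.castSucc Fin.castSucc).det / S.det := by
    rw [he, mulVec_single_one, col_apply, Matrix.inv_def, Matrix.smul_apply, adjugate_fin_succ_eq_det_submatrix]
    have h : (Fin.last n).succAbove = Fin.castSucc := by funext i; simp
    rw [h, ← two_mul, pow_mul]
    simp [Ring.inverse_eq_inv', div_eq_inv_mul]
  have h3 : (star (S⁻¹ *ᵥ e) ⬝ᵥ e) = star ((S.submatrix Fin.castSucc Fin.castSucc).det / S.det) := by
    rw [← h2, he, dotProduct_single, mul_one]; rfl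
  rw [h3] at h1
  have h4 : 0 < ((S.submatrix Fin.castSucc Fin.castSucc).det / S.det).re := by
    rw [Complex.star_def, Complex.conj_re] at h1
    exact h1
  rw [← inv_div, Complex.inv_re]
  exact div_pos h4 (Complex.normSq_pos.2 (div_ne_zero hd' hd))

theorem differentiable_det {n : ℕ} : Differentiable ℂ (fun S : Matrix (Fin n) (Fin n) ℂ => S.det) := by
  let _ : NormedAddCommGroup (Matrix (Fin n) (Fin n) ℂ) := Matrix.normedAddCommGroup
  let _ : NormedSpace ℂ (Matrix (Fin n) (Fin n) ℂ) := Matrix.normedSpace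
  have : (fun S : Matrix (Fin n) (Fin n) ℂ => S.det) =
    fun S => ∑ σ : Equiv.Perm (Fin n), ((Equiv.Perm.sign σ : ℤ) : ℂ) * ∏ i, S (σ i) i := by
    funext S; exact Matrix.det_apply' S
  rw [this]
  have h : ∀ i j, Differentiable ℂ (fun S : Matrix (Fin n) (Fin n) ℂ => S i j) := fun i j =>
    (Matrix.entryLinearMap ℂ ℂ i j).toContinuousLinearMap.differentiable
  fun_prop

theorem exists_detSqrt (n : ℕ) : ∃ f : Matrix (Fin n) (Fin n) ℂ → ℂ,
    DifferentiableOn ℂ f (posRe n) ∧ (∀ S ∈ posRe n, f S ^ 2 = S.det) ∧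
    ∀ S : Matrix (Fin n) (Fin n) ℝ, S.map Complex.ofReal ∈ posRe n →
      f (S.map Complex.ofReal) = (Real.sqrt S.det : ℝ) := by
  let _ : ∀ k, NormedAddCommGroup (Matrix (Fin k) (Fin k) ℂ) := fun k => Matrix.normedAddCommGroup
  let _ : ∀ k, NormedSpace ℂ (Matrix (Fin k) (Fin k) ℂ) := fun k => Matrix.normedSpace
  induction n with
  | zero => exact ⟨fun _ => 1, by fun_prop, by simp, by simp⟩
  | succ n ih =>
    obtain ⟨f, h1, h2, h3⟩ := ih
    have hsub : Differentiable ℂ (fun S : Matrix (Fin (n+1)) (Fin (n+1)) ℂ =>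
        S.submatrix Fin.castSucc Fin.castSucc) := by
      have : (fun S : Matrix (Fin (n+1)) (Fin (n+1)) ℂ =>
        S.submatrix Fin.castSucc Fin.castSucc) = (LinearMap.funLeft ℂ (Fin n → ℂ) Fin.castSucc ∘ₗ 
         (LinearMap.compLeft (LinearMap.funLeft ℂ ℂ Fin.castSucc) (Fin (n+1)))  : (Fin (n+1) → Fin (n+1) → ℂ) →ₗ[ℂ] (Fin n → Fin n → ℂ)) := by
        funext S; ext i j; rfl
      rw [this]
      exact (LinearMap.toContinuousLinearMap _).differentiable
    refine ⟨fun S => f (S.submatrix Fin.castSucc Fin.castSucc) *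
      (S.det / (S.submatrix Fin.castSucc Fin.castSucc).det) ^ (1 / 2 : ℂ), ?_, ?_, ?_⟩
    · refine DifferentiableOn.mul ?_ ?_
      · exact h1.comp hsub.differentiableOn (fun S hS => posRe_submatrix hS)
      · refine DifferentiableOn.cpow ?_ (by fun_prop) (fun S hS => Or.inl (posRe_pivot hS))
        have d1 : DifferentiableOn ℂ (fun S : Matrix (Fin (n + 1)) (Fin (n + 1)) ℂ => S.det)
          (posRe (n + 1)) := differentiable_det.differentiableOn
        have d2 : DifferentiableOn ℂ (fun S : Matrix (Fin (n + 1)) (Fin (n + 1)) ℂ =>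
          (S.submatrix Fin.castSucc Fin.castSucc).det) (posRe (n + 1)) :=
          (differentiable_det.comp hsub).differentiableOn
        simp only [div_eq_mul_inv]
        exact d1.fun_mul (d2.fun_inv (fun S hS => posRe_det_ne_zero (posRe_submatrix hS)))
    · intro S hS
      rw [mul_pow, h2 _ (posRe_submatrix hS), ← Complex.cpow_nat_mul]
      have := posRe_det_ne_zero (posRe_submatrix hS)
      simp; field_simp
    · intro S hS
      have hs := posRe_submatrix hS
      have e : (S.map Complex.ofReal).submatrix Fin.castSucc Fin.castSucc =
        (S.submatrix Fin.castSucc Fin.castSucc).map Complex.ofReal := by ext; rfl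
      have hp := posRe_pivot hS
      have e1 : ∀ k (T : Matrix (Fin k) (Fin k) ℝ), (T.map Complex.ofReal).det = (T.det : ℂ) := by
        intro k T; exact (RingHom.map_det Complex.ofRealHom T).symm
      dsimp only
      rw [e] at hs hp ⊢
      rw [h3 _ hs, e1, e1] 
      rw [e1, e1, ← Complex.ofReal_div, Complex.ofReal_re] at hp
      rw [← Complex.ofReal_div, show (1 / 2 : ℂ) = ((1 / 2 : ℝ) : ℂ) by push_cast; rfl,
        ← Complex.ofReal_cpow hp.le, ← Real.sqrt_eq_rpow, ← Complex.ofReal_mul]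
      have hpd : 0 < (S.submatrix Fin.castSucc Fin.castSucc).det := by
        have : (((S.submatrix Fin.castSucc Fin.castSucc).map Complex.ofReal).map Complex.re)
          = (S.submatrix Fin.castSucc Fin.castSucc) := by ext; simp
        have h := hs.2
        rw [this] at h
        exact h.det_pos
      rw [← Real.sqrt_mul hpd.le, mul_div_cancel₀ _ hpd.ne']


/-- The unique holomorphic function `det^{1/2}` on `posRe n` whose square is `det` and which is the
positive square root of `det` on the real matrices (its values off `posRe n` are never used). -/
def detSqrt (n : ℕ) : Matrix (Fin n) (Fin n) ℂ → ℂ := Classical.choose (exists_detSqrt n)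

theorem detSqrt_differentiableOn (n : ℕ) : DifferentiableOn ℂ (detSqrt n) (posRe n) :=
  (Classical.choose_spec (exists_detSqrt n)).1

theorem detSqrt_sq {n : ℕ} {S : Matrix (Fin n) (Fin n) ℂ} (hS : S ∈ posRe n) :
    detSqrt n S ^ 2 = S.det :=
  (Classical.choose_spec (exists_detSqrt n)).2.1 S hS

theorem detSqrt_ofReal {n : ℕ} {S : Matrix (Fin n) (Fin n) ℝ}
    (hS : S.map Complex.ofReal ∈ posRe n) :
    detSqrt n (S.map Complex.ofReal) = (Real.sqrt S.det : ℝ) :=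
  (Classical.choose_spec (exists_detSqrt n)).2.2 S hS

theorem detSqrt_ne_zero {n : ℕ} {S : Matrix (Fin n) (Fin n) ℂ} (hS : S ∈ posRe n) :
    detSqrt n S ≠ 0 := by
  intro h
  have := detSqrt_sq hS
  rw [h] at this
  exact posRe_det_ne_zero hS (by simpa using this.symm)

/-- The Siegel upper half plane of degree `n`. -/
def siegelUpper (n : ℕ) : Set (Matrix (Fin n) (Fin n) ℂ) :=
  {Ω | Ω.IsSymm ∧ (Ω.map Complex.im).PosDef}

/-- The real symplectic group `Sp(n,ℝ)`, with blocks `g = (A B; C D)`. -/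
abbrev Sp (n : ℕ) := Matrix.symplecticGroup (Fin n) ℝ

/-- The block `A` of `g`, as a complex matrix. -/
def blkA {n : ℕ} (g : Sp n) : Matrix (Fin n) (Fin n) ℂ := g.1.toBlocks₁₁.map Complex.ofReal
/-- The block `B` of `g`. -/
def blkB {n : ℕ} (g : Sp n) : Matrix (Fin n) (Fin n) ℂ := g.1.toBlocks₁₂.map Complex.ofReal
/-- The block `C` of `g`. -/
def blkC {n : ℕ} (g : Sp n) : Matrix (Fin n) (Fin n) ℂ := g.1.toBlocks₂₁.map Complex.ofReal
/-- The block `D` of `g`. -/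
def blkD {n : ℕ} (g : Sp n) : Matrix (Fin n) (Fin n) ℂ := g.1.toBlocks₂₂.map Complex.ofReal

/-- `J(g,Ω) = CΩ + D`. -/
def autJ {n : ℕ} (g : Sp n) (Ω : Matrix (Fin n) (Fin n) ℂ) : Matrix (Fin n) (Fin n) ℂ :=
  blkC g * Ω + blkD g

/-- The action `g·Ω = (AΩ + B)(CΩ + D)⁻¹`. -/
def act {n : ℕ} (g : Sp n) (Ω : Matrix (Fin n) (Fin n) ℂ) : Matrix (Fin n) (Fin n) ℂ :=
  (blkA g * Ω + blkB g) * (autJ g Ω)⁻¹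

theorem blk_rel {n : ℕ} (g : Sp n) :
    (blkA g)ᵀ * blkC g = (blkC g)ᵀ * blkA g ∧ (blkB g)ᵀ * blkD g = (blkD g)ᵀ * blkB g ∧
      (blkA g)ᵀ * blkD g - (blkC g)ᵀ * blkB g = 1 := by
  have h := SymplecticGroup.map_mem g.2 Complex.ofRealHom
  rw [← Matrix.fromBlocks_toBlocks (g.1.map _), SymplecticGroup.fromBlocks_mem_iff] at h
  exact h

theorem blk_one (n : ℕ) : blkA (1 : Sp n) = 1 ∧ blkB (1 : Sp n) = 0 ∧ blkC (1 : Sp n) = 0 ∧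
    blkD (1 : Sp n) = 1 := by
  have h : ((1 : Sp n) : Matrix (Fin n ⊕ Fin n) (Fin n ⊕ Fin n) ℝ) = fromBlocks 1 0 0 1 := by
    simp
  refine ⟨?_, ?_, ?_, ?_⟩ <;> simp only [blkA, blkB, blkC, blkD, h, toBlocks_fromBlocks₁₁,
    toBlocks_fromBlocks₁₂, toBlocks_fromBlocks₂₁, toBlocks_fromBlocks₂₂] <;> simp

theorem blk_mul {n : ℕ} (g h : Sp n) :
    blkA (g * h) = blkA g * blkA h + blkB g * blkC h ∧
    blkB (g * h) = blkA g * blkB h + blkB g * blkD h ∧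
    blkC (g * h) = blkC g * blkA h + blkD g * blkC h ∧
    blkD (g * h) = blkC g * blkB h + blkD g * blkD h := by
  have e : ((g * h : Sp n) : Matrix (Fin n ⊕ Fin n) (Fin n ⊕ Fin n) ℝ) = 
      fromBlocks g.1.toBlocks₁₁ g.1.toBlocks₁₂ g.1.toBlocks₂₁ g.1.toBlocks₂₂ *
      fromBlocks h.1.toBlocks₁₁ h.1.toBlocks₁₂ h.1.toBlocks₂₁ h.1.toBlocks₂₂ := by
    rw [fromBlocks_toBlocks, fromBlocks_toBlocks]; rfl
  rw [fromBlocks_multiply] at e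
  have hm : ∀ X Y : Matrix (Fin n) (Fin n) ℝ, (X * Y).map Complex.ofReal =
      X.map Complex.ofReal * Y.map Complex.ofReal := fun X Y => Matrix.map_mul (f := Complex.ofRealHom)
  have ha : ∀ X Y : Matrix (Fin n) (Fin n) ℝ, (X + Y).map Complex.ofReal =
      X.map Complex.ofReal + Y.map Complex.ofReal := fun X Y => by ext; simp
  refine ⟨?_, ?_, ?_, ?_⟩ <;> simp only [blkA, blkB, blkC, blkD, e, toBlocks_fromBlocks₁₁,
    toBlocks_fromBlocks₁₂, toBlocks_fromBlocks₂₁, toBlocks_fromBlocks₂₂, ha, hm]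

theorem blk_star {n : ℕ} (g : Sp n) : (blkA g)ᴴ = (blkA g)ᵀ ∧ (blkB g)ᴴ = (blkB g)ᵀ ∧
    (blkC g)ᴴ = (blkC g)ᵀ ∧ (blkD g)ᴴ = (blkD g)ᵀ := by
  refine ⟨?_, ?_, ?_, ?_⟩ <;> ext i j <;> simp [blkA, blkB, blkC, blkD]

theorem star_rel {n : ℕ} (g : Sp n) (X Y : Matrix (Fin n) (Fin n) ℂ) :
    (autJ g Y)ᴴ * (blkA g * X + blkB g) - (blkA g * Y + blkB g)ᴴ * autJ g X = X - Yᴴ := by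
  obtain ⟨h1, h2, h3⟩ := blk_rel g
  obtain ⟨a, b, c, d⟩ := blk_star g
  have h4 : (blkD g)ᵀ * blkA g - (blkB g)ᵀ * blkC g = 1 := by
    have := congrArg Matrix.transpose h3
    simpa using this
  simp only [autJ, conjTranspose_add, conjTranspose_mul, a, b, c, d]
  calc _ = Yᴴ * ((blkC g)ᵀ * blkA g - (blkA g)ᵀ * blkC g) * X 
      - Yᴴ * ((blkA g)ᵀ * blkD g - (blkC g)ᵀ * blkB g) 
      + ((blkD g)ᵀ * blkA g - (blkB g)ᵀ * blkC g) * X 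
      + ((blkD g)ᵀ * blkB g - (blkB g)ᵀ * blkD g) := by noncomm_ring
    _ = _ := by rw [h1, h2, h3, h4]; simp; abel

theorem trans_rel {n : ℕ} (g : Sp n) (X Y : Matrix (Fin n) (Fin n) ℂ) :
    (autJ g Y)ᵀ * (blkA g * X + blkB g) - (blkA g * Y + blkB g)ᵀ * autJ g X = X - Yᵀ := by
  obtain ⟨h1, h2, h3⟩ := blk_rel g
  have h4 : (blkD g)ᵀ * blkA g - (blkB g)ᵀ * blkC g = 1 := by
    have := congrArg Matrix.transpose h3
    simpa using this
  simp only [autJ, transpose_add, transpose_mul]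
  calc _ = Yᵀ * ((blkC g)ᵀ * blkA g - (blkA g)ᵀ * blkC g) * X 
      - Yᵀ * ((blkA g)ᵀ * blkD g - (blkC g)ᵀ * blkB g) 
      + ((blkD g)ᵀ * blkA g - (blkB g)ᵀ * blkC g) * X 
      + ((blkD g)ᵀ * blkB g - (blkB g)ᵀ * blkD g) := by noncomm_ring
    _ = _ := by rw [h1, h2, h3, h4]; simp; abel

/-- `(Ω₁ - conj Ω₂) / 2i`. -/
def halfDiff {n : ℕ} (Ω₁ Ω₂ : Matrix (Fin n) (Fin n) ℂ) : Matrix (Fin n) (Fin n) ℂ :=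
  (1 / (2 * Complex.I)) • (Ω₁ - Ω₂.map (starRingEnd ℂ))

theorem halfDiff_mem {n : ℕ} {X Y : Matrix (Fin n) (Fin n) ℂ} (hX : X ∈ siegelUpper n)
    (hY : Y ∈ siegelUpper n) : halfDiff X Y ∈ posRe n := by
  refine ⟨?_, ?_⟩
  · have := hX.1; have h2 := hY.1
    unfold halfDiff
    exact (hX.1.sub (hY.1.map _)).smul _
  · have e : (halfDiff X Y).map Complex.re = (1/2 : ℝ) • (X.map Complex.im + Y.map Complex.im) := by
      ext i j
      simp [halfDiff, Complex.mul_re]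
    rw [e]
    exact (hX.2.add hY.2).smul (by norm_num)

theorem map_conj_eq {n : ℕ} {X : Matrix (Fin n) (Fin n) ℂ} (hX : X ∈ siegelUpper n) :
    X.map (starRingEnd ℂ) = Xᴴ := by
  rw [conjTranspose, hX.1.eq]; rfl

theorem autJ_det_ne_zero {n : ℕ} (g : Sp n) {X : Matrix (Fin n) (Fin n) ℂ} (hX : X ∈ siegelUpper n) :
    (autJ g X).det ≠ 0 := by
  intro h
  obtain ⟨v, hv, h0⟩ := Matrix.exists_mulVec_eq_zero_iff.2 h
  have h1 := star_rel g X X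
  have h2 := posRe_re_pos (halfDiff_mem hX hX) hv
  have h3 : star v ⬝ᵥ ((X - Xᴴ) *ᵥ v) = 0 := by
    rw [← h1, sub_mulVec, ← mulVec_mulVec, ← mulVec_mulVec, h0, mulVec_zero, sub_zero,
      dotProduct_mulVec, ← star_mulVec, h0]
    simp
  rw [halfDiff, map_conj_eq hX, smul_mulVec, dotProduct_smul, h3] at h2
  simp at h2

theorem autJ_isUnit {n : ℕ} (g : Sp n) {X : Matrix (Fin n) (Fin n) ℂ} (hX : X ∈ siegelUpper n) :
    IsUnit (autJ g X).det := (autJ_det_ne_zero g hX).isUnit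

theorem act_isSymm {n : ℕ} (g : Sp n) {X : Matrix (Fin n) (Fin n) ℂ} (hX : X ∈ siegelUpper n) :
    (act g X).IsSymm := by
  have h := trans_rel g X X
  rw [hX.1.eq, sub_self, sub_eq_zero] at h
  have hu := autJ_isUnit g hX
  have hu' : IsUnit (autJ g X)ᵀ.det := by rwa [det_transpose]
  unfold Matrix.IsSymm act
  rw [transpose_mul, transpose_nonsing_inv]
  calc (autJ g X)ᵀ⁻¹ * (blkA g * X + blkB g)ᵀ 
      = (autJ g X)ᵀ⁻¹ * ((blkA g * X + blkB g)ᵀ * autJ g X) * (autJ g X)⁻¹ := by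
        rw [Matrix.mul_assoc, mul_nonsing_inv_cancel_right _ _ hu]
    _ = _ := by rw [← h, nonsing_inv_mul_cancel_left _ _ hu']

theorem act_sub {n : ℕ} (g : Sp n) {X Y : Matrix (Fin n) (Fin n) ℂ} (hX : X ∈ siegelUpper n)
    (hY : Y ∈ siegelUpper n) :
    (autJ g Y)ᴴ * halfDiff (act g X) (act g Y) * autJ g X = halfDiff X Y := by
  have h := star_rel g X Y
  have e : (act g Y).map (starRingEnd ℂ) = (act g Y)ᴴ := by
    rw [conjTranspose, (act_isSymm g hY).eq]; rfl
  have h1 : act g X * autJ g X = blkA g * X + blkB g := by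
    rw [act, nonsing_inv_mul_cancel_right _ _ (autJ_isUnit g hX)]
  have h2 : act g Y * autJ g Y = blkA g * Y + blkB g := by
    rw [act, nonsing_inv_mul_cancel_right _ _ (autJ_isUnit g hY)]
  rw [halfDiff, halfDiff, e, map_conj_eq hY, ← h, ← h1, ← h2, conjTranspose_mul]
  simp only [Matrix.mul_smul, Matrix.smul_mul]
  congr 1
  noncomm_ring

theorem act_mem {n : ℕ} (g : Sp n) {X : Matrix (Fin n) (Fin n) ℂ} (hX : X ∈ siegelUpper n) :
    act g X ∈ siegelUpper n := by
  refine ⟨act_isSymm g hX, ?_⟩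
  have hre : ∀ Z : Matrix (Fin n) (Fin n) ℂ, (halfDiff Z Z).map Complex.re = Z.map Complex.im := by
    intro Z; ext i j; simp [halfDiff, Complex.mul_re]
    ring
  have him : ∀ Z : Matrix (Fin n) (Fin n) ℂ, ∀ i j, (halfDiff Z Z i j).im = 0 := by
    intro Z i j; simp [halfDiff, Complex.mul_im]
  have hs := act_isSymm g hX
  refine Matrix.PosDef.of_dotProduct_mulVec_pos ?_ ?_
  · rw [Matrix.IsHermitian, conjTranspose_eq_transpose_of_trivial, ← Matrix.transpose_map, hs.eq]
  · intro x hx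
    set v : Fin n → ℂ := fun i => (x i : ℂ) with hv
    have hv0 : v ≠ 0 := by
      intro h; apply hx; funext i; have := congrFun h i; simpa [hv] using this
    set w := (autJ g X)⁻¹ *ᵥ v with hw
    have hwv : autJ g X *ᵥ w = v := by
      rw [hw, mulVec_mulVec, mul_nonsing_inv _ (autJ_isUnit g hX), one_mulVec]
    have hw0 : w ≠ 0 := by
      intro h; rw [h, mulVec_zero] at hwv; exact hv0 hwv.symm
    have h1 := posRe_re_pos (halfDiff_mem hX hX) hw0
    rw [← act_sub g hX hX, ← mulVec_mulVec, ← mulVec_mulVec, hwv, dotProduct_mulVec,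
      ← star_mulVec, hwv] at h1
    rw [← hre]
    have e : star x ⬝ᵥ (halfDiff (act g X) (act g X)).map Complex.re *ᵥ x =
        (star v ⬝ᵥ halfDiff (act g X) (act g X) *ᵥ v).re := by
      simp [dotProduct, mulVec, hv, Complex.re_sum, Finset.mul_sum, him]
    rw [e]
    exact h1

theorem autJ_mul {n : ℕ} (g h : Sp n) {X : Matrix (Fin n) (Fin n) ℂ} (hX : X ∈ siegelUpper n) :
    autJ (g * h) X = autJ g (act h X) * autJ h X := by
  obtain ⟨_, _, c, d⟩ := blk_mul g h
  have h1 : act h X * autJ h X = blkA h * X + blkB h := by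
    rw [act, nonsing_inv_mul_cancel_right _ _ (autJ_isUnit h hX)]
  rw [autJ, autJ, Matrix.add_mul, Matrix.mul_assoc, h1, autJ, c, d]
  noncomm_ring

theorem act_mul {n : ℕ} (g h : Sp n) {X : Matrix (Fin n) (Fin n) ℂ} (hX : X ∈ siegelUpper n) :
    act (g * h) X = act g (act h X) := by
  obtain ⟨a, b, _, _⟩ := blk_mul g h
  have h1 : act h X * autJ h X = blkA h * X + blkB h := by
    rw [act, nonsing_inv_mul_cancel_right _ _ (autJ_isUnit h hX)]
  have h2 : blkA (g * h) * X + blkB (g * h) = (blkA g * act h X + blkB g) * autJ h X := by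
    rw [Matrix.add_mul, Matrix.mul_assoc, h1, a, b, autJ]
    noncomm_ring
  rw [act, autJ_mul g h hX, h2, Matrix.mul_inv_rev, Matrix.mul_assoc, mul_nonsing_inv_cancel_left _ _
    (autJ_isUnit h hX)]
  rfl

theorem autJ_one {n : ℕ} (X : Matrix (Fin n) (Fin n) ℂ) : autJ 1 X = 1 := by
  obtain ⟨_, _, c, d⟩ := blk_one n
  simp [autJ, c, d]

theorem act_one {n : ℕ} (X : Matrix (Fin n) (Fin n) ℂ) : act 1 X = X := by
  obtain ⟨a, b, _, _⟩ := blk_one n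
  simp [act, autJ_one, a, b]


/-- `α_Ω(g) = det J(g,Ω) / |det J(g,Ω)|`. -/
def alpha {n : ℕ} (Ω : Matrix (Fin n) (Fin n) ℂ) (g : Sp n) : ℂ :=
  (autJ g Ω).det / (‖(autJ g Ω).det‖ : ℂ)

/-- `ε(g;Ω',Ω) = det^{-1/2}((g·Ω' - conj(g·Ω))/2i) det^{1/2}((Ω' - conj Ω)/2i)
|det J(g,Ω')|^{-1/2} |det J(g,Ω)|^{-1/2}`. -/
def eps {n : ℕ} (g : Sp n) (Ω' Ω : Matrix (Fin n) (Fin n) ℂ) : ℂ :=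
  (detSqrt n (halfDiff (act g Ω') (act g Ω)))⁻¹ * detSqrt n (halfDiff Ω' Ω) *
    ((‖(autJ g Ω').det‖ ^ (-1 / 2 : ℝ) * ‖(autJ g Ω).det‖ ^ (-1 / 2 : ℝ) : ℝ) : ℂ)

/-- `β_Ω(g₁,g₂) = ε(g₁;Ω,g₂·Ω)`. -/
def beta {n : ℕ} (Ω : Matrix (Fin n) (Fin n) ℂ) (g₁ g₂ : Sp n) : ℂ := eps g₁ Ω (act g₂ Ω)

theorem rpow_half_sq {x : ℝ} (hx : 0 < x) : (x ^ (-1 / 2 : ℝ)) ^ 2 = x⁻¹ := by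
  rw [← Real.rpow_natCast, ← Real.rpow_mul hx.le]
  norm_num [Real.rpow_neg_one]

theorem alpha_mul {n : ℕ} {Ω : Matrix (Fin n) (Fin n) ℂ} (hΩ : Ω ∈ siegelUpper n) (g h : Sp n) :
    alpha Ω (g * h) = alpha (act h Ω) g * alpha Ω h := by
  simp only [alpha, autJ_mul g h hΩ, det_mul, norm_mul, Complex.ofReal_mul]
  rw [div_mul_div_comm]

theorem alpha_conj {n : ℕ} {Ω : Matrix (Fin n) (Fin n) ℂ} (hΩ : Ω ∈ siegelUpper n) (g : Sp n) :
    alpha Ω g * (starRingEnd ℂ) (alpha Ω g) = 1 := by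
  have h := autJ_det_ne_zero g hΩ
  rw [Complex.mul_conj, Complex.normSq_eq_norm_sq, alpha, norm_div, Complex.norm_real, norm_norm,
    div_self (norm_ne_zero_iff.2 h)]
  simp

theorem alpha_ne_zero {n : ℕ} {Ω : Matrix (Fin n) (Fin n) ℂ} (hΩ : Ω ∈ siegelUpper n) (g : Sp n) :
    alpha Ω g ≠ 0 := left_ne_zero_of_mul (by rw [alpha_conj hΩ g]; exact one_ne_zero)

theorem eps_sq {n : ℕ} (g : Sp n) {X Y : Matrix (Fin n) (Fin n) ℂ} (hX : X ∈ siegelUpper n)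
    (hY : Y ∈ siegelUpper n) : eps g X Y ^ 2 = alpha X g * (starRingEnd ℂ) (alpha Y g) := by
  have h := congrArg Matrix.det (act_sub g hX hY)
  rw [det_mul, det_mul, det_conjTranspose] at h
  have a := autJ_det_ne_zero g hX
  have b := autJ_det_ne_zero g hY
  have c := posRe_det_ne_zero (halfDiff_mem hX hY)
  have d := posRe_det_ne_zero (halfDiff_mem (act_mem g hX) (act_mem g hY))
  have e1 := rpow_half_sq (norm_pos_iff.2 a)
  have e2 := rpow_half_sq (norm_pos_iff.2 b)
  rw [eps, mul_pow, mul_pow, inv_pow, detSqrt_sq (halfDiff_mem (act_mem g hX) (act_mem g hY)),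
    detSqrt_sq (halfDiff_mem hX hY), ← h, ← Complex.ofReal_pow, mul_pow, e1, e2, alpha, alpha]
  have a' : (‖(autJ g X).det‖ : ℂ) ≠ 0 := by simpa using a
  have b' : (‖(autJ g Y).det‖ : ℂ) ≠ 0 := by simpa using b
  rw [map_div₀, Complex.conj_ofReal, Complex.star_def]
  push_cast
  field_simp

theorem eps_ne_zero {n : ℕ} (g : Sp n) {X Y : Matrix (Fin n) (Fin n) ℂ} (hX : X ∈ siegelUpper n)
    (hY : Y ∈ siegelUpper n) : eps g X Y ≠ 0 := by
  intro h
  have := eps_sq g hX hY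
  rw [h] at this
  have h2 := alpha_ne_zero hX g
  have h3 := alpha_ne_zero hY g
  simp [h2, h3] at this

theorem eps_mul {n : ℕ} (g h : Sp n) {X Y : Matrix (Fin n) (Fin n) ℂ} (hX : X ∈ siegelUpper n)
    (hY : Y ∈ siegelUpper n) : eps (g * h) X Y = eps g (act h X) (act h Y) * eps h X Y := by
  have d := detSqrt_ne_zero (halfDiff_mem (act_mem h hX) (act_mem h hY))
  simp only [eps, act_mul g h hX, act_mul g h hY, autJ_mul g h hX, autJ_mul g h hY, det_mul, norm_mul]
  rw [Real.mul_rpow (norm_nonneg _) (norm_nonneg _), Real.mul_rpow (norm_nonneg _) (norm_nonneg _)]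
  push_cast
  field_simp

theorem eps_one {n : ℕ} {X Y : Matrix (Fin n) (Fin n) ℂ} (hX : X ∈ siegelUpper n)
    (hY : Y ∈ siegelUpper n) : eps 1 X Y = 1 := by
  have d := detSqrt_ne_zero (halfDiff_mem hX hY)
  simp [eps, act_one, autJ_one, d]

theorem detSqrt_halfDiff_self {n : ℕ} {X : Matrix (Fin n) (Fin n) ℂ} (hX : X ∈ siegelUpper n) :
    ∃ r : ℝ, 0 < r ∧ (halfDiff X X).det = (r : ℂ) ∧ detSqrt n (halfDiff X X) = (Real.sqrt r : ℝ) := by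
  have e : halfDiff X X = (X.map Complex.im).map Complex.ofReal := by
    ext i j; apply Complex.ext <;> simp [halfDiff, Complex.mul_re, Complex.mul_im]
    ring
  have hm := halfDiff_mem hX hX
  rw [e] at hm ⊢
  exact ⟨_, hX.2.det_pos, (RingHom.map_det Complex.ofRealHom (X.map Complex.im)).symm,
    detSqrt_ofReal hm⟩

theorem eps_self {n : ℕ} (g : Sp n) {X : Matrix (Fin n) (Fin n) ℂ} (hX : X ∈ siegelUpper n) :
    eps g X X = 1 := by
  obtain ⟨r, hr, h1, h2⟩ := detSqrt_halfDiff_self hX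
  obtain ⟨s, hs, h3, h4⟩ := detSqrt_halfDiff_self (act_mem g hX)
  have h := congrArg Matrix.det (act_sub g hX hX)
  rw [det_mul, det_mul, det_conjTranspose, h1, h3] at h
  have hj := norm_pos_iff.2 (autJ_det_ne_zero g hX)
  have h5 : r = s * ‖(autJ g X).det‖ ^ 2 := by
    have : star (autJ g X).det * (s : ℂ) * (autJ g X).det = ((s * ‖(autJ g X).det‖ ^ 2 : ℝ) : ℂ) := by
      rw [← Complex.normSq_eq_norm_sq]
      push_cast
      rw [Complex.normSq_eq_conj_mul_self, Complex.star_def]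
      ring
    rw [this] at h
    exact_mod_cast h.symm
  rw [eps, h2, h4, ← pow_two, rpow_half_sq hj, ← Complex.ofReal_inv, ← Complex.ofReal_mul,
    ← Complex.ofReal_mul, h5, Real.sqrt_mul hs.le, Real.sqrt_sq hj.le]
  have := (Real.sqrt_pos.2 hs).ne'
  have := hj.ne'
  norm_cast
  field_simp

theorem continuousOn_act {n : ℕ} (g : Sp n) : ContinuousOn (act g) (siegelUpper n) := by
  have h : Continuous (autJ g) := by unfold autJ; fun_prop
  have h2 : ContinuousOn (fun X => (autJ g X)⁻¹) (siegelUpper n) := by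
    simp only [Matrix.inv_def, Ring.inverse_eq_inv']
    exact (h.matrix_det.continuousOn.inv₀ fun X hX => autJ_det_ne_zero g hX).smul
      h.matrix_adjugate.continuousOn
  unfold act
  exact ContinuousOn.mul (by fun_prop) h2

theorem continuousOn_eps {n : ℕ} (g : Sp n) {T : Type*} [TopologicalSpace T] {s : Set T}
    {u v : T → Matrix (Fin n) (Fin n) ℂ} (hu : ContinuousOn u s) (hv : ContinuousOn v s)
    (hu' : ∀ t ∈ s, u t ∈ siegelUpper n) (hv' : ∀ t ∈ s, v t ∈ siegelUpper n) :
    ContinuousOn (fun t => eps g (u t) (v t)) s := by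
  have hc : Continuous (starRingEnd ℂ) := Complex.continuous_conj
  have hs : ContinuousOn (detSqrt n) (posRe n) := (detSqrt_differentiableOn n).continuousOn
  have hj : Continuous (fun X => (autJ g X).det) := by
    apply Continuous.matrix_det; unfold autJ; fun_prop
  have ha := continuousOn_act g
  have hau : ContinuousOn (fun t => act g (u t)) s := ha.comp hu hu'
  have hav : ContinuousOn (fun t => act g (v t)) s := ha.comp hv hv'
  have hd : ∀ w z : T → Matrix (Fin n) (Fin n) ℂ, ContinuousOn w s → ContinuousOn z s →
      (∀ t ∈ s, w t ∈ siegelUpper n) → (∀ t ∈ s, z t ∈ siegelUpper n) →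
      ContinuousOn (fun t => detSqrt n (halfDiff (w t) (z t))) s := by
    intro w z hw hz hw' hz'
    have h1 : ContinuousOn (fun t => halfDiff (w t) (z t)) s := by
      unfold halfDiff
      have h2 : ContinuousOn (fun t => (z t).map (starRingEnd ℂ)) s :=
        (continuous_id.matrix_map hc).comp_continuousOn hz
      exact ContinuousOn.const_smul (hw.sub h2) (1 / (2 * Complex.I))
    exact ContinuousOn.comp (g := detSqrt n) (t := posRe n) hs h1
      (fun t ht => halfDiff_mem (hw' t ht) (hz' t ht))
  have n1 : ∀ w : T → Matrix (Fin n) (Fin n) ℂ, ContinuousOn w s → (∀ t ∈ s, w t ∈ siegelUpper n) →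
      ContinuousOn (fun t => ‖(autJ g (w t)).det‖ ^ (-1 / 2 : ℝ)) s := fun w hw hw' =>
    (hj.norm.comp_continuousOn hw).rpow_const
      fun t ht => Or.inl (norm_ne_zero_iff.2 (autJ_det_ne_zero g (hw' t ht)))
  have p1 := hd _ _ hau hav (fun t ht => act_mem g (hu' t ht)) (fun t ht => act_mem g (hv' t ht))
  have p2 := hd _ _ hu hv hu' hv'
  have p3 : ContinuousOn (fun t => ((‖(autJ g (u t)).det‖ ^ (-1 / 2 : ℝ) *
      ‖(autJ g (v t)).det‖ ^ (-1 / 2 : ℝ) : ℝ) : ℂ)) s :=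
    Complex.continuous_ofReal.comp_continuousOn ((n1 u hu hu').mul (n1 v hv hv'))
  exact ((p1.inv₀ fun t ht => detSqrt_ne_zero
    (halfDiff_mem (act_mem g (hu' t ht)) (act_mem g (hv' t ht)))).mul p2).mul p3

theorem siegelUpper_convex (n : ℕ) : Convex ℝ (siegelUpper n) := by
  have e : ∀ (t : ℝ) (X : Matrix (Fin n) (Fin n) ℂ), (t • X).map Complex.im = t • X.map Complex.im := by
    intro t X; ext i j; simp
  intro X hX Y hY a b ha hb hab
  refine ⟨(hX.1.smul a).add (hY.1.smul b), ?_⟩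
  have e2 : (a • X + b • Y).map Complex.im = a • X.map Complex.im + b • Y.map Complex.im := by
    ext i j; simp
  rw [e2]
  rcases ha.eq_or_lt with h | h
  · subst h
    have hb1 : b = 1 := by linarith
    subst hb1
    simpa using hY.2
  · exact (hX.2.smul h).add_posSemidef (hY.2.posSemidef.smul hb)

theorem eps_triple {n : ℕ} (g : Sp n) {X Y Z : Matrix (Fin n) (Fin n) ℂ} (hX : X ∈ siegelUpper n)
    (hY : Y ∈ siegelUpper n) (hZ : Z ∈ siegelUpper n) :
    eps g X Y * eps g Z X = eps g Z Y := by
  have hx : ∀ W ∈ siegelUpper n, ∀ t ∈ Set.Icc (0 : ℝ) 1, (1 - t) • X + t • W ∈ siegelUpper n :=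
    fun W hW t ht => siegelUpper_convex n hX hW (by linarith [ht.2]) ht.1 (by ring)
  have hcx : ∀ W : Matrix (Fin n) (Fin n) ℂ,
      ContinuousOn (fun t : ℝ => (1 - t) • X + t • W) (Set.Icc 0 1) := fun W => by fun_prop
  have hcc : ContinuousOn (fun _ : ℝ => X) (Set.Icc 0 1) := continuousOn_const
  have f1 := continuousOn_eps g hcc (hcx Y) (fun _ _ => hX) (hx Y hY)
  have f2 := continuousOn_eps g (hcx Z) hcc (hx Z hZ) (fun _ _ => hX)
  have f3 := continuousOn_eps g (hcx Z) (hcx Y) (hx Z hZ) (hx Y hY)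
  have key := isPreconnected_Icc.eq_of_sq_eq (f1.mul f2) f3 (fun t ht => by
      have := alpha_conj hX g
      simp only [Pi.pow_apply, Pi.mul_apply]
      rw [mul_pow, eps_sq g hX (hx Y hY t ht), eps_sq g (hx Z hZ t ht) hX,
        eps_sq g (hx Z hZ t ht) (hx Y hY t ht)]
      linear_combination (alpha ((1 - t) • X + t • Z) g *
        (starRingEnd ℂ) (alpha ((1 - t) • X + t • Y) g)) * this)
    (fun {t} ht => eps_ne_zero g (hx Z hZ t ht) (hx Y hY t ht))
    (y := 0) (by simp) (by simp [eps_self g hX])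
  have := key (show (1 : ℝ) ∈ Set.Icc 0 1 by simp)
  simpa using this

/-- The base point `iIₙ`. -/
def basePt (n : ℕ) : Matrix (Fin n) (Fin n) ℂ := Complex.I • 1

theorem basePt_mem (n : ℕ) : basePt n ∈ siegelUpper n := by
  refine ⟨isSymm_one.smul _, ?_⟩
  have : (basePt n).map Complex.im = 1 := by
    ext i j; simp [basePt, Matrix.one_apply]; split_ifs <;> simp
  rw [this]; exact Matrix.PosDef.one

theorem beta_sq {n : ℕ} {Ω : Matrix (Fin n) (Fin n) ℂ} (hΩ : Ω ∈ siegelUpper n) (g h : Sp n) :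
    beta Ω g h ^ 2 = alpha Ω h * (alpha Ω (g * h))⁻¹ * alpha Ω g := by
  have h1 := act_mem h hΩ
  rw [beta, eps_sq g hΩ h1, alpha_mul hΩ, eq_inv_of_mul_eq_one_right (alpha_conj h1 g)]
  have := alpha_ne_zero hΩ h
  have := alpha_ne_zero h1 g
  field_simp

theorem beta_cocycle {n : ℕ} {Ω : Matrix (Fin n) (Fin n) ℂ} (hΩ : Ω ∈ siegelUpper n)
    (g₁ g₂ g₃ : Sp n) :
    beta Ω (g₁ * g₂) g₃ * beta Ω g₁ g₂ = beta Ω g₁ (g₂ * g₃) * beta Ω g₂ g₃ := by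
  have h2 := act_mem g₂ hΩ
  have h3 := act_mem g₃ hΩ
  have h23 := act_mem g₂ h3
  rw [beta, beta, beta, beta, eps_mul g₁ g₂ hΩ h3, act_mul g₂ g₃ hΩ, ← eps_triple g₁ h2 h23 hΩ]
  ring

/-- The two-fold cover `G_* = {(g,ε) : ε² = α_{iI}(g)⁻¹}` of `Sp(n,ℝ)` (so `|ε| = 1`), with the
multiplication `(g,ε)(h,η) = (gh, ε η β_{iI}(g,h))`. -/
@[ext]
structure Mp (n : ℕ) where
  g : Sp n
  ε : ℂ
  sq : ε ^ 2 = (alpha (basePt n) g)⁻¹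

namespace Mp

variable {n : ℕ}

theorem ε_ne_zero (x : Mp n) : x.ε ≠ 0 := by
  intro h
  have := x.sq
  rw [h] at this
  exact alpha_ne_zero (basePt_mem n) x.g (by simpa using this.symm)

instance : Mul (Mp n) where
  mul x y := ⟨x.g * y.g, x.ε * y.ε * beta (basePt n) x.g y.g, by
    have a := alpha_ne_zero (basePt_mem n) x.g
    have b := alpha_ne_zero (basePt_mem n) y.g
    rw [mul_pow, mul_pow, x.sq, y.sq, beta_sq (basePt_mem n)]
    field_simp⟩

instance : One (Mp n) where
  one := ⟨1, 1, by simp [alpha, autJ_one]⟩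

instance : Inv (Mp n) where
  inv x := ⟨x.g⁻¹, (x.ε * beta (basePt n) x.g⁻¹ x.g)⁻¹, by
    have a := alpha_ne_zero (basePt_mem n) x.g
    have b := alpha_ne_zero (basePt_mem n) x.g⁻¹
    have c : alpha (basePt n) (1 : Sp n) = 1 := by simp [alpha, autJ_one]
    rw [inv_pow, mul_pow, x.sq, beta_sq (basePt_mem n), inv_mul_cancel, c]
    field_simp⟩

theorem mul_g (x y : Mp n) : (x * y).g = x.g * y.g := rfl
theorem mul_ε (x y : Mp n) : (x * y).ε = x.ε * y.ε * beta (basePt n) x.g y.g := rfl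
theorem one_g : (1 : Mp n).g = 1 := rfl
theorem one_ε : (1 : Mp n).ε = 1 := rfl
theorem inv_g (x : Mp n) : (x⁻¹).g = x.g⁻¹ := rfl
theorem inv_ε (x : Mp n) : (x⁻¹).ε = (x.ε * beta (basePt n) x.g⁻¹ x.g)⁻¹ := rfl

instance : Group (Mp n) :=
  Group.ofLeftAxioms
    (fun x y z => by
      have h := beta_cocycle (basePt_mem n) x.g y.g z.g
      apply Mp.ext
      · simp only [mul_g, mul_assoc]
      · simp only [mul_g, mul_ε]
        linear_combination (x.ε * y.ε * z.ε) * h)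
    (fun x => by
      apply Mp.ext
      · simp only [mul_g, one_g, one_mul]
      · simp only [mul_ε, one_ε, one_g, one_mul, beta]
        rw [eps_one (basePt_mem n) (act_mem _ (basePt_mem n)), mul_one])
    (fun x => by
      have a := x.ε_ne_zero
      have b : beta (basePt n) x.g⁻¹ x.g ≠ 0 :=
        eps_ne_zero _ (basePt_mem n) (act_mem _ (basePt_mem n))
      apply Mp.ext
      · simp only [mul_g, inv_g, one_g, inv_mul_cancel]
      · simp only [mul_ε, inv_ε, inv_g, one_ε]
        field_simp)

instance : TopologicalSpace (Mp n) :=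
  TopologicalSpace.induced (fun x => (x.g, x.ε)) inferInstance

/-- The covering projection `π_*(g,ε) = g`. -/
def proj (n : ℕ) : Mp n →* Sp n where
  toFun x := x.g
  map_one' := rfl
  map_mul' _ _ := rfl

end Mp


/-- The automorphic factor `J_{1/2}((g,ε),Ω) = ε⁻¹ ε(g;Ω,iI) |det J(g,Ω)|^{1/2}` of weight `1/2`. -/
def Jhalf {n : ℕ} (x : Mp n) (Ω : Matrix (Fin n) (Fin n) ℂ) : ℂ :=
  x.ε⁻¹ * eps x.g Ω (basePt n) * ((‖(autJ x.g Ω).det‖ ^ (1 / 2 : ℝ) : ℝ) : ℂ)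

/-- The first component `λA + μC` of `(λ,μ)g`. -/
def tl {n m : ℕ} (l u : Matrix (Fin m) (Fin n) ℝ) (g : Sp n) : Matrix (Fin m) (Fin n) ℝ :=
  l * g.1.toBlocks₁₁ + u * g.1.toBlocks₂₁

/-- The second component `λB + μD` of `(λ,μ)g`. -/
def tu {n m : ℕ} (l u : Matrix (Fin m) (Fin n) ℝ) (g : Sp n) : Matrix (Fin m) (Fin n) ℝ :=
  l * g.1.toBlocks₁₂ + u * g.1.toBlocks₂₂

theorem tl_tu_mul {n m : ℕ} (l u : Matrix (Fin m) (Fin n) ℝ) (g h : Sp n) :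
    tl l u (g * h) = tl (tl l u g) (tu l u g) h ∧ tu l u (g * h) = tu (tl l u g) (tu l u g) h := by
  have e : ((g * h : Sp n) : Matrix (Fin n ⊕ Fin n) (Fin n ⊕ Fin n) ℝ) =
      fromBlocks g.1.toBlocks₁₁ g.1.toBlocks₁₂ g.1.toBlocks₂₁ g.1.toBlocks₂₂ *
      fromBlocks h.1.toBlocks₁₁ h.1.toBlocks₁₂ h.1.toBlocks₂₁ h.1.toBlocks₂₂ := by
    rw [fromBlocks_toBlocks, fromBlocks_toBlocks]; rfl
  rw [fromBlocks_multiply] at e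
  constructor <;> simp only [tl, tu, e, toBlocks_fromBlocks₁₁, toBlocks_fromBlocks₁₂,
    toBlocks_fromBlocks₂₁, toBlocks_fromBlocks₂₂, Matrix.mul_add, Matrix.add_mul,
    Matrix.mul_assoc] <;> abel

theorem tl_tu_one {n m : ℕ} (l u : Matrix (Fin m) (Fin n) ℝ) :
    tl l u (1 : Sp n) = l ∧ tu l u (1 : Sp n) = u := by
  have h : ((1 : Sp n) : Matrix (Fin n ⊕ Fin n) (Fin n ⊕ Fin n) ℝ) = fromBlocks 1 0 0 1 := by
    simp
  constructor <;> simp only [tl, tu, h, toBlocks_fromBlocks₁₁,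
    toBlocks_fromBlocks₁₂, toBlocks_fromBlocks₂₁, toBlocks_fromBlocks₂₂] <;> simp

theorem form_inv {n m : ℕ} (l u l' u' : Matrix (Fin m) (Fin n) ℝ) (g : Sp n) :
    tl l u g * (tu l' u' g)ᵀ - tu l u g * (tl l' u' g)ᵀ = l * u'ᵀ - u * l'ᵀ := by
  have h := SymplecticGroup.transpose_mem g.2
  rw [← fromBlocks_toBlocks g.1, fromBlocks_transpose, SymplecticGroup.fromBlocks_mem_iff] at h
  simp only [transpose_transpose] at h
  obtain ⟨h1, h2, h3⟩ := h
  have h4 : g.1.toBlocks₂₂ * (g.1.toBlocks₁₁)ᵀ - g.1.toBlocks₂₁ * (g.1.toBlocks₁₂)ᵀ = 1 := by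
    have := congrArg Matrix.transpose h3
    simpa using this
  simp only [tl, tu, transpose_add, transpose_mul]
  calc _ = l * (g.1.toBlocks₁₁ * (g.1.toBlocks₁₂)ᵀ - g.1.toBlocks₁₂ * (g.1.toBlocks₁₁)ᵀ) * l'ᵀ
      + l * (g.1.toBlocks₁₁ * (g.1.toBlocks₂₂)ᵀ - g.1.toBlocks₁₂ * (g.1.toBlocks₂₁)ᵀ) * u'ᵀ
      - u * (g.1.toBlocks₂₂ * (g.1.toBlocks₁₁)ᵀ - g.1.toBlocks₂₁ * (g.1.toBlocks₁₂)ᵀ) * l'ᵀ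
      + u * (g.1.toBlocks₂₁ * (g.1.toBlocks₂₂)ᵀ - g.1.toBlocks₂₂ * (g.1.toBlocks₂₁)ᵀ) * u'ᵀ := by
        simp only [Matrix.mul_add, Matrix.add_mul, Matrix.mul_sub, Matrix.sub_mul, Matrix.mul_assoc]
        abel
    _ = _ := by rw [h1, h2, h3, h4]; simp

theorem tl_tu_add {n m : ℕ} (l u l' u' : Matrix (Fin m) (Fin n) ℝ) (g : Sp n) :
    tl (l + l') (u + u') g = tl l u g + tl l' u' g ∧
    tu (l + l') (u + u') g = tu l u g + tu l' u' g := by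
  constructor <;> simp only [tl, tu, Matrix.add_mul] <;> abel

theorem tl_tu_neg {n m : ℕ} (l u : Matrix (Fin m) (Fin n) ℝ) (g : Sp n) :
    tl (-l) (-u) g = -tl l u g ∧ tu (-l) (-u) g = -tu l u g := by
  constructor <;> simp only [tl, tu, Matrix.neg_mul] <;> abel

/-- The group `G^J_* = G_* ⋉ H_ℝ^{(n,m)}` of pairs `(g_*, (λ,μ;κ))` with `κ + μ ᵗλ` symmetric; the
product of `(g,(λ,μ;κ))` and `(g',(λ',μ';κ'))` is
`(gg', (λ~ + λ', μ~ + μ'; κ + κ' + λ~ ᵗμ' - μ~ ᵗλ'))` with `(λ~,μ~) = (λ,μ)g'`. -/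
@[ext]
structure JacobiMp (n m : ℕ) where
  g : Mp n
  lam : Matrix (Fin m) (Fin n) ℝ
  mu : Matrix (Fin m) (Fin n) ℝ
  kap : Matrix (Fin m) (Fin m) ℝ
  symm : (kap + mu * lamᵀ).IsSymm

namespace JacobiMp

variable {n m : ℕ}

theorem symm_eq (x : JacobiMp n m) : x.kapᵀ = x.kap + x.mu * x.lamᵀ - x.lam * x.muᵀ := by
  have h := x.symm
  simp only [Matrix.IsSymm, transpose_add, transpose_mul, transpose_transpose] at h
  rw [← h]; abel

theorem mul_symm (x y : JacobiMp n m) :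
    ((x.kap + y.kap + tl x.lam x.mu y.g.g * y.muᵀ - tu x.lam x.mu y.g.g * y.lamᵀ) +
      (tu x.lam x.mu y.g.g + y.mu) * (tl x.lam x.mu y.g.g + y.lam)ᵀ).IsSymm := by
  have h := form_inv x.lam x.mu x.lam x.mu y.g.g
  simp only [Matrix.IsSymm, transpose_add, transpose_sub, transpose_mul, transpose_transpose,
    x.symm_eq, y.symm_eq, Matrix.add_mul, Matrix.mul_add]
  rw [eq_sub_iff_add_eq] at h
  have h' : tl x.lam x.mu y.g.g * (tu x.lam x.mu y.g.g)ᵀ =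
    x.lam * x.muᵀ - x.mu * x.lamᵀ + tu x.lam x.mu y.g.g * (tl x.lam x.mu y.g.g)ᵀ := by
    rw [← form_inv x.lam x.mu x.lam x.mu y.g.g]; abel
  rw [h']
  abel

instance : Mul (JacobiMp n m) where
  mul x y := ⟨x.g * y.g, tl x.lam x.mu y.g.g + y.lam, tu x.lam x.mu y.g.g + y.mu,
    x.kap + y.kap + tl x.lam x.mu y.g.g * y.muᵀ - tu x.lam x.mu y.g.g * y.lamᵀ, mul_symm x y⟩

instance : One (JacobiMp n m) where
  one := ⟨1, 0, 0, 0, by simp [Matrix.IsSymm]⟩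

instance : Inv (JacobiMp n m) where
  inv x := ⟨x.g⁻¹, -tl x.lam x.mu x.g.g⁻¹, -tu x.lam x.mu x.g.g⁻¹, -x.kapᵀ, by
    have h := form_inv x.lam x.mu x.lam x.mu x.g.g⁻¹
    have h' : tl x.lam x.mu x.g.g⁻¹ * (tu x.lam x.mu x.g.g⁻¹)ᵀ =
      x.lam * x.muᵀ - x.mu * x.lamᵀ + tu x.lam x.mu x.g.g⁻¹ * (tl x.lam x.mu x.g.g⁻¹)ᵀ := by
      rw [← h]; abel
    simp only [Matrix.IsSymm, transpose_add, transpose_sub, transpose_neg, transpose_mul,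
      transpose_transpose, Matrix.neg_mul, Matrix.mul_neg, neg_neg, h', x.symm_eq]
    abel⟩

theorem mul_def (x y : JacobiMp n m) : x * y = ⟨x.g * y.g, tl x.lam x.mu y.g.g + y.lam,
    tu x.lam x.mu y.g.g + y.mu,
    x.kap + y.kap + tl x.lam x.mu y.g.g * y.muᵀ - tu x.lam x.mu y.g.g * y.lamᵀ, mul_symm x y⟩ := rfl

theorem inv_def (x : JacobiMp n m) : x⁻¹ = ⟨x.g⁻¹, -tl x.lam x.mu x.g.g⁻¹, -tu x.lam x.mu x.g.g⁻¹,
    -x.kapᵀ, (x⁻¹).symm⟩ := rfl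

theorem one_def : (1 : JacobiMp n m) = ⟨1, 0, 0, 0, (1 : JacobiMp n m).symm⟩ := rfl

instance : Group (JacobiMp n m) :=
  Group.ofLeftAxioms
    (fun x y z => by
      obtain ⟨a1, a2⟩ := tl_tu_add (tl x.lam x.mu y.g.g) (tu x.lam x.mu y.g.g) y.lam y.mu z.g.g
      obtain ⟨b1, b2⟩ := tl_tu_mul x.lam x.mu y.g.g z.g.g
      have f := form_inv (tl x.lam x.mu y.g.g) (tu x.lam x.mu y.g.g) y.lam y.mu z.g.g
      rw [mul_def, mul_def, mul_def, mul_def]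
      ext1
      · exact mul_assoc _ _ _
      · simp only [Mp.mul_g, a1, b1]; abel
      · simp only [Mp.mul_g, a2, b2]; abel
      · simp only [Mp.mul_g, a1, a2, b1, b2, transpose_add, Matrix.mul_add, Matrix.add_mul]
        have f' : tl x.lam x.mu y.g.g * y.muᵀ =
          tl (tl x.lam x.mu y.g.g) (tu x.lam x.mu y.g.g) z.g.g * (tu y.lam y.mu z.g.g)ᵀ -
          tu (tl x.lam x.mu y.g.g) (tu x.lam x.mu y.g.g) z.g.g * (tl y.lam y.mu z.g.g)ᵀ +
          tu x.lam x.mu y.g.g * y.lamᵀ := by rw [f]; abel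
        rw [f']
        abel)
    (fun x => by
      rw [one_def, mul_def]
      ext1
      · exact one_mul _
      · simp [tl]
      · simp [tu]
      · simp [tl, tu])
    (fun x => by
      obtain ⟨a1, a2⟩ := tl_tu_neg (tl x.lam x.mu x.g.g⁻¹) (tu x.lam x.mu x.g.g⁻¹) x.g.g
      obtain ⟨b1, b2⟩ := tl_tu_mul x.lam x.mu x.g.g⁻¹ x.g.g
      obtain ⟨c1, c2⟩ := tl_tu_one x.lam x.mu
      rw [inv_mul_cancel] at b1 b2
      rw [inv_def, mul_def, one_def]
      ext1
      · exact inv_mul_cancel _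
      · simp only [a1, ← b1, c1]; abel
      · simp only [a2, ← b2, c2]; abel
      · simp only [a1, a2, ← b1, ← b2, c1, c2, x.symm_eq, Matrix.neg_mul]; abel)

instance : TopologicalSpace (JacobiMp n m) :=
  TopologicalSpace.induced (fun x => (x.g, x.lam, x.mu, x.kap)) inferInstance

end JacobiMp

/-- The Siegel–Jacobi space `ℍ_n × ℂ^{(m,n)}`. -/
def siegelJacobi (n m : ℕ) : Set (Matrix (Fin n) (Fin n) ℂ × Matrix (Fin m) (Fin n) ℂ) :=
  siegelUpper n ×ˢ Set.univ

/-- `Z + λΩ + μ`. -/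
def shift {n m : ℕ} (x : JacobiMp n m)
    (p : Matrix (Fin n) (Fin n) ℂ × Matrix (Fin m) (Fin n) ℂ) : Matrix (Fin m) (Fin n) ℂ :=
  p.2 + x.lam.map Complex.ofReal * p.1 + x.mu.map Complex.ofReal

/-- The action `(Ω,Z) ↦ (g·Ω, (Z + λΩ + μ)(CΩ + D)⁻¹)`. -/
def jact {n m : ℕ} (x : JacobiMp n m)
    (p : Matrix (Fin n) (Fin n) ℂ × Matrix (Fin m) (Fin n) ℂ) :
    Matrix (Fin n) (Fin n) ℂ × Matrix (Fin m) (Fin n) ℂ :=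
  (act x.g.g p.1, shift x p * (autJ x.g.g p.1)⁻¹)

/-- `σ(M (Z+λΩ+μ)(CΩ+D)⁻¹ C ᵗ(Z+λΩ+μ))`. -/
def quadA {n m : ℕ} (M : Matrix (Fin m) (Fin m) ℂ) (x : JacobiMp n m)
    (p : Matrix (Fin n) (Fin n) ℂ × Matrix (Fin m) (Fin n) ℂ) : ℂ :=
  (M * (shift x p * (autJ x.g.g p.1)⁻¹ * blkC x.g.g * (shift x p)ᵀ)).trace

/-- `σ(M (λ Ω ᵗλ + 2 λ ᵗZ + κ + μ ᵗλ))`. -/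
def quadB {n m : ℕ} (M : Matrix (Fin m) (Fin m) ℂ) (x : JacobiMp n m)
    (p : Matrix (Fin n) (Fin n) ℂ × Matrix (Fin m) (Fin n) ℂ) : ℂ :=
  (M * (x.lam.map Complex.ofReal * p.1 * (x.lam.map Complex.ofReal)ᵀ +
    (2 : ℂ) • (x.lam.map Complex.ofReal * p.2ᵀ) +
    (x.kap + x.mu * x.lamᵀ).map Complex.ofReal)).trace

/-- The automorphic factor `J_{k,M}` of weight `k/2` and index `M`. -/
def jacobiFactor {n m : ℕ} (k : ℤ) (M : Matrix (Fin m) (Fin m) ℂ) (x : JacobiMp n m)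
    (p : Matrix (Fin n) (Fin n) ℂ × Matrix (Fin m) (Fin n) ℂ) : ℂ :=
  Complex.exp (2 * Real.pi * Complex.I * quadA M x p) *
    Complex.exp (-(2 * Real.pi * Complex.I * quadB M x p)) * Jhalf x.g p.1 ^ k

/-- The automorphic factor `J*_M`; it has weight `m/2` and index `M/2`. -/
def jStar {n m : ℕ} (M : Matrix (Fin m) (Fin m) ℂ) (x : JacobiMp n m)
    (p : Matrix (Fin n) (Fin n) ℂ × Matrix (Fin m) (Fin n) ℂ) : ℂ :=
  Complex.exp (Real.pi * Complex.I * quadA M x p) *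
    Complex.exp (-(Real.pi * Complex.I * quadB M x p)) * Jhalf x.g p.1 ^ m

/-- Matrices with integral entries. -/
def IsInt {a b : Type*} (X : Matrix a b ℝ) : Prop := ∃ N : Matrix a b ℤ, X = N.map Int.cast

theorem IsInt.add {a b : Type*} {X Y : Matrix a b ℝ} (hX : IsInt X) (hY : IsInt Y) :
    IsInt (X + Y) := by
  obtain ⟨N, rfl⟩ := hX; obtain ⟨K, rfl⟩ := hY
  exact ⟨N + K, by ext; simp⟩

theorem IsInt.neg {a b : Type*} {X : Matrix a b ℝ} (hX : IsInt X) : IsInt (-X) := by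
  obtain ⟨N, rfl⟩ := hX
  exact ⟨-N, by ext; simp⟩

theorem IsInt.sub {a b : Type*} {X Y : Matrix a b ℝ} (hX : IsInt X) (hY : IsInt Y) :
    IsInt (X - Y) := by
  rw [sub_eq_add_neg]; exact hX.add hY.neg

theorem IsInt.mul {a b c : Type*} [Fintype b] {X : Matrix a b ℝ} {Y : Matrix b c ℝ}
    (hX : IsInt X) (hY : IsInt Y) : IsInt (X * Y) := by
  obtain ⟨N, rfl⟩ := hX; obtain ⟨K, rfl⟩ := hY
  exact ⟨N * K, by ext; simp [Matrix.mul_apply]⟩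

theorem IsInt.transpose {a b : Type*} {X : Matrix a b ℝ} (hX : IsInt X) : IsInt Xᵀ := by
  obtain ⟨N, rfl⟩ := hX
  exact ⟨Nᵀ, rfl⟩

theorem IsInt.zero {a b : Type*} : IsInt (0 : Matrix a b ℝ) := ⟨0, by ext; simp⟩

/-- The Siegel modular group `Γ_n = Sp(n,ℤ)`. -/
def siegelModular (n : ℕ) : Subgroup (Sp n) where
  carrier := {g | IsInt g.1}
  one_mem' := ⟨1, by
    ext i j
    simp [Matrix.one_apply]⟩
  mul_mem' ha hb := ha.mul hb
  inv_mem' {g} hg := by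
    have hJ : IsInt (Matrix.J (Fin n) ℝ) :=
      ⟨Matrix.J (Fin n) ℤ, (Matrix.map_J (Fin n) (Int.castRingHom ℝ)).symm⟩
    change IsInt (g⁻¹).1
    rw [show (g⁻¹).1 = (-J (Fin n) ℝ) * (g.1)ᵀ * J (Fin n) ℝ from SymplecticGroup.coe_inv g]
    exact (hJ.neg.mul (IsInt.transpose hg)).mul hJ

/-- `Γ_* = π_*⁻¹(Γ)`. -/
def metaLift {n : ℕ} (Γ : Subgroup (siegelModular n)) : Subgroup (Mp n) :=
  (Γ.map (siegelModular n).subtype).comap (Mp.proj n)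

theorem metaLift_isInt {n : ℕ} {Γ : Subgroup (siegelModular n)} {x : Mp n} (hx : x ∈ metaLift Γ) :
    IsInt x.g.1 := by
  obtain ⟨y, _, hy⟩ := hx
  have h : (y : Sp n) = x.g := hy
  rw [← h]; exact y.2

theorem tl_tu_isInt {n m : ℕ} {l u : Matrix (Fin m) (Fin n) ℝ} {g : Sp n} (hl : IsInt l)
    (hu : IsInt u) (hg : IsInt g.1) : IsInt (tl l u g) ∧ IsInt (tu l u g) := by
  obtain ⟨N, hN⟩ := hg
  have h11 : IsInt g.1.toBlocks₁₁ := ⟨N.toBlocks₁₁, by rw [hN]; rfl⟩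
  have h12 : IsInt g.1.toBlocks₁₂ := ⟨N.toBlocks₁₂, by rw [hN]; rfl⟩
  have h21 : IsInt g.1.toBlocks₂₁ := ⟨N.toBlocks₂₁, by rw [hN]; rfl⟩
  have h22 : IsInt g.1.toBlocks₂₂ := ⟨N.toBlocks₂₂, by rw [hN]; rfl⟩
  exact ⟨(hl.mul h11).add (hu.mul h21), (hl.mul h12).add (hu.mul h22)⟩

/-- `Γ_* ⋉ H_ℤ^{(n,m)}`. -/
def jacobiLift {n : ℕ} (m : ℕ) (Γ : Subgroup (siegelModular n)) : Subgroup (JacobiMp n m) where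
  carrier := {x | x.g ∈ metaLift Γ ∧ IsInt x.lam ∧ IsInt x.mu ∧ IsInt x.kap}
  one_mem' := ⟨one_mem _, IsInt.zero, IsInt.zero, IsInt.zero⟩
  mul_mem' {x y} hx hy := by
    obtain ⟨a, b, c, d⟩ := hx
    obtain ⟨a', b', c', d'⟩ := hy
    obtain ⟨e, f⟩ := tl_tu_isInt b c (metaLift_isInt a')
    exact ⟨mul_mem a a', e.add b', f.add c',
      ((d.add d').add (e.mul c'.transpose)).sub (f.mul b'.transpose)⟩
  inv_mem' {x} hx := by
    obtain ⟨a, b, c, d⟩ := hx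
    obtain ⟨e, f⟩ := tl_tu_isInt b c (metaLift_isInt (inv_mem a))
    exact ⟨inv_mem a, e.neg, f.neg, d.transpose.neg⟩

/-- `f` is a Jacobi form of weight `k/2` and index `M` with level `Γ` for the character `χ` of `Γ_*`:
`M` is half-integral (integral diagonal entries, `2M` integral) and positive semidefinite, `Γ` has
finite index in `Γ_n`, `χ` is a unitary character of finite order, `f` is holomorphic on
`ℍ_n × ℂ^{(m,n)}`, and `f` transforms under `Γ_* ⋉ H_ℤ^{(n,m)}` with the factor `χ · J_{k,M}`. -/
structure IsJacobiForm {n m : ℕ} (k : ℤ) (M : Matrix (Fin m) (Fin m) ℝ)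
    (Γ : Subgroup (siegelModular n)) (χ : metaLift Γ →* Circle)
    (f : Matrix (Fin n) (Fin n) ℂ × Matrix (Fin m) (Fin n) ℂ → ℂ) : Prop where
  index_posSemidef : M.PosSemidef
  index_diag : ∀ i, ∃ a : ℤ, M i i = a
  index_half : IsInt ((2 : ℝ) • M)
  finiteIndex : Γ.FiniteIndex
  finiteOrder : IsOfFinOrder χ
  holomorphic : DifferentiableOn ℂ f (siegelJacobi n m)
  transform : ∀ (x : JacobiMp n m) (hx : x ∈ jacobiLift m Γ), ∀ p ∈ siegelJacobi n m,
    f (jact x p) = χ ⟨x.g, hx.1⟩ * jacobiFactor k (M.map Complex.ofReal) x p * f p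

/-- An integral matrix, viewed as a complex matrix. -/
def intC {a b : Type*} (X : Matrix a b ℤ) : Matrix a b ℂ := X.map (Int.cast : ℤ → ℂ)

/-- The term `e^{πi σ(M(ξ Ω ᵗξ + 2 ξ ᵗZ))}` of the theta series. -/
def thetaTerm {n m : ℕ} (M : Matrix (Fin m) (Fin m) ℤ)
    (p : Matrix (Fin n) (Fin n) ℂ × Matrix (Fin m) (Fin n) ℂ) (ξ : Matrix (Fin m) (Fin n) ℤ) : ℂ :=
  Complex.exp (Real.pi * Complex.I *
    (intC M * (intC ξ * p.1 * (intC ξ)ᵀ + (2 : ℂ) • (intC ξ * p.2ᵀ))).trace)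

/-- The theta series `Θ_M(Ω,Z) = ∑_ξ e^{πi σ(M(ξ Ω ᵗξ + 2 ξ ᵗZ))}`. -/
def theta {n m : ℕ} (M : Matrix (Fin m) (Fin m) ℤ)
    (p : Matrix (Fin n) (Fin n) ℂ × Matrix (Fin m) (Fin n) ℂ) : ℂ :=
  ∑' ξ : Matrix (Fin m) (Fin n) ℤ, thetaTerm M p ξ

/-- `e^{πi σ(M(κ + μ ᵗλ))}`; on `H_ℤ^{(n,m)}` this is a sign `±1` when `M` is integral, and it is
identically `1` when moreover the diagonal entries of `M` are even. -/
def heisSign {n m : ℕ} (M : Matrix (Fin m) (Fin m) ℤ) (x : JacobiMp n m) : ℂ :=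
  Complex.exp (Real.pi * Complex.I *
    (intC M * (x.kap + x.mu * x.lamᵀ).map Complex.ofReal).trace)

end
end JacobiTheta

open JacobiTheta

/-!
# The theta series of a positive definite integral matrix is a Jacobi form

Convergence and holomorphy come from comparison with a Gaussian (`summable_norm_cexp`,
`differentiableAt_tsum_cexp`). Translations by the Heisenberg group only shift the summation index
(`theta_shift`), so everything rests on the action of the symplectic group. There the claim is that
each `x` in the preimage of the principal congruence subgroup of level `2 det M` has a multiplier `c`,
that is `Θ(g·Ω, Z(CΩ+D)⁻¹) = c e^{πi σ(M Z (CΩ+D)⁻¹ C ᵗZ)} J_{1/2}(x,Ω)^m Θ(Ω,Z)` (`IsThetaMult`), and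
that `c⁸ = 1`. Multipliers are unique because `Θ(iI,0) > 0`, and multiplicative because the factor is
a cocycle; so they form the character `ρ_M`, whose order divides eight.

The multiplier is found directly for a single `g` with `det C ≠ 0`, without generators of `Sp(n,ℤ)`.
Put `δ = |det C|`, `K = δ C⁻¹` and `q = 2δ`. Completing the square with
`g·Ω = A C⁻¹ - ((CΩ+D) ᵗC)⁻¹` and splitting `ξ` into residue classes modulo `q` turns the transformed
series into a finite combination of dual Gaussian series. The inversion formula
(`exists_matrix_inversion`, one variable at a time from the functional equation of Jacobi's theta
function) gives a series over `x ∈ ℤ^{(m,n)}` whose coefficients are finite Fourier transforms of a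
quadratic character (`HasBlocks.thetaSlash_eq_tsum`). By the level condition the transformed series is
periodic in `Z` under `M⁻¹ ℤ^{(m,n)}` (`HasBlocks.thetaSlash_add`); averaging over these periods leaves
only the indices `x = 2MηK`, whose terms are the terms of `Θ` times one and the same Gauss sum `G`
(`HasBlocks.thetaSlash_eq`). So `c = κ G`, where the factor `D` of the inversion formula is
`κ J_{1/2}^m`: both are continuous square roots of multiples of `det(CΩ+D)^m` on a connected space.

The square of `κ` is explicit and `κ⁸ > 0`. The fourth power of `G` is real
(`conj_gaussSumMat_pow_four`), since `-1` is a sum of four squares modulo `q`. Thus `c⁸ ≥ 0`. Finally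
`|c| = 1`, because `x⁻¹` has a multiplier of the same absolute value, by a symplectic change of
variables in the Gauss sum (`GaussRel.gaussSumMat_eq`). If `C` is singular, write
`x = (x y) y⁻¹` with `y` lower unipotent such that `x y` and `y` have invertible lower left blocks.
-/

namespace JacobiTheta
noncomputable section

open scoped Kronecker
open ZMod (stdAddChar)

/-! ### Gaussian sums over integer lattices -/

theorem summable_prod_pi {k : ℕ} {f : Fin k → ℤ → ℝ} (h0 : ∀ i x, 0 ≤ f i x)
    (hf : ∀ i, Summable (f i)) : Summable fun x : Fin k → ℤ => ∏ i, f i (x i) := by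
  induction k with
  | zero => exact (hasSum_fintype _).summable
  | succ k ih =>
    have h1 := ih (f := fun i => f i.succ) (fun i x => h0 _ _) (fun i => hf _)
    have h2 := (hf 0).mul_of_nonneg h1 (h0 0) (fun x => Finset.prod_nonneg fun i _ => h0 _ _)
    rw [← (Fin.consEquiv fun _ : Fin (k + 1) => ℤ).summable_iff]
    refine h2.congr fun p => ?_
    simp [Fin.prod_univ_succ, Fin.consEquiv]

/-- The summand has a linear term because the exponents below are quadratic polynomials. -/
theorem summable_exp_int {ε : ℝ} (hε : 0 < ε) (a : ℝ) :
    Summable fun x : ℤ => Real.exp (-ε * x ^ 2 + a * |(x : ℝ)|) := by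
  have hb : ∀ x : ℝ, -ε * x ^ 2 + a * |x| ≤ (a + 1) ^ 2 / (4 * ε) + -|x| := fun x => by
    have h := sq_nonneg (2 * ε * |x| - (a + 1))
    have h1 : (2 * ε * |x| - (a + 1)) ^ 2 = 4 * ε * (ε * x ^ 2 - (a + 1) * |x| +
        (a + 1) ^ 2 / (4 * ε)) := by
      rw [← sq_abs x]; field_simp; ring
    rw [h1] at h
    have := nonneg_of_mul_nonneg_right h (by positivity)
    linarith
  refine Summable.of_nonneg_of_le (fun _ => (Real.exp_pos _).le)
    (fun x => (Real.exp_le_exp.2 (hb x)).trans_eq (Real.exp_add _ _)) (Summable.mul_left _ ?_)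
  have hn : Summable fun x : ℕ => Real.exp (-(x : ℝ)) := by
    simpa using Real.summable_exp_neg_nat
  refine Summable.of_nat_of_neg ?_ ?_ <;> simpa using hn

theorem summable_exp_pi {ι : Type*} [Fintype ι] {ε : ℝ} (hε : 0 < ε) (a : ℝ) :
    Summable fun x : ι → ℤ => Real.exp (-ε * ∑ i, (x i : ℝ) ^ 2 + a * ∑ i, |(x i : ℝ)|) := by
  have h := summable_prod_pi (k := Fintype.card ι) (f := fun _ x => Real.exp (-ε * x ^ 2 + a * |(x : ℝ)|))
    (fun _ _ => (Real.exp_pos _).le) (fun _ => summable_exp_int hε a)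
  rw [← (Equiv.arrowCongr (Fintype.equivFin ι) (Equiv.refl ℤ)).symm.summable_iff] 
  refine h.congr fun x => ?_
  rw [← Real.exp_sum, Finset.sum_add_distrib, ← Finset.mul_sum, ← Finset.mul_sum]
  simp only [Function.comp_apply, Equiv.arrowCongr_symm, Equiv.arrowCongr_apply, Equiv.symm_symm,
    Equiv.refl_symm, Equiv.coe_refl, id]
  rw [Equiv.sum_comp (Fintype.equivFin ι) (fun i => (x i : ℝ) ^ 2),
    Equiv.sum_comp (Fintype.equivFin ι) (fun i => |(x i : ℝ)|)]

/-- A continuous function on `ℝ^ι` that is homogeneous of degree two and positive away from the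
origin dominates a multiple of the sum of squares. -/
theorem exists_le_of_homogeneous {ι : Type*} [Fintype ι] {Q : (ι → ℝ) → ℝ} (hc : Continuous Q)
    (hh : ∀ (t : ℝ) x, Q (t • x) = t ^ 2 * Q x) (hp : ∀ x, x ≠ 0 → 0 < Q x) :
    ∃ ε > 0, ∀ x, ε * ∑ i, x i ^ 2 ≤ Q x := by
  have h0 : Q 0 = 0 := by simpa using hh 0 0
  rcases (Metric.sphere (0 : ι → ℝ) 1).eq_empty_or_nonempty with he | hne
  · refine ⟨1, one_pos, fun x => ?_⟩
    have : x = 0 := by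
      by_contra hx
      have : ‖x‖⁻¹ • x ∈ Metric.sphere (0 : ι → ℝ) 1 := by
        simp [norm_smul, hx]
      rw [he] at this
      exact this
    simp [this, h0]
  · obtain ⟨y, hy, hmin⟩ := (isCompact_sphere (0 : ι → ℝ) 1).exists_isMinOn hne hc.continuousOn
    have hy0 : y ≠ 0 := by rintro rfl; simp at hy
    refine ⟨Q y / (Fintype.card ι + 1), div_pos (hp y hy0) (by positivity), fun x => ?_⟩
    by_cases hx : x = 0
    · simp [hx, h0]
    have h1 := hmin (show ‖x‖⁻¹ • x ∈ Metric.sphere (0 : ι → ℝ) 1 by simp [norm_smul, hx])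
    have hn := norm_pos_iff.2 hx
    simp only [Set.mem_ofPred_eq] at h1
    rw [hh, inv_pow, ← div_eq_inv_mul, le_div_iff₀ (by positivity)] at h1
    have h2 : ∑ i, x i ^ 2 ≤ (Fintype.card ι + 1) * ‖x‖ ^ 2 := by
      calc ∑ i, x i ^ 2 ≤ ∑ _i : ι, ‖x‖ ^ 2 := Finset.sum_le_sum fun i _ => by
            rw [← sq_abs, ← Real.norm_eq_abs]
            exact pow_le_pow_left₀ (norm_nonneg _) (norm_le_pi_norm x i) 2
        _ ≤ _ := by
          simp only [Finset.sum_const, Finset.card_univ, nsmul_eq_mul]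
          nlinarith [sq_nonneg ‖x‖]
    refine le_trans ?_ h1
    rw [div_mul_eq_mul_div, div_le_iff₀ (by positivity), mul_assoc]
    refine mul_le_mul_of_nonneg_left (h2.trans_eq (by ring)) (hp y hy0).le

/-- The exponential of a complex quadratic polynomial on `ℝ^ι` whose quadratic part has negative
real part is absolutely summable over the integer points. -/
theorem summable_norm_cexp {ι : Type*} [Fintype ι] {q : (ι → ℝ) → ℂ} (hc : Continuous q)
    (hh : ∀ (t : ℝ) x, q (t • x) = t ^ 2 * q x) (hp : ∀ x, x ≠ 0 → 0 < (q x).re)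
    (w : ι → ℂ) (c : ℂ) :
    Summable fun x : ι → ℤ => ‖Complex.exp (-q (fun i => x i) + ∑ i, (x i : ℂ) * w i + c)‖ := by
  obtain ⟨ε, hε, h⟩ := exists_le_of_homogeneous (Q := fun x => (q x).re)
    (Complex.continuous_re.comp hc) (fun t x => by
      rw [hh, ← Complex.ofReal_pow, Complex.re_ofReal_mul]) hp
  refine Summable.of_nonneg_of_le (fun _ => norm_nonneg _) (fun x => ?_)
    ((summable_exp_pi (ι := ι) hε (∑ i, ‖w i‖)).mul_right (Real.exp c.re))
  rw [Complex.norm_exp, ← Real.exp_add, Real.exp_le_exp]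
  have h1 := h (fun i => x i)
  have h2 : (∑ i, (x i : ℂ) * w i).re ≤ (∑ i, ‖w i‖) * ∑ i, |(x i : ℝ)| := by
    refine (Complex.re_le_norm _).trans ((norm_sum_le _ _).trans ?_)
    rw [Finset.mul_sum]
    refine Finset.sum_le_sum fun i _ => ?_
    rw [norm_mul, Complex.norm_intCast, mul_comm]
    exact mul_le_mul_of_nonneg_right
      (Finset.single_le_sum (f := fun i => ‖w i‖) (fun j _ => norm_nonneg _) (Finset.mem_univ i))
      (abs_nonneg _)
  simp only [Complex.add_re, Complex.neg_re]
  linarith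

/-! ### The inversion formula for theta series of several variables -/

/-- The term `e^{-π ᵗx S x + 2πi ᵗx z}` of a theta series in `k` variables. -/
def gaussTerm {k : ℕ} (S : Matrix (Fin k) (Fin k) ℂ) (z : Fin k → ℂ) (x : Fin k → ℤ) : ℂ :=
  Complex.exp (-(Real.pi * ((fun i => (x i : ℂ)) ⬝ᵥ S *ᵥ fun i => (x i : ℂ))) +
    ∑ i, (x i : ℂ) * (2 * Real.pi * Complex.I * z i))

theorem posRe_re_pos_ofReal {k : ℕ} {S : Matrix (Fin k) (Fin k) ℂ} (hS : S ∈ posRe k)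
    {x : Fin k → ℝ} (hx : x ≠ 0) :
    0 < ((fun i => (x i : ℂ)) ⬝ᵥ S *ᵥ fun i => (x i : ℂ)).re := by
  have h := posRe_re_pos hS (x := fun i => (x i : ℂ)) (fun h => hx (funext fun i => by
    simpa using congrFun h i))
  convert h using 3
  ext i; simp

theorem summable_gaussTerm {k : ℕ} {S : Matrix (Fin k) (Fin k) ℂ} (hS : S ∈ posRe k)
    (z : Fin k → ℂ) : Summable fun x => ‖gaussTerm S z x‖ := by
  have h := summable_norm_cexp
    (q := fun x : Fin k → ℝ => Real.pi * ((fun i => (x i : ℂ)) ⬝ᵥ S *ᵥ fun i => (x i : ℂ)))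
    (by simp only [dotProduct, mulVec]; fun_prop)
    (fun t x => by
      have : (fun i => ((t • x) i : ℂ)) = (t : ℂ) • fun i => (x i : ℂ) := by ext i; simp
      rw [this, mulVec_smul, smul_dotProduct, dotProduct_smul]
      simp only [smul_eq_mul]; ring)
    (fun x hx => by
      rw [Complex.re_ofReal_mul]
      exact mul_pos Real.pi_pos (posRe_re_pos_ofReal hS hx))
    (fun i => 2 * Real.pi * Complex.I * z i) 0
  simpa [gaussTerm] using h

/-- The inversion formula in one variable. -/
theorem tsum_gauss_one {s : ℂ} (hs : 0 < s.re) (z : ℂ) :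
    ∑' y : ℤ, Complex.exp (-(Real.pi * (z - y) ^ 2 / s)) =
      s ^ (1 / 2 : ℂ) * ∑' x : ℤ, Complex.exp (-(Real.pi * s * x ^ 2) + x * (2 * Real.pi * Complex.I * z)) := by
  have hs0 : s ≠ 0 := by rintro rfl; simp at hs
  have h := jacobiTheta₂_functional_equation z (Complex.I * s)
  have e1 : -Complex.I * (Complex.I * s) = s := by
    rw [neg_mul, ← mul_assoc, Complex.I_mul_I]; ring
  have hp : s ^ (1 / 2 : ℂ) ≠ 0 := by simp [Complex.cpow_eq_zero_iff, hs0]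
  rw [e1] at h
  have e2 : ∑' x : ℤ, Complex.exp (-(Real.pi * s * x ^ 2) + x * (2 * Real.pi * Complex.I * z)) =
      jacobiTheta₂ z (Complex.I * s) := by
    refine tsum_congr fun x => ?_
    rw [jacobiTheta₂_term]
    congr 1
    linear_combination (-Real.pi * s * x ^ 2) * Complex.I_mul_I
  rw [e2, h, mul_assoc, ← mul_assoc, mul_one_div_cancel hp, one_mul, jacobiTheta₂, ← tsum_mul_left]
  refine tsum_congr fun y => ?_
  rw [jacobiTheta₂_term, ← Complex.exp_add]
  congr 1
  field_simp
  ring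

/-- The Schur complement of the entry `(0,0)`. -/
def schur {k : ℕ} (S : Matrix (Fin (k + 1)) (Fin (k + 1)) ℂ) : Matrix (Fin k) (Fin k) ℂ :=
  of fun i j => S i.succ j.succ - S i.succ 0 * S 0 j.succ / S 0 0

/-- The off-diagonal part of the zeroth row. -/
def rowTail {k : ℕ} (S : Matrix (Fin (k + 1)) (Fin (k + 1)) ℂ) : Fin k → ℂ := fun j => S 0 j.succ

theorem quad_succ {k : ℕ} {S : Matrix (Fin (k + 1)) (Fin (k + 1)) ℂ} (hS : S.IsSymm) (t u : ℂ)
    (x y : Fin k → ℂ) :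
    (Fin.cons t x : Fin (k + 1) → ℂ) ⬝ᵥ S *ᵥ (Fin.cons u y : Fin (k + 1) → ℂ) =
      t * S 0 0 * u + t * (rowTail S ⬝ᵥ y) + u * (rowTail S ⬝ᵥ x) +
        x ⬝ᵥ S.submatrix Fin.succ Fin.succ *ᵥ y := by
  have h : ∀ i : Fin k, S i.succ 0 = rowTail S i := fun i => hS.apply 0 i.succ
  have h1 : ∑ i, x i * (rowTail S i * u) = u * ∑ i, rowTail S i * x i := by
    rw [Finset.mul_sum]
    exact Finset.sum_congr rfl fun i _ => by ring
  simp only [dotProduct, mulVec, Fin.sum_univ_succ, Fin.cons_zero, Fin.cons_succ, h, submatrix_apply,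
    mul_add, Finset.sum_add_distrib, h1]
  simp only [rowTail]
  ring

/-- Completing the square along the zeroth variable. -/
theorem quad_schur {k : ℕ} {S : Matrix (Fin (k + 1)) (Fin (k + 1)) ℂ} (hS : S.IsSymm)
    (x : Fin k → ℂ) :
    x ⬝ᵥ schur S *ᵥ x = x ⬝ᵥ S.submatrix Fin.succ Fin.succ *ᵥ x - (rowTail S ⬝ᵥ x) ^ 2 / S 0 0 := by
  have h : ∀ i : Fin k, S i.succ 0 = rowTail S i := fun i => hS.apply 0 i.succ
  have h1 : (rowTail S ⬝ᵥ x) ^ 2 / S 0 0 =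
      ∑ i, ∑ j, rowTail S i * x i * (rowTail S j * x j) / S 0 0 := by
    rw [sq, dotProduct, Finset.sum_mul_sum, Finset.sum_div]
    exact Finset.sum_congr rfl fun i _ => Finset.sum_div _ _ _
  rw [h1]
  simp only [dotProduct, mulVec, schur, of_apply, h, submatrix_apply, Finset.mul_sum,
    ← Finset.sum_sub_distrib]
  refine Finset.sum_congr rfl fun i _ => Finset.sum_congr rfl fun j _ => ?_
  simp only [rowTail]; ring

theorem posRe_zero_zero {k : ℕ} {S : Matrix (Fin (k + 1)) (Fin (k + 1)) ℂ} (hS : S ∈ posRe (k + 1)) :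
    0 < (S 0 0).re := by
  simpa using hS.2.diag_pos (i := 0)

/-- Positivity of the quadratic form that arises after a partial Fourier transform in the zeroth
variable. -/
theorem mixed_re_pos {k : ℕ} {S : Matrix (Fin (k + 1)) (Fin (k + 1)) ℂ} (hS : S ∈ posRe (k + 1))
    {y : ℝ} {x : Fin k → ℝ} (h : y ≠ 0 ∨ x ≠ 0) :
    0 < (((fun i => (x i : ℂ)) ⬝ᵥ S.submatrix Fin.succ Fin.succ *ᵥ fun i => (x i : ℂ)) +
      (Complex.I * (rowTail S ⬝ᵥ fun i => (x i : ℂ)) - y) ^ 2 / S 0 0).re := by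
  have hs0 : S 0 0 ≠ 0 := by
    intro h; have := posRe_zero_zero hS; rw [h] at this; simp at this
  set X : Fin k → ℂ := fun i => (x i : ℂ) with hX
  have hsX : star X = X := by ext i; simp [hX]
  set β := rowTail S ⬝ᵥ X with hβ
  -- the real part of the form is that of the Hermitian form of `S` at the vector `(t, x)`
  set t : ℂ := (-β - Complex.I * y) / S 0 0 with ht
  have hst : S 0 0 * t = -β - Complex.I * y := by rw [ht]; field_simp
  have hv : (Fin.cons t X : Fin (k + 1) → ℂ) ≠ 0 := by
    intro h0
    have hx0 : x = 0 := by
      funext i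
      have := congrFun h0 i.succ
      simpa [hX] using this
    have ht0 : t = 0 := by simpa using congrFun h0 0
    have hb0 : β = 0 := by simp [hβ, hX, hx0]
    rw [ht0, hb0] at hst
    rcases h with h | h
    · apply h; simpa using hst
    · exact h hx0
  have hp := posRe_re_pos hS hv
  have hstar : star (Fin.cons t X : Fin (k + 1) → ℂ) = Fin.cons (star t) X := by
    funext i
    refine Fin.cases ?_ (fun j => ?_) i
    · simp
    · simp [hX]
  rw [hstar, quad_succ hS.1, ← hβ] at hp
  have e1 : star t * S 0 0 * t + star t * β + t * β = t * β - Complex.I * y * star t := by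
    linear_combination (star t) * hst
  have e2 : (t * β - Complex.I * y * star t).re = (t * β + Complex.I * y * t).re := by
    simp [Complex.mul_re, Complex.mul_im]
    ring
  have e3 : (Complex.I * β - y) ^ 2 / S 0 0 = t * β + Complex.I * y * t := by
    rw [ht]; field_simp
    linear_combination (β ^ 2 + (y : ℂ) ^ 2) * Complex.I_sq
  rw [e1, Complex.add_re, e2] at hp
  rw [Complex.add_re, e3]
  linarith

theorem schur_mem {k : ℕ} {S : Matrix (Fin (k + 1)) (Fin (k + 1)) ℂ} (hS : S ∈ posRe (k + 1)) :
    schur S ∈ posRe k := by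
  have hsym : (schur S).IsSymm := by
    ext i j
    have h1 : S i.succ j.succ = S j.succ i.succ := hS.1.apply _ _
    have h2 : S i.succ 0 = S 0 i.succ := hS.1.apply _ _
    have h3 : S j.succ 0 = S 0 j.succ := hS.1.apply _ _
    simp only [schur, transpose_apply, of_apply, h1, h2, h3]; ring
  refine ⟨hsym, Matrix.PosDef.of_dotProduct_mulVec_pos ?_ fun x hx => ?_⟩
  · rw [Matrix.IsHermitian, conjTranspose_eq_transpose_of_trivial, ← Matrix.transpose_map, hsym.eq]
  · have h := mixed_re_pos hS (y := 0) (Or.inr hx)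
    have e : star x ⬝ᵥ (schur S).map Complex.re *ᵥ x =
        ((fun i => (x i : ℂ)) ⬝ᵥ schur S *ᵥ fun i => (x i : ℂ)).re := by
      simp [dotProduct, mulVec, Complex.re_sum, Finset.mul_sum]
    rw [Complex.ofReal_zero, sub_zero, mul_pow, Complex.I_sq, neg_one_mul, neg_div,
      ← sub_eq_add_neg] at h
    rw [e, quad_schur hS.1]
    exact h

theorem det_schur {k : ℕ} {S : Matrix (Fin (k + 1)) (Fin (k + 1)) ℂ} (h0 : S 0 0 ≠ 0) :
    S.det = S 0 0 * (schur S).det := by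
  have h : IsUnit (of fun _ _ : Unit => S 0 0) := by
    rw [isUnit_iff_isUnit_det]; simpa using h0
  let _ := h.invertible
  have h1 : S.submatrix (Sum.elim (fun _ : Unit => (0 : Fin (k+1))) Fin.succ)
      (Sum.elim (fun _ => 0) Fin.succ) = fromBlocks (of fun _ _ : Unit => S 0 0)
      (of fun _ j => S 0 j.succ) (of fun i _ => S i.succ 0) (S.submatrix Fin.succ Fin.succ) := by
    ext (i | i) (j | j) <;> rfl
  have h2 : (S.submatrix (Sum.elim (fun _ : Unit => (0 : Fin (k+1))) Fin.succ)
      (Sum.elim (fun _ => 0) Fin.succ)).det = S.det :=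
    det_submatrix_equiv_self
      ({ toFun := Sum.elim (fun _ => 0) Fin.succ
         invFun := Fin.cases (Sum.inl ()) Sum.inr
         left_inv := by rintro (_ | i) <;> simp
         right_inv := by intro i; refine Fin.cases ?_ (fun j => ?_) i <;> simp } :
        Unit ⊕ Fin k ≃ Fin (k + 1)) S
  rw [← h2, h1, det_fromBlocks₁₁]
  congr 1
  · simp
  · congr 1
    ext i j
    simp [schur, mul_apply, div_eq_mul_inv]
    ring

/-- Completing the square in the inverse form, along the zeroth variable. -/
theorem quad_inv_succ {k : ℕ} {S : Matrix (Fin (k + 1)) (Fin (k + 1)) ℂ} (hS : S ∈ posRe (k + 1))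
    (w : Fin (k + 1) → ℂ) :
    w ⬝ᵥ S⁻¹ *ᵥ w = w 0 ^ 2 / S 0 0 + (Fin.tail w - (w 0 / S 0 0) • rowTail S) ⬝ᵥ
      (schur S)⁻¹ *ᵥ (Fin.tail w - (w 0 / S 0 0) • rowTail S) := by
  have hs0 : S 0 0 ≠ 0 := by
    intro h; have := posRe_zero_zero hS; rw [h] at this; simp at this
  set u := S⁻¹ *ᵥ w with hu
  have hw : S *ᵥ u = w := by
    rw [hu, mulVec_mulVec, mul_nonsing_inv _ (posRe_det_ne_zero hS).isUnit, one_mulVec]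
  have h0 : S 0 0 * u 0 + rowTail S ⬝ᵥ Fin.tail u = w 0 := by
    rw [← hw]; simp [mulVec, dotProduct, Fin.sum_univ_succ, rowTail, Fin.tail]
  have hb : ∀ i : Fin k, S i.succ 0 = rowTail S i := fun i => hS.1.apply 0 i.succ
  have h1 : schur S *ᵥ Fin.tail u = Fin.tail w - (w 0 / S 0 0) • rowTail S := by
    funext i
    have hi : w i.succ = S i.succ 0 * u 0 + ∑ j : Fin k, S i.succ j.succ * u j.succ := by
      rw [← hw]; simp [mulVec, dotProduct, Fin.sum_univ_succ]
    have h3 : ∑ j : Fin k, S i.succ 0 * S 0 j.succ / S 0 0 * u j.succ =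
        S i.succ 0 / S 0 0 * (rowTail S ⬝ᵥ Fin.tail u) := by
      simp only [dotProduct, Finset.mul_sum, rowTail, Fin.tail]
      exact Finset.sum_congr rfl fun j _ => by ring
    simp only [mulVec, dotProduct, schur, of_apply, Fin.tail, sub_mul, Finset.sum_sub_distrib,
      Pi.sub_apply, Pi.smul_apply, smul_eq_mul, hi]
    rw [h3, ← h0, hb]
    field_simp
    ring
  have h2 : (schur S)⁻¹ *ᵥ (Fin.tail w - (w 0 / S 0 0) • rowTail S) = Fin.tail u := by
    rw [← h1, mulVec_mulVec, nonsing_inv_mul _ (posRe_det_ne_zero (schur_mem hS)).isUnit, one_mulVec]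
  rw [h2, sub_dotProduct, smul_dotProduct, smul_eq_mul]
  have h3 : w ⬝ᵥ u = w 0 * u 0 + Fin.tail w ⬝ᵥ Fin.tail u := by
    simp [dotProduct, Fin.sum_univ_succ, Fin.tail]
  rw [h3]
  have h4 : u 0 = (w 0 - rowTail S ⬝ᵥ Fin.tail u) / S 0 0 := by
    rw [← h0]; field_simp; ring
  rw [h4]
  field_simp
  ring

theorem posRe_inv {k : ℕ} {S : Matrix (Fin k) (Fin k) ℂ} (hS : S ∈ posRe k) : S⁻¹ ∈ posRe k := by
  have hsym : (S⁻¹).IsSymm := by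
    rw [Matrix.IsSymm, transpose_nonsing_inv, hS.1.eq]
  refine ⟨hsym, Matrix.PosDef.of_dotProduct_mulVec_pos ?_ fun x hx => ?_⟩
  · rw [Matrix.IsHermitian, conjTranspose_eq_transpose_of_trivial, ← Matrix.transpose_map, hsym.eq]
  · set X : Fin k → ℂ := fun i => (x i : ℂ) with hX
    have hsX : star X = X := by ext i; simp [hX]
    have e : star x ⬝ᵥ (S⁻¹).map Complex.re *ᵥ x = (X ⬝ᵥ S⁻¹ *ᵥ X).re := by
      simp [hX, dotProduct, mulVec, Complex.re_sum, Finset.mul_sum]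
    set u := S⁻¹ *ᵥ X with hu
    have hw : S *ᵥ u = X := by
      rw [hu, mulVec_mulVec, mul_nonsing_inv _ (posRe_det_ne_zero hS).isUnit, one_mulVec]
    have hu0 : u ≠ 0 := by
      intro h
      rw [h, mulVec_zero] at hw
      exact hx (funext fun i => by simpa [hX] using (congrFun hw i).symm)
    have h := posRe_re_pos hS hu0
    rw [hw] at h
    have e2 : star u ⬝ᵥ X = star (X ⬝ᵥ u) := by
      rw [← star_dotProduct_star, hsX, dotProduct_comm]
    rw [e2, Complex.star_def, Complex.conj_re] at h
    rw [e]; exact h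

/-- The term `e^{-π ᵗ(z-y) S⁻¹ (z-y)}` of the dual theta series. -/
def dualTerm {k : ℕ} (S : Matrix (Fin k) (Fin k) ℂ) (z : Fin k → ℂ) (y : Fin k → ℤ) : ℂ :=
  Complex.exp (-(Real.pi * ((fun i => z i - y i) ⬝ᵥ S⁻¹ *ᵥ fun i => z i - y i)))

/-- A dual series is a Gaussian series for `S⁻¹`, up to a constant factor. -/
theorem summable_dualTerm {k : ℕ} {S : Matrix (Fin k) (Fin k) ℂ} (hS : S ∈ posRe k)
    (z : Fin k → ℂ) : Summable fun y => ‖dualTerm S z y‖ := by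
  refine ((summable_gaussTerm (posRe_inv hS) (fun i => -Complex.I * (S⁻¹ *ᵥ z) i)).mul_right
    ‖Complex.exp (-(Real.pi * (z ⬝ᵥ S⁻¹ *ᵥ z)))‖).congr fun y => ?_
  rw [← norm_mul, gaussTerm, ← Complex.exp_add, dualTerm]
  congr 2
  have h : (fun i => z i - (y i : ℂ)) = z - fun i => (y i : ℂ) := rfl
  have h2 : z ⬝ᵥ S⁻¹ *ᵥ (fun i => (y i : ℂ)) = (fun i => (y i : ℂ)) ⬝ᵥ S⁻¹ *ᵥ z := by
    rw [dotProduct_mulVec, ← mulVec_transpose, (posRe_inv hS).1.eq, dotProduct_comm]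
  have h3 : ∑ i, (y i : ℂ) * (2 * Real.pi * Complex.I * (-Complex.I * (S⁻¹ *ᵥ z) i)) =
      2 * Real.pi * ((fun i => (y i : ℂ)) ⬝ᵥ S⁻¹ *ᵥ z) := by
    rw [dotProduct, Finset.mul_sum]
    refine Finset.sum_congr rfl fun i _ => ?_
    linear_combination (-2 * Real.pi * y i * (S⁻¹ *ᵥ z) i) * Complex.I_mul_I
  rw [h, h3, mulVec_sub, sub_dotProduct, dotProduct_sub, dotProduct_sub, h2]
  ring

/-- The term of the double series obtained by inversion in the zeroth variable only. -/
def mixedTerm {k : ℕ} (S : Matrix (Fin (k + 1)) (Fin (k + 1)) ℂ) (z : Fin (k + 1) → ℂ) (y : ℤ)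
    (x : Fin k → ℤ) : ℂ :=
  gaussTerm (S.submatrix Fin.succ Fin.succ) (Fin.tail z) x *
    Complex.exp (-(Real.pi * (z 0 + Complex.I * (rowTail S ⬝ᵥ fun i => (x i : ℂ)) - y) ^ 2 / S 0 0))

theorem summable_mixedTerm {k : ℕ} {S : Matrix (Fin (k + 1)) (Fin (k + 1)) ℂ} (hS : S ∈ posRe (k + 1))
    (z : Fin (k + 1) → ℂ) : Summable fun p : ℤ × (Fin k → ℤ) => mixedTerm S z p.1 p.2 := by
  refine Summable.of_norm ?_
  set X : (Fin (k + 1) → ℝ) → Fin k → ℂ := fun v i => (v i.succ : ℂ) with hX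
  have hXt : ∀ (t : ℝ) v, X (t • v) = (t : ℂ) • X v := fun t v => by ext i; simp [hX]
  have h := summable_norm_cexp (ι := Fin (k + 1))
    (q := fun v : Fin (k + 1) → ℝ => Real.pi * (X v ⬝ᵥ S.submatrix Fin.succ Fin.succ *ᵥ X v +
      (Complex.I * (rowTail S ⬝ᵥ X v) - v 0) ^ 2 / S 0 0))
    (by simp only [dotProduct, mulVec, hX]; fun_prop)
    (fun t v => by
      rw [hXt, mulVec_smul, smul_dotProduct, dotProduct_smul, dotProduct_smul]
      simp only [smul_eq_mul, Pi.smul_apply, Complex.ofReal_mul]; ring)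
    (fun v hv => by
      rw [Complex.re_ofReal_mul]
      refine mul_pos Real.pi_pos (mixed_re_pos hS (y := v 0) (x := fun i => v i.succ) ?_)
      by_contra! h
      exact hv (funext fun i => Fin.cases h.1 (fun j => congrFun h.2 j) i))
    (Fin.cons (2 * Real.pi * z 0 / S 0 0) fun i =>
      2 * Real.pi * Complex.I * (z i.succ - z 0 * rowTail S i / S 0 0))
    (-(Real.pi * z 0 ^ 2 / S 0 0))
  rw [← (Fin.consEquiv fun _ : Fin (k + 1) => ℤ).summable_iff] at h
  refine h.congr fun p => ?_
  rw [Function.comp_apply, mixedTerm, gaussTerm, ← Complex.exp_add]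
  congr 2
  have h1 : ∑ i, (p.2 i : ℂ) * (2 * Real.pi * Complex.I * (z i.succ - z 0 * rowTail S i / S 0 0)) =
      ∑ i, (p.2 i : ℂ) * (2 * Real.pi * Complex.I * Fin.tail z i) -
        2 * Real.pi * Complex.I * z 0 / S 0 0 * (rowTail S ⬝ᵥ fun i => (p.2 i : ℂ)) := by
    rw [dotProduct, Finset.mul_sum, ← Finset.sum_sub_distrib]
    exact Finset.sum_congr rfl fun i _ => by simp only [Fin.tail]; ring
  simp only [Fin.consEquiv_apply, Fin.sum_univ_succ, Fin.cons_zero, Fin.cons_succ, hX, h1,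
    Complex.ofReal_intCast]
  ring

theorem dualTerm_cons {k : ℕ} {S : Matrix (Fin (k + 1)) (Fin (k + 1)) ℂ} (hS : S ∈ posRe (k + 1))
    (z : Fin (k + 1) → ℂ) (y : ℤ) (x : Fin k → ℤ) :
    dualTerm S z (Fin.cons y x) = Complex.exp (-(Real.pi * (z 0 - y) ^ 2 / S 0 0)) *
      dualTerm (schur S) (Fin.tail z - ((z 0 - y) / S 0 0) • rowTail S) x := by
  rw [dualTerm, quad_inv_succ hS, dualTerm, ← Complex.exp_add]
  congr 1
  have h : (Fin.tail fun i => z i - ((Fin.cons y x : Fin (k + 1) → ℤ) i : ℂ)) -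
      ((z 0 - y) / S 0 0) • rowTail S =
      fun i => (Fin.tail z - ((z 0 - y) / S 0 0) • rowTail S) i - (x i : ℂ) := by
    ext i; simp [Fin.tail]; ring
  simp only [Fin.cons_zero] at h ⊢
  rw [h]; ring

theorem mixedTerm_eq_gaussTerm {k : ℕ} {S : Matrix (Fin (k + 1)) (Fin (k + 1)) ℂ} (hS : S.IsSymm)
    (z : Fin (k + 1) → ℂ) (y : ℤ) (x : Fin k → ℤ) :
    Complex.exp (-(Real.pi * (z 0 - y) ^ 2 / S 0 0)) *
      gaussTerm (schur S) (Fin.tail z - ((z 0 - y) / S 0 0) • rowTail S) x = mixedTerm S z y x := by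
  rw [mixedTerm, gaussTerm, gaussTerm, ← Complex.exp_add, ← Complex.exp_add, quad_schur hS]
  congr 1
  have h1 : ∑ i, (x i : ℂ) * (2 * Real.pi * Complex.I *
        (Fin.tail z - ((z 0 - y) / S 0 0) • rowTail S) i) =
      ∑ i, (x i : ℂ) * (2 * Real.pi * Complex.I * Fin.tail z i) -
        2 * Real.pi * Complex.I * (z 0 - y) / S 0 0 * (rowTail S ⬝ᵥ fun i => (x i : ℂ)) := by
    rw [dotProduct, Finset.mul_sum, ← Finset.sum_sub_distrib]
    refine Finset.sum_congr rfl fun i _ => ?_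
    simp only [Pi.sub_apply, Pi.smul_apply, smul_eq_mul]; ring
  rw [h1]
  generalize rowTail S ⬝ᵥ (fun i => (x i : ℂ)) = β
  linear_combination (Real.pi * β ^ 2 / S 0 0) * Complex.I_sq

theorem gaussTerm_cons {k : ℕ} {S : Matrix (Fin (k + 1)) (Fin (k + 1)) ℂ} (hS : S.IsSymm)
    (z : Fin (k + 1) → ℂ) (y : ℤ) (x : Fin k → ℤ) :
    gaussTerm S z (Fin.cons y x) = gaussTerm (S.submatrix Fin.succ Fin.succ) (Fin.tail z) x *
      Complex.exp (-(Real.pi * S 0 0 * y ^ 2) + y * (2 * Real.pi * Complex.I *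
        (z 0 + Complex.I * (rowTail S ⬝ᵥ fun i => (x i : ℂ))))) := by
  have h : (fun i => ((Fin.cons y x : Fin (k + 1) → ℤ) i : ℂ)) =
      (Fin.cons (y : ℂ) fun i => (x i : ℂ)) := by
    ext i; refine Fin.cases ?_ (fun j => ?_) i <;> simp
  rw [gaussTerm, h, quad_succ hS, gaussTerm, ← Complex.exp_add]
  congr 1
  simp only [Fin.sum_univ_succ, Fin.cons_zero, Fin.cons_succ, Fin.tail]
  generalize rowTail S ⬝ᵥ (fun i => (x i : ℂ)) = β
  linear_combination (-2 * Real.pi * β * y) * Complex.I_sq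

theorem continuousOn_schur {k : ℕ} :
    ContinuousOn (schur (k := k)) (posRe (k + 1)) := by
  unfold schur
  refine continuousOn_pi.2 fun i => continuousOn_pi.2 fun j => ?_
  refine ContinuousOn.sub (by fun_prop) (ContinuousOn.div (by fun_prop) (by fun_prop) ?_)
  intro S hS h
  have := posRe_zero_zero hS; rw [h] at this; simp at this

theorem tsum_fin_cons {k : ℕ} {f : (Fin (k + 1) → ℤ) → ℂ} (hf : Summable f) :
    ∑' v, f v = ∑' (y : ℤ) (x : Fin k → ℤ), f (Fin.cons y x) := by
  have h := hf
  rw [← (Fin.consEquiv fun _ : Fin (k + 1) => ℤ).summable_iff] at h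
  rw [← (Fin.consEquiv fun _ : Fin (k + 1) => ℤ).tsum_eq]
  exact h.tsum_prod

theorem tsum_fin_cons' {k : ℕ} {f : (Fin (k + 1) → ℤ) → ℂ} (hf : Summable f) :
    ∑' v, f v = ∑' (x : Fin k → ℤ) (y : ℤ), f (Fin.cons y x) := by
  have h := hf
  rw [← (Fin.consEquiv fun _ : Fin (k + 1) => ℤ).summable_iff] at h
  rw [tsum_fin_cons hf]
  exact Summable.tsum_comm (f := fun (x : Fin k → ℤ) (y : ℤ) => f (Fin.cons y x)) h.prod_symm

/-- The inversion formula for theta series attached to a symmetric complex matrix with positive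
definite real part. The factor `D` is a continuous square root of the determinant. It is proved one
variable at a time, by passing to the Schur complement. -/
theorem exists_inversion (k : ℕ) : ∃ D : Matrix (Fin k) (Fin k) ℂ → ℂ,
    ContinuousOn D (posRe k) ∧ (∀ S ∈ posRe k, D S ^ 2 = S.det) ∧
    ∀ S ∈ posRe k, ∀ z, ∑' y, dualTerm S z y = D S * ∑' x, gaussTerm S z x := by
  induction k with
  | zero => exact ⟨fun _ => 1, continuousOn_const, by simp, by simp [dualTerm, gaussTerm]⟩
  | succ k ih =>
    obtain ⟨D, h1, h2, h3⟩ := ih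
    refine ⟨fun S => S 0 0 ^ (1 / 2 : ℂ) * D (schur S), ?_, ?_, ?_⟩
    · refine ContinuousOn.mul ?_ (h1.comp continuousOn_schur fun S hS => schur_mem hS)
      exact ContinuousOn.cpow (by fun_prop) continuousOn_const
        fun S hS => Or.inl (posRe_zero_zero hS)
    · intro S hS
      have hs0 : S 0 0 ≠ 0 := by
        intro h; have := posRe_zero_zero hS; rw [h] at this; simp at this
      rw [mul_pow, h2 _ (schur_mem hS), ← Complex.cpow_nat_mul, det_schur hs0]
      simp
    · intro S hS z
      have hs := posRe_zero_zero hS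
      change _ = S 0 0 ^ (1 / 2 : ℂ) * D (schur S) * _
      rw [tsum_fin_cons (summable_dualTerm hS z).of_norm,
        tsum_fin_cons' (summable_gaussTerm hS z).of_norm]
      have hsw : ∑' (y : ℤ) (x : Fin k → ℤ), mixedTerm S z y x =
          ∑' (x : Fin k → ℤ) (y : ℤ), mixedTerm S z y x :=
        (Summable.tsum_comm (f := fun (y : ℤ) (x : Fin k → ℤ) => mixedTerm S z y x)
          (summable_mixedTerm hS z)).symm
      calc ∑' (y : ℤ) (x : Fin k → ℤ), dualTerm S z (Fin.cons y x)
          = D (schur S) * ∑' (y : ℤ) (x : Fin k → ℤ), mixedTerm S z y x := by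
            -- for fixed `y`, inversion in the last `k` variables
            rw [← tsum_mul_left]
            refine tsum_congr fun y => ?_
            simp only [← mixedTerm_eq_gaussTerm hS.1, dualTerm_cons hS, tsum_mul_left,
              h3 _ (schur_mem hS)]
            ring
        _ = _ := by
            rw [hsw, mul_comm (S 0 0 ^ (1 / 2 : ℂ)) (D (schur S)), mul_assoc]
            refine congrArg _ ?_
            -- for fixed `x`, inversion in the zeroth variable
            rw [← tsum_mul_left]
            refine tsum_congr fun x => ?_
            simp only [mixedTerm, tsum_mul_left, tsum_gauss_one hs, gaussTerm_cons hS.1]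
            ring

/-! ### The inversion formula for matrix variables -/

/-- The entries of an `m × n` matrix, as a vector of length `m * n`. -/
def flatten {R : Type*} {m n : ℕ} : Matrix (Fin m) (Fin n) R ≃ (Fin (m * n) → R) where
  toFun X k := X (finProdFinEquiv.symm k).1 (finProdFinEquiv.symm k).2
  invFun x := of fun i j => x (finProdFinEquiv (i, j))
  left_inv X := by ext; simp
  right_inv x := by ext; simp [-finProdFinEquiv_symm_apply]

/-- `T ⊗ Y` as a square matrix of size `m * n`. -/
def kron {m n : ℕ} (T : Matrix (Fin m) (Fin m) ℂ) (Y : Matrix (Fin n) (Fin n) ℂ) :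
    Matrix (Fin (m * n)) (Fin (m * n)) ℂ :=
  (T ⊗ₖ Y).submatrix finProdFinEquiv.symm finProdFinEquiv.symm

theorem quad_kron {m n : ℕ} (T : Matrix (Fin m) (Fin m) ℂ) {Y : Matrix (Fin n) (Fin n) ℂ}
    (hY : Y.IsSymm) (X : Matrix (Fin m) (Fin n) ℂ) :
    flatten X ⬝ᵥ kron T Y *ᵥ flatten X = (T * (X * Y * Xᵀ)).trace := by
  have h1 : flatten X ⬝ᵥ kron T Y *ᵥ flatten X =
      ∑ i, ∑ j, ∑ i', ∑ j', X i j * (T i i' * Y j j' * X i' j') := by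
    simp only [dotProduct, mulVec]
    rw [← finProdFinEquiv.sum_comp, Fintype.sum_prod_type]
    refine Finset.sum_congr rfl fun i _ => Finset.sum_congr rfl fun j _ => ?_
    rw [← finProdFinEquiv.sum_comp, Fintype.sum_prod_type, Finset.mul_sum]
    refine Finset.sum_congr rfl fun i' _ => ?_
    rw [Finset.mul_sum]
    refine Finset.sum_congr rfl fun j' _ => ?_
    simp [-finProdFinEquiv_symm_apply, flatten, kron, kroneckerMap_apply]
  rw [h1]
  simp only [trace, diag_apply, mul_apply, transpose_apply, Finset.mul_sum, Finset.sum_mul]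
  refine Finset.sum_congr rfl fun i _ => ?_
  rw [Finset.sum_comm]
  refine Finset.sum_congr rfl fun i' _ => Finset.sum_congr rfl fun j _ =>
    Finset.sum_congr rfl fun j' _ => ?_
  rw [hY.apply j j']
  ring

theorem sum_flatten {m n : ℕ} (X Z : Matrix (Fin m) (Fin n) ℂ) :
    ∑ k, flatten X k * flatten Z k = (X * Zᵀ).trace := by
  rw [← finProdFinEquiv.sum_comp, Fintype.sum_prod_type]
  simp [-finProdFinEquiv_symm_apply, flatten, trace, mul_apply]

theorem kron_mem {m n : ℕ} {T : Matrix (Fin m) (Fin m) ℝ} (hT : T.PosDef)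
    {Y : Matrix (Fin n) (Fin n) ℂ} (hY : Y ∈ posRe n) :
    kron (T.map Complex.ofReal) Y ∈ posRe (m * n) := by
  refine ⟨?_, ?_⟩
  · have hTs : T.IsSymm := by
      have := hT.1
      rwa [Matrix.IsHermitian, conjTranspose_eq_transpose_of_trivial] at this
    ext a b
    simp only [kron, transpose_apply, submatrix_apply, kroneckerMap_apply, map_apply]
    rw [hTs.apply, hY.1.apply]
  · have e : (kron (T.map Complex.ofReal) Y).map Complex.re =
        (T ⊗ₖ Y.map Complex.re).submatrix finProdFinEquiv.symm finProdFinEquiv.symm := by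
      ext a b
      simp [kron, kroneckerMap_apply]
    rw [e]
    exact (hT.kronecker hY.2).submatrix finProdFinEquiv.symm.injective

theorem kron_inv {m n : ℕ} (T : Matrix (Fin m) (Fin m) ℂ) (Y : Matrix (Fin n) (Fin n) ℂ) :
    (kron T Y)⁻¹ = kron T⁻¹ Y⁻¹ := by
  rw [kron, kron, inv_submatrix_equiv, inv_kronecker]

theorem det_kron {m n : ℕ} (T : Matrix (Fin m) (Fin m) ℂ) (Y : Matrix (Fin n) (Fin n) ℂ) :
    (kron T Y).det = T.det ^ n * Y.det ^ m := by
  rw [kron, det_submatrix_equiv_self, det_kronecker]; simp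

theorem continuous_kron {m n : ℕ} (T : Matrix (Fin m) (Fin m) ℂ) :
    Continuous (kron T : Matrix (Fin n) (Fin n) ℂ → _) := by
  refine continuous_pi fun a => continuous_pi fun b => ?_
  simp only [kron, submatrix_apply, kroneckerMap_apply]
  fun_prop

/-- The term `e^{-π σ(T x Y ᵗx) + 2πi σ(x ᵗz)}`. -/
def matTerm {m n : ℕ} (T : Matrix (Fin m) (Fin m) ℂ) (Y : Matrix (Fin n) (Fin n) ℂ)
    (z : Matrix (Fin m) (Fin n) ℂ) (x : Matrix (Fin m) (Fin n) ℤ) : ℂ :=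
  Complex.exp (-(Real.pi * (T * (intC x * Y * (intC x)ᵀ)).trace) +
    2 * Real.pi * Complex.I * (intC x * zᵀ).trace)

/-- The term `e^{-π σ(T⁻¹ (z-y) Y⁻¹ ᵗ(z-y))}`. -/
def matDual {m n : ℕ} (T : Matrix (Fin m) (Fin m) ℂ) (Y : Matrix (Fin n) (Fin n) ℂ)
    (z : Matrix (Fin m) (Fin n) ℂ) (y : Matrix (Fin m) (Fin n) ℤ) : ℂ :=
  Complex.exp (-(Real.pi * (T⁻¹ * ((z - intC y) * Y⁻¹ * (z - intC y)ᵀ)).trace))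

theorem matTerm_eq {m n : ℕ} (T : Matrix (Fin m) (Fin m) ℂ) {Y : Matrix (Fin n) (Fin n) ℂ}
    (hY : Y.IsSymm) (z : Matrix (Fin m) (Fin n) ℂ) (x : Matrix (Fin m) (Fin n) ℤ) :
    matTerm T Y z x = gaussTerm (kron T Y) (flatten z) (flatten x) := by
  have e : (fun i => ((flatten x i : ℤ) : ℂ)) = flatten (intC x) := rfl
  rw [matTerm, gaussTerm, e, quad_kron T hY, ← sum_flatten, Finset.mul_sum]
  congr 2
  refine Finset.sum_congr rfl fun k _ => ?_
  rw [← e]; ring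

theorem matDual_eq {m n : ℕ} (T : Matrix (Fin m) (Fin m) ℂ) {Y : Matrix (Fin n) (Fin n) ℂ}
    (hY : Y.IsSymm) (z : Matrix (Fin m) (Fin n) ℂ) (y : Matrix (Fin m) (Fin n) ℤ) :
    matDual T Y z y = dualTerm (kron T Y) (flatten z) (flatten y) := by
  have e : (fun i => flatten z i - ((flatten y i : ℤ) : ℂ)) = flatten (z - intC y) := rfl
  have hYi : (Y⁻¹).IsSymm := by rw [Matrix.IsSymm, transpose_nonsing_inv, hY.eq]
  rw [matDual, dualTerm, e, kron_inv, quad_kron _ hYi]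

theorem summable_matTerm {m n : ℕ} {T : Matrix (Fin m) (Fin m) ℝ} (hT : T.PosDef)
    {Y : Matrix (Fin n) (Fin n) ℂ} (hY : Y ∈ posRe n) (z : Matrix (Fin m) (Fin n) ℂ) :
    Summable fun x => ‖matTerm (T.map Complex.ofReal) Y z x‖ := by
  simp only [matTerm_eq _ hY.1]
  exact (summable_gaussTerm (kron_mem hT hY) (flatten z)).comp_injective flatten.injective

/-- The inversion formula for `T ⊗ Y`. Only the square and the continuity of the factor `D` are
recorded; they determine it up to sign. -/
theorem exists_matrix_inversion {m : ℕ} (n : ℕ) {T : Matrix (Fin m) (Fin m) ℝ} (hT : T.PosDef) :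
    ∃ D : Matrix (Fin n) (Fin n) ℂ → ℂ, ContinuousOn D (posRe n) ∧
      (∀ Y ∈ posRe n, D Y ^ 2 = (T.det : ℂ) ^ n * Y.det ^ m) ∧
      ∀ Y ∈ posRe n, ∀ z, ∑' y, matDual (T.map Complex.ofReal) Y z y =
        D Y * ∑' x, matTerm (T.map Complex.ofReal) Y z x := by
  obtain ⟨D, h1, h2, h3⟩ := exists_inversion (m * n)
  refine ⟨fun Y => D (kron (T.map Complex.ofReal) Y),
    h1.comp (continuous_kron _).continuousOn fun Y hY => kron_mem hT hY, fun Y hY => ?_,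
    fun Y hY z => ?_⟩
  · rw [h2 _ (kron_mem hT hY), det_kron]
    congr 2
    exact (RingHom.map_det Complex.ofRealHom T).symm
  · simp only [matTerm_eq _ hY.1, matDual_eq _ hY.1]
    rw [flatten.tsum_eq (fun x => gaussTerm _ _ x), flatten.tsum_eq (fun x => dualTerm _ _ x)]
    exact h3 _ (kron_mem hT hY) _

/-! ### The trace form on rectangular matrices -/

/-- The bilinear form `σ(M X ᵗY)` on `m × n` matrices. -/
def bil {R : Type*} [CommRing R] {m n : ℕ} (M : Matrix (Fin m) (Fin m) R)
    (X Y : Matrix (Fin m) (Fin n) R) : R := (M * (X * Yᵀ)).trace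

section bil
variable {R : Type*} [CommRing R] {m n : ℕ} (M : Matrix (Fin m) (Fin m) R)
  (X X' Y Y' : Matrix (Fin m) (Fin n) R)

theorem bil_add_left : bil M (X + X') Y = bil M X Y + bil M X' Y := by
  simp [bil, Matrix.add_mul, Matrix.mul_add]
theorem bil_add_right : bil M X (Y + Y') = bil M X Y + bil M X Y' := by
  simp [bil, Matrix.mul_add]
theorem bil_sub_left : bil M (X - X') Y = bil M X Y - bil M X' Y := by
  simp [bil, Matrix.sub_mul, Matrix.mul_sub]
theorem bil_sub_right : bil M X (Y - Y') = bil M X Y - bil M X Y' := by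
  simp [bil, Matrix.mul_sub]
theorem bil_neg_left : bil M (-X) Y = -bil M X Y := by simp [bil]
theorem bil_neg_right : bil M X (-Y) = -bil M X Y := by simp [bil]
theorem bil_smul_left (a : R) : bil M (a • X) Y = a * bil M X Y := by simp [bil]
theorem bil_smul_right (a : R) : bil M X (a • Y) = a * bil M X Y := by simp [bil]
theorem bil_zero_left : bil M 0 Y = 0 := by simp [bil]
theorem bil_zero_right : bil M X 0 = 0 := by simp [bil]

theorem bil_mul_left (A : Matrix (Fin n) (Fin n) R) : bil M (X * A) Y = bil M X (Y * Aᵀ) := by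
  simp [bil, Matrix.mul_assoc]

variable {M} in
theorem bil_comm (hM : M.IsSymm) : bil M X Y = bil M Y X := by
  rw [bil, ← trace_transpose, transpose_mul, transpose_mul, transpose_transpose, hM.eq,
    trace_mul_comm, bil]

variable {M} in
theorem bil_mul_comm (hM : M.IsSymm) (A : Matrix (Fin n) (Fin n) R) :
    bil M (X * A) Y = bil M (Y * Aᵀ) X := by
  rw [bil_mul_left, bil_comm _ _ hM]

/-- Multiplying the first argument by a matrix `N` on the left amounts to replacing `M` by `M N`. -/
theorem bil_mul (N : Matrix (Fin m) (Fin m) R) : bil M (N * X) Y = bil (M * N) X Y := by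
  simp [bil, Matrix.mul_assoc]

theorem bil_one : bil 1 X Y = (X * Yᵀ).trace := by simp [bil]

theorem map_bil {S : Type*} [CommRing S] (f : R →+* S) :
    f (bil M X Y) = bil (M.map f) (X.map f) (Y.map f) := by
  rw [bil, bil, ← Matrix.transpose_map, ← Matrix.map_mul, ← Matrix.map_mul, trace, trace, map_sum]
  rfl

end bil

theorem intC_bil {m n : ℕ} (M : Matrix (Fin m) (Fin m) ℤ) (X Y : Matrix (Fin m) (Fin n) ℤ) :
    bil (intC M) (intC X) (intC Y) = (bil M X Y : ℤ) :=
  (map_bil M X Y (Int.castRingHom ℂ)).symm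

theorem intC_add {a b : Type*} (X Y : Matrix a b ℤ) : intC (X + Y) = intC X + intC Y := by
  ext; simp [intC]
theorem intC_neg {a b : Type*} (X : Matrix a b ℤ) : intC (-X) = -intC X := by
  ext; simp [intC]
theorem intC_sub {a b : Type*} (X Y : Matrix a b ℤ) : intC (X - Y) = intC X - intC Y := by
  ext; simp [intC]
theorem intC_mul {a b c : Type*} [Fintype b] (X : Matrix a b ℤ) (Y : Matrix b c ℤ) :
    intC (X * Y) = intC X * intC Y := Matrix.map_mul (f := Int.castRingHom ℂ)
theorem intC_smul {a b : Type*} (k : ℤ) (X : Matrix a b ℤ) : intC (k • X) = (k : ℂ) • intC X := by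
  ext; simp [intC]
theorem intC_transpose {a b : Type*} (X : Matrix a b ℤ) : intC Xᵀ = (intC X)ᵀ := rfl
theorem intC_one {a : Type*} [DecidableEq a] : intC (1 : Matrix a a ℤ) = 1 := by
  ext i j; by_cases h : i = j <;> simp [intC, Matrix.one_apply, h]
theorem intC_injective {a b : Type*} : Function.Injective (intC : Matrix a b ℤ → Matrix a b ℂ) :=
  fun X Y h => by
    ext i j
    have := congrFun (congrFun h i) j
    simpa [intC] using this
theorem intC_det {a : Type*} [Fintype a] [DecidableEq a] (X : Matrix a a ℤ) :
    (intC X).det = (X.det : ℂ) := (RingHom.map_det (Int.castRingHom ℂ) X).symm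
theorem intC_isSymm {a : Type*} {M : Matrix a a ℤ} (hM : M.IsSymm) : (intC M).IsSymm := hM.map _

/-! ### The theta series: convergence, holomorphy, quasi-periodicity -/

theorem thetaTerm_eq_bil {n m : ℕ} (M : Matrix (Fin m) (Fin m) ℤ)
    (p : Matrix (Fin n) (Fin n) ℂ × Matrix (Fin m) (Fin n) ℂ) (ξ : Matrix (Fin m) (Fin n) ℤ) :
    thetaTerm M p ξ = Complex.exp (Real.pi * Complex.I *
      (bil (intC M) (intC ξ * p.1) (intC ξ) + 2 * bil (intC M) (intC ξ) p.2)) := by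
  rw [thetaTerm, bil, bil, Matrix.mul_add, trace_add, Matrix.mul_smul, trace_smul, smul_eq_mul]

theorem neg_I_smul_mem {n : ℕ} {Ω : Matrix (Fin n) (Fin n) ℂ} (hΩ : Ω ∈ siegelUpper n) :
    (-Complex.I) • Ω ∈ posRe n := by
  refine ⟨hΩ.1.smul _, ?_⟩
  have : ((-Complex.I) • Ω).map Complex.re = Ω.map Complex.im := by
    ext i j; simp
  rw [this]; exact hΩ.2

theorem intC_eq_map {a b : Type*} (M : Matrix a b ℤ) :
    intC M = (M.map (Int.cast : ℤ → ℝ)).map Complex.ofReal := by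
  ext; simp [intC]

theorem thetaTerm_eq_matTerm {n m : ℕ} (M : Matrix (Fin m) (Fin m) ℤ)
    (p : Matrix (Fin n) (Fin n) ℂ × Matrix (Fin m) (Fin n) ℂ) (ξ : Matrix (Fin m) (Fin n) ℤ) :
    thetaTerm M p ξ = matTerm (intC M) ((-Complex.I) • p.1) ((intC M)ᵀ * p.2) ξ := by
  rw [thetaTerm_eq_bil, matTerm]
  congr 1
  have h : (intC ξ * ((intC M)ᵀ * p.2)ᵀ).trace = bil (intC M) (intC ξ) p.2 := by
    rw [transpose_mul, transpose_transpose, ← Matrix.mul_assoc, trace_mul_comm, bil]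
  rw [h]
  simp only [Matrix.mul_smul, Matrix.smul_mul, trace_smul, smul_eq_mul]
  rw [bil]
  ring

theorem summable_thetaTerm {n m : ℕ} {M : Matrix (Fin m) (Fin m) ℤ}
    (hM : (M.map (Int.cast : ℤ → ℝ)).PosDef)
    {p : Matrix (Fin n) (Fin n) ℂ × Matrix (Fin m) (Fin n) ℂ} (hp : p ∈ siegelJacobi n m) :
    Summable fun ξ => ‖thetaTerm M p ξ‖ := by
  simp only [thetaTerm_eq_matTerm]
  rw [intC_eq_map]
  exact summable_matTerm hM (neg_I_smul_mem hp.1) _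

/-- Quasi-periodicity of the theta series. The translation `μ` need not be integral, only `M μ`. -/
theorem theta_shift {n m : ℕ} {M : Matrix (Fin m) (Fin m) ℤ} (hM : M.IsSymm)
    {Ω : Matrix (Fin n) (Fin n) ℂ} (hΩ : Ω.IsSymm) (Z μ : Matrix (Fin m) (Fin n) ℂ)
    (l ν : Matrix (Fin m) (Fin n) ℤ) (hμ : intC M * μ = intC ν) :
    theta M (Ω, Z + intC l * Ω + μ) = Complex.exp (-(Real.pi * Complex.I *
      (bil (intC M) (intC l * Ω) (intC l) + 2 * bil (intC M) (intC l) Z))) * theta M (Ω, Z) := by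
  have hMC := intC_isSymm hM
  rw [theta, theta, ← (Equiv.addRight l).tsum_eq (thetaTerm M (Ω, Z)), ← tsum_mul_left]
  refine tsum_congr fun ξ => ?_
  have h1 : bil (intC M) (intC ξ) μ = (bil 1 ξ ν : ℤ) := by
    rw [← intC_bil, intC_one, bil_comm _ _ hMC, ← Matrix.one_mul (intC M), ← bil_mul, hμ,
      bil_comm _ _ Matrix.isSymm_one]
  rw [thetaTerm_eq_bil, thetaTerm_eq_bil, ← Complex.exp_add, Complex.exp_eq_exp_iff_exists_int]
  refine ⟨bil 1 ξ ν, ?_⟩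
  have h2 : bil (intC M) (intC ξ) (intC l * Ω) = bil (intC M) (intC ξ * Ω) (intC l) := by
    rw [bil_mul_left, hΩ.eq]
  have h3 : bil (intC M) (intC l * Ω) (intC ξ) = bil (intC M) (intC ξ * Ω) (intC l) := by
    rw [bil_mul_comm _ _ hMC, hΩ.eq]
  simp only [Equiv.coe_addRight, intC_add, Matrix.add_mul, bil_add_left, bil_add_right, h1, h2, h3]
  ring

/-- The series converges with room to spare, which allows for perturbations of the exponent of size
`ε |x|²`. -/
theorem exists_summable_gaussTerm_mul {k : ℕ} {S : Matrix (Fin k) (Fin k) ℂ} (hS : S ∈ posRe k)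
    (z : Fin k → ℂ) : ∃ ε > 0, Summable fun x : Fin k → ℤ =>
      ‖gaussTerm S z x‖ * Real.exp (ε * ∑ i, (x i : ℝ) ^ 2) := by
  have hq : ∀ (t : ℝ) (x : Fin k → ℝ), (fun i => ((t • x) i : ℂ)) = (t : ℂ) • fun i => (x i : ℂ) :=
    fun t x => by ext i; simp
  have hh : ∀ (t : ℝ) (x : Fin k → ℝ), (Real.pi * ((fun i => ((t • x) i : ℂ)) ⬝ᵥ S *ᵥ
      fun i => ((t • x) i : ℂ)) : ℂ) = t ^ 2 * (Real.pi * ((fun i => (x i : ℂ)) ⬝ᵥ S *ᵥ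
      fun i => (x i : ℂ))) := fun t x => by
    rw [hq, mulVec_smul, smul_dotProduct, dotProduct_smul]
    simp only [smul_eq_mul]; ring
  obtain ⟨ε, hε, h⟩ := exists_le_of_homogeneous
    (Q := fun x : Fin k → ℝ => (Real.pi * ((fun i => (x i : ℂ)) ⬝ᵥ S *ᵥ fun i => (x i : ℂ)) : ℂ).re)
    (by simp only [dotProduct, mulVec]; fun_prop)
    (fun t x => by rw [hh, ← Complex.ofReal_pow, Complex.re_ofReal_mul])
    (fun x hx => by
      rw [Complex.re_ofReal_mul]
      exact mul_pos Real.pi_pos (posRe_re_pos_ofReal hS hx))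
  refine ⟨ε / 2, half_pos hε, ?_⟩
  have hs := summable_norm_cexp
    (q := fun x : Fin k → ℝ => Real.pi * ((fun i => (x i : ℂ)) ⬝ᵥ S *ᵥ fun i => (x i : ℂ)) -
      ((ε / 2 * ∑ i, x i ^ 2 : ℝ) : ℂ))
    (by simp only [dotProduct, mulVec]; fun_prop)
    (fun t x => by
      rw [hh]
      simp only [Pi.smul_apply, smul_eq_mul, mul_pow, ← Finset.mul_sum]
      push_cast; ring)
    (fun x hx => by
      rw [Complex.sub_re, Complex.ofReal_re]
      have h1 := h x
      have h2 : 0 < ∑ i, x i ^ 2 := by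
        obtain ⟨i, hi⟩ := Function.ne_iff.1 hx
        exact Finset.sum_pos' (fun _ _ => sq_nonneg _) ⟨i, Finset.mem_univ i, sq_pos_iff.2 hi⟩
      have := mul_pos hε h2
      linarith)
    (fun i => 2 * Real.pi * Complex.I * z i) 0
  refine hs.congr fun x => ?_
  rw [gaussTerm, ← Complex.norm_of_nonneg (Real.exp_pos (ε / 2 * ∑ i, (x i : ℝ) ^ 2)).le, ← norm_mul,
    Complex.ofReal_exp, ← Complex.exp_add]
  congr 2
  push_cast
  ring

/-- Termwise differentiation of a series of exponentials of linear forms. -/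
theorem differentiableAt_tsum_cexp {ι E : Type*} [NormedAddCommGroup E] [NormedSpace ℂ E]
    (L : ι → E →L[ℂ] ℂ) (q : ι → ℝ) (hq : ∀ i, 0 ≤ q i) {K : ℝ} (hK : 0 ≤ K)
    (hL : ∀ i, ‖L i‖ ≤ K * q i) {ε : ℝ} (hε : 0 < ε) (p₀ : E)
    (hs : Summable fun i => ‖Complex.exp (L i p₀)‖ * Real.exp (ε * q i)) :
    DifferentiableAt ℂ (fun p => ∑' i, Complex.exp (L i p)) p₀ := by
  set r : ℝ := ε / (2 * (K + 1)) with hr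
  have hr0 : 0 < r := by positivity
  have hb : ∀ i, ∀ p ∈ Metric.ball p₀ r, ‖Complex.exp (L i p) • L i‖ ≤
      K * (2 / ε) * (‖Complex.exp (L i p₀)‖ * Real.exp (ε * q i)) := by
    intro i p hp
    rw [norm_smul]
    have h1 : ‖Complex.exp (L i p)‖ ≤ ‖Complex.exp (L i p₀)‖ * Real.exp (ε / 2 * q i) := by
      rw [Complex.norm_exp, Complex.norm_exp, ← Real.exp_add, Real.exp_le_exp]
      have h2 : L i p = L i p₀ + L i (p - p₀) := by rw [map_sub]; ring
      rw [h2, Complex.add_re]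
      have h3 := (Complex.re_le_norm (L i (p - p₀))).trans ((L i).le_opNorm (p - p₀))
      have h4 : ‖L i‖ * ‖p - p₀‖ ≤ (K * q i) * r :=
        mul_le_mul (hL i) (by rw [← dist_eq_norm]; exact (Metric.mem_ball.1 hp).le)
          (norm_nonneg _) (mul_nonneg hK (hq i))
      have h5 : K * r ≤ ε / 2 := by
        rw [hr, mul_div_assoc', div_le_div_iff₀ (by positivity) (by norm_num)]
        nlinarith
      nlinarith [hq i]
    have h6 : q i ≤ 2 / ε * Real.exp (ε / 2 * q i) := by
      have := Real.add_one_le_exp (ε / 2 * q i)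
      rw [div_mul_eq_mul_div, le_div_iff₀ hε]
      linarith
    have h7 : Real.exp (ε * q i) = Real.exp (ε / 2 * q i) * Real.exp (ε / 2 * q i) := by
      rw [← Real.exp_add]; ring_nf
    calc ‖Complex.exp (L i p)‖ * ‖L i‖ ≤
        (‖Complex.exp (L i p₀)‖ * Real.exp (ε / 2 * q i)) *
          (K * (2 / ε * Real.exp (ε / 2 * q i))) :=
          mul_le_mul h1 ((hL i).trans (mul_le_mul_of_nonneg_left h6 hK)) (norm_nonneg _)
            (by positivity)
      _ = _ := by rw [h7]; ring
  refine (hasFDerivAt_tsum_of_isPreconnected (hs.mul_left (K * (2 / ε))) Metric.isOpen_ball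
    (convex_ball p₀ r).isPreconnected (fun i p _ => ((L i).hasFDerivAt (x := p)).cexp) hb
    (Metric.mem_ball_self hr0) ?_ (Metric.mem_ball_self hr0)).differentiableAt
  refine Summable.of_norm (hs.of_nonneg_of_le (fun _ => norm_nonneg _) fun i => ?_)
  exact le_mul_of_one_le_right (norm_nonneg _) (Real.one_le_exp (mul_nonneg hε.le (hq i)))

/-- The exponent of a term of the theta series, as a linear form in `(Ω, Z)`. -/
def thetaExponent {n m : ℕ} (M : Matrix (Fin m) (Fin m) ℤ) (ξ : Matrix (Fin m) (Fin n) ℤ) :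
    (Matrix (Fin n) (Fin n) ℂ × Matrix (Fin m) (Fin n) ℂ) →ₗ[ℂ] ℂ where
  toFun p := Real.pi * Complex.I *
    (bil (intC M) (intC ξ * p.1) (intC ξ) + 2 * bil (intC M) (intC ξ) p.2)
  map_add' p p' := by
    simp only [Prod.fst_add, Prod.snd_add, Matrix.mul_add, bil_add_left, bil_add_right]; ring
  map_smul' c p := by
    simp only [Prod.smul_fst, Prod.smul_snd, Matrix.mul_smul, bil_smul_left, bil_smul_right,
      RingHom.id_apply, smul_eq_mul]; ring

/-- The exponent of a term of the theta series is bounded by a multiple of `|ξ|²`. -/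
theorem norm_bil_le {n m : ℕ} (M : Matrix (Fin m) (Fin m) ℤ) (ξ : Matrix (Fin m) (Fin n) ℤ)
    {q : ℝ} (hξ : ∀ i j, (ξ i j : ℝ) ^ 2 ≤ q) (Ω : Matrix (Fin n) (Fin n) ℂ)
    (Z : Matrix (Fin m) (Fin n) ℂ) {r : ℝ} (hΩ : ∀ i j, ‖Ω i j‖ ≤ r) (hZ : ∀ i j, ‖Z i j‖ ≤ r) :
    ‖bil (intC M) (intC ξ * Ω) (intC ξ)‖ ≤ (∑ a, ∑ b, ∑ _j : Fin n, ∑ _i : Fin n, |(M a b : ℝ)|) * (q * r) ∧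
    ‖bil (intC M) (intC ξ) Z‖ ≤ (∑ a, ∑ b, ∑ _i : Fin n, |(M a b : ℝ)|) * (q * r) := by
  constructor
  · simp only [bil, trace, diag_apply, mul_apply, transpose_apply, Finset.mul_sum, Finset.sum_mul]
    refine (norm_sum_le _ _).trans (Finset.sum_le_sum fun a _ => (norm_sum_le _ _).trans
      (Finset.sum_le_sum fun b _ => (norm_sum_le _ _).trans (Finset.sum_le_sum fun j _ =>
      (norm_sum_le _ _).trans (Finset.sum_le_sum fun i _ => ?_))))
    have h1 := hξ b i
    have h2 := hξ a j
    have h3 : |(ξ b i : ℝ)| * |(ξ a j : ℝ)| ≤ q := by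
      nlinarith [sq_nonneg (|(ξ b i : ℝ)| - |(ξ a j : ℝ)|), sq_abs (ξ b i : ℝ), sq_abs (ξ a j : ℝ)]
    have h4 := mul_le_mul h3 (hΩ i j) (norm_nonneg _) ((sq_nonneg _).trans h1)
    simp only [intC, map_apply, norm_mul, Complex.norm_intCast]
    calc _ = |(M a b : ℝ)| * (|(ξ b i : ℝ)| * |(ξ a j : ℝ)| * ‖Ω i j‖) := by ring
      _ ≤ _ := mul_le_mul_of_nonneg_left h4 (abs_nonneg _)
  · simp only [bil, trace, diag_apply, mul_apply, transpose_apply, Finset.mul_sum, Finset.sum_mul]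
    refine (norm_sum_le _ _).trans (Finset.sum_le_sum fun a _ => (norm_sum_le _ _).trans
      (Finset.sum_le_sum fun b _ => (norm_sum_le _ _).trans (Finset.sum_le_sum fun i _ => ?_)))
    have h1 : |(ξ b i : ℝ)| ≤ q := by
      refine le_trans ?_ (hξ b i)
      rw [← sq_abs]
      exact_mod_cast (Int.le_self_sq |ξ b i|)
    have h4 := mul_le_mul h1 (hZ a i) (norm_nonneg _) ((abs_nonneg _).trans h1)
    simp only [intC, map_apply, norm_mul, Complex.norm_intCast]
    exact mul_le_mul_of_nonneg_left h4 (abs_nonneg _)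

theorem differentiableOn_theta {n m : ℕ} {M : Matrix (Fin m) (Fin m) ℤ}
    (hM : (M.map (Int.cast : ℤ → ℝ)).PosDef) :
    DifferentiableOn ℂ (theta (n := n) M) (siegelJacobi n m) := by
  let _ : ∀ a b : ℕ, NormedAddCommGroup (Matrix (Fin a) (Fin b) ℂ) :=
    fun a b => Matrix.normedAddCommGroup
  let _ : ∀ a b : ℕ, NormedSpace ℂ (Matrix (Fin a) (Fin b) ℂ) := fun a b => Matrix.normedSpace
  intro p hp
  refine DifferentiableAt.differentiableWithinAt ?_
  obtain ⟨ε, hε, hs⟩ := exists_summable_gaussTerm_mul (kron_mem hM (neg_I_smul_mem hp.1))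
    (flatten ((intC M)ᵀ * p.2))
  have hs' := hs.comp_injective flatten.injective
  have hL : ∀ (ξ : Matrix (Fin m) (Fin n) ℤ) p', thetaTerm M p' ξ =
      Complex.exp (LinearMap.toContinuousLinearMap (thetaExponent M ξ) p') := fun ξ p' =>
    thetaTerm_eq_bil M p' ξ
  have hfun : theta (n := n) M = fun p' =>
      ∑' ξ, Complex.exp (LinearMap.toContinuousLinearMap (thetaExponent M ξ) p') := by
    funext p'
    exact tsum_congr fun ξ => hL ξ p'
  rw [hfun]
  set K₁ : ℝ := ∑ a, ∑ b, ∑ _j : Fin n, ∑ _i : Fin n, |(M a b : ℝ)| with hK₁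
  set K₂ : ℝ := ∑ a, ∑ b, ∑ _i : Fin n, |(M a b : ℝ)| with hK₂
  have hK₁0 : 0 ≤ K₁ := by positivity
  have hK₂0 : 0 ≤ K₂ := by positivity
  refine differentiableAt_tsum_cexp _ (fun ξ : Matrix (Fin m) (Fin n) ℤ =>
      ∑ k, ((flatten ξ k : ℤ) : ℝ) ^ 2) (fun ξ => by positivity) (K := Real.pi * (K₁ + 2 * K₂))
    (by positivity) (fun ξ => ?_) hε p ?_
  · set q : ℝ := ∑ k, ((flatten ξ k : ℤ) : ℝ) ^ 2 with hq
    have hξ : ∀ i j, (ξ i j : ℝ) ^ 2 ≤ q := fun i j => by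
      have := Finset.single_le_sum (f := fun k => ((flatten ξ k : ℤ) : ℝ) ^ 2) (fun k _ => sq_nonneg _)
        (Finset.mem_univ (finProdFinEquiv (i, j)))
      have e : flatten ξ (finProdFinEquiv (i, j)) = ξ i j := by
        simp [flatten, -finProdFinEquiv_symm_apply]
      rw [← e]
      exact this
    refine ContinuousLinearMap.opNorm_le_bound _ (by positivity) fun p' => ?_
    obtain ⟨h1, h2⟩ := norm_bil_le M ξ hξ p'.1 p'.2 (r := ‖p'‖)
      (fun i j => (Matrix.norm_entry_le_entrywise_sup_norm p'.1).trans (norm_fst_le p'))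
      (fun i j => (Matrix.norm_entry_le_entrywise_sup_norm p'.2).trans (norm_snd_le p'))
    change ‖Real.pi * Complex.I *
      (bil (intC M) (intC ξ * p'.1) (intC ξ) + 2 * bil (intC M) (intC ξ) p'.2)‖ ≤ _
    have h3 := norm_add_le (bil (intC M) (intC ξ * p'.1) (intC ξ)) (2 * bil (intC M) (intC ξ) p'.2)
    rw [norm_mul, norm_mul, Complex.norm_I, Complex.norm_real, Real.norm_of_nonneg Real.pi_pos.le,
      mul_one, mul_assoc, mul_assoc]
    rw [norm_mul, Complex.norm_ofNat] at h3
    refine mul_le_mul_of_nonneg_left ?_ Real.pi_pos.le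
    calc _ ≤ K₁ * (q * ‖p'‖) + 2 * (K₂ * (q * ‖p'‖)) := by linarith
      _ = _ := by ring
  · refine hs'.congr fun ξ => ?_
    have hY := (neg_I_smul_mem hp.1).1
    have e : gaussTerm (kron ((M.map (Int.cast : ℤ → ℝ)).map Complex.ofReal) (-Complex.I • p.1))
        (flatten ((intC M)ᵀ * p.2)) (flatten ξ) = thetaTerm M p ξ := by
      rw [thetaTerm_eq_matTerm, matTerm_eq _ hY, intC_eq_map M]
    exact congrArg (fun w : ℂ => ‖w‖ * Real.exp (ε * ∑ k, ((flatten ξ k : ℤ) : ℝ) ^ 2))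
      (e.trans (hL ξ p))

/-- At `(iI, 0)` all terms of the theta series are positive real numbers. -/
theorem theta_basePt_ne_zero {n m : ℕ} {M : Matrix (Fin m) (Fin m) ℤ}
    (hM : (M.map (Int.cast : ℤ → ℝ)).PosDef) : theta (n := n) M (basePt n, 0) ≠ 0 := by
  have hs := summable_thetaTerm (n := n) hM (p := (basePt n, 0)) ⟨basePt_mem n, Set.mem_univ _⟩
  have h : ∀ ξ : Matrix (Fin m) (Fin n) ℤ, thetaTerm M (basePt n, 0) ξ =
      ((‖thetaTerm M (basePt n, 0) ξ‖ : ℝ) : ℂ) := fun ξ => by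
    have e : thetaTerm M (basePt n, 0) ξ = ((Real.exp (-(Real.pi * (bil M ξ ξ : ℤ))) : ℝ) : ℂ) := by
      rw [thetaTerm_eq_bil, basePt, Matrix.mul_smul, Matrix.mul_one, bil_smul_left, bil_zero_right,
        intC_bil, Complex.ofReal_exp]
      congr 1
      push_cast
      linear_combination (Real.pi * ((bil M ξ ξ : ℤ) : ℂ)) * Complex.I_mul_I
    rw [e, Complex.norm_real, Real.norm_of_nonneg (Real.exp_pos _).le]
  rw [theta, tsum_congr h, ← Complex.ofReal_tsum]
  refine Complex.ofReal_ne_zero.2 (ne_of_gt (hs.tsum_pos (fun _ => norm_nonneg _) 0 ?_))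
  rw [norm_pos_iff, thetaTerm]
  exact Complex.exp_ne_zero _

/-! ### The automorphy factor of weight one half -/

theorem Jhalf_sq {n : ℕ} (x : Mp n) {Ω : Matrix (Fin n) (Fin n) ℂ} (hΩ : Ω ∈ siegelUpper n) :
    Jhalf x Ω ^ 2 = (autJ x.g Ω).det := by
  have hd := norm_pos_iff.2 (autJ_det_ne_zero x.g hΩ)
  have h1 : (‖(autJ x.g Ω).det‖ ^ (1 / 2 : ℝ)) ^ 2 = ‖(autJ x.g Ω).det‖ := by
    rw [← Real.rpow_natCast, ← Real.rpow_mul hd.le]; norm_num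
  have hd' : (‖(autJ x.g Ω).det‖ : ℂ) ≠ 0 := by exact_mod_cast hd.ne'
  rw [Jhalf, mul_pow, mul_pow, inv_pow, x.sq, inv_inv, eps_sq x.g hΩ (basePt_mem n),
    ← Complex.ofReal_pow, h1]
  have h2 := alpha_conj (basePt_mem n) x.g
  have h3 : alpha Ω x.g * ‖(autJ x.g Ω).det‖ = (autJ x.g Ω).det := by
    rw [alpha, div_mul_cancel₀ _ hd']
  linear_combination (alpha Ω x.g * ‖(autJ x.g Ω).det‖) * h2 + h3

theorem Jhalf_ne_zero {n : ℕ} (x : Mp n) {Ω : Matrix (Fin n) (Fin n) ℂ} (hΩ : Ω ∈ siegelUpper n) :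
    Jhalf x Ω ≠ 0 := fun h => autJ_det_ne_zero x.g hΩ (by rw [← Jhalf_sq x hΩ, h]; simp)

theorem Jhalf_mul {n : ℕ} (x y : Mp n) {Ω : Matrix (Fin n) (Fin n) ℂ} (hΩ : Ω ∈ siegelUpper n) :
    Jhalf (x * y) Ω = Jhalf x (act y.g Ω) * Jhalf y Ω := by
  have hb := basePt_mem n
  have hyb := act_mem y.g hb
  have hyΩ := act_mem y.g hΩ
  have h0 : beta (basePt n) x.g y.g ≠ 0 := eps_ne_zero _ hb hyb
  have hx := x.ε_ne_zero
  have hy := y.ε_ne_zero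
  have h1 : eps x.g (act y.g Ω) (act y.g (basePt n)) =
      beta (basePt n) x.g y.g * eps x.g (act y.g Ω) (basePt n) := by
    rw [beta, eps_triple x.g hb hyb hyΩ]
  rw [Jhalf, Jhalf, Jhalf, Mp.mul_g, Mp.mul_ε, eps_mul _ _ hΩ hb, h1, autJ_mul _ _ hΩ, det_mul,
    norm_mul, Real.mul_rpow (norm_nonneg _) (norm_nonneg _)]
  push_cast
  field_simp

theorem Jhalf_one {n : ℕ} {Ω : Matrix (Fin n) (Fin n) ℂ} (hΩ : Ω ∈ siegelUpper n) :
    Jhalf (1 : Mp n) Ω = 1 := by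
  rw [Jhalf, Mp.one_ε, Mp.one_g, eps_one hΩ (basePt_mem n), autJ_one]
  simp

theorem continuousOn_Jhalf {n : ℕ} (x : Mp n) : ContinuousOn (Jhalf x) (siegelUpper n) := by
  have h1 := continuousOn_eps x.g (s := siegelUpper n) continuousOn_id
    (continuousOn_const (c := basePt n)) (fun _ h => h) (fun _ _ => basePt_mem n)
  have h2 : Continuous fun Ω => (autJ x.g Ω).det := by
    apply Continuous.matrix_det; unfold autJ; fun_prop
  have h3 : ContinuousOn (fun Ω => ((‖(autJ x.g Ω).det‖ ^ (1 / 2 : ℝ) : ℝ) : ℂ)) (siegelUpper n) :=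
    Complex.continuous_ofReal.comp_continuousOn (h2.norm.continuousOn.rpow_const
      fun _ _ => Or.inr (by norm_num))
  exact (continuousOn_const.mul h1).mul h3

/-! ### Multipliers of the theta series -/

/-- The action `(Ω, Z) ↦ (g·Ω, Z (CΩ+D)⁻¹)` of the symplectic group. -/
def spAct {n m : ℕ} (g : Sp n) (p : Matrix (Fin n) (Fin n) ℂ × Matrix (Fin m) (Fin n) ℂ) :
    Matrix (Fin n) (Fin n) ℂ × Matrix (Fin m) (Fin n) ℂ :=
  (act g p.1, p.2 * (autJ g p.1)⁻¹)

theorem spAct_mem {n m : ℕ} (g : Sp n) {p : Matrix (Fin n) (Fin n) ℂ × Matrix (Fin m) (Fin n) ℂ}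
    (hp : p ∈ siegelJacobi n m) : spAct g p ∈ siegelJacobi n m := ⟨act_mem g hp.1, Set.mem_univ _⟩

theorem spAct_mul {n m : ℕ} (g h : Sp n) {p : Matrix (Fin n) (Fin n) ℂ × Matrix (Fin m) (Fin n) ℂ}
    (hp : p ∈ siegelJacobi n m) : spAct (g * h) p = spAct g (spAct h p) := by
  simp only [spAct, act_mul g h hp.1, autJ_mul g h hp.1, Matrix.mul_inv_rev, Matrix.mul_assoc]

theorem spAct_one {n m : ℕ} (p : Matrix (Fin n) (Fin n) ℂ × Matrix (Fin m) (Fin n) ℂ) :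
    spAct 1 p = p := by
  simp [spAct, act_one, autJ_one]

/-- The quadratic form `σ(M Z (CΩ+D)⁻¹ C ᵗZ)`. -/
def spQuad {n m : ℕ} (M : Matrix (Fin m) (Fin m) ℂ) (g : Sp n)
    (p : Matrix (Fin n) (Fin n) ℂ × Matrix (Fin m) (Fin n) ℂ) : ℂ :=
  bil M (p.2 * ((autJ g p.1)⁻¹ * blkC g)) p.2

/-- The cocycle rule for `(CΩ+D)⁻¹ C`. -/
theorem autJ_inv_mul_blkC_mul {n : ℕ} (g h : Sp n) {Ω : Matrix (Fin n) (Fin n) ℂ}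
    (hΩ : Ω ∈ siegelUpper n) : (autJ (g * h) Ω)⁻¹ * blkC (g * h) =
      (autJ h Ω)⁻¹ * ((autJ g (act h Ω))⁻¹ * blkC g) * ((autJ h Ω)⁻¹)ᵀ + (autJ h Ω)⁻¹ * blkC h := by
  obtain ⟨_, _, c, _⟩ := blk_mul g h
  obtain ⟨r1, r2, r3⟩ := blk_rel h
  have hu := autJ_isUnit h hΩ
  have hu' : IsUnit (autJ h Ω)ᵀ.det := by rwa [det_transpose]
  have hv := autJ_isUnit g (act_mem h hΩ)
  have e1 : (autJ h Ω)ᵀ * act h Ω = (blkA h * Ω + blkB h)ᵀ := by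
    rw [← (act_isSymm h hΩ).eq, ← transpose_mul, act, nonsing_inv_mul_cancel_right _ _ hu]
  have e2 : (autJ h Ω)ᵀ * (blkA h - act h Ω * blkC h) = 1 := by
    rw [Matrix.mul_sub, ← Matrix.mul_assoc, e1, autJ]
    simp only [transpose_add, transpose_mul, hΩ.1.eq]
    have r4 : (blkD h)ᵀ * blkA h - (blkB h)ᵀ * blkC h = 1 := by
      simpa using congrArg Matrix.transpose r3
    calc _ = Ω * ((blkC h)ᵀ * blkA h - (blkA h)ᵀ * blkC h) +
          ((blkD h)ᵀ * blkA h - (blkB h)ᵀ * blkC h) := by noncomm_ring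
      _ = 1 := by rw [r1, r4]; simp
  -- `ᵗ(CΩ+D)⁻¹ = A - (h·Ω) C`
  have e3 : ((autJ h Ω)⁻¹)ᵀ = blkA h - act h Ω * blkC h := by
    rw [transpose_nonsing_inv]
    exact inv_eq_right_inv e2
  have e4 : blkC (g * h) = blkC g * ((autJ h Ω)⁻¹)ᵀ + autJ g (act h Ω) * blkC h := by
    rw [e3, c, autJ]; noncomm_ring
  rw [autJ_mul g h hΩ, Matrix.mul_inv_rev, e4, Matrix.mul_add, Matrix.mul_assoc (autJ h Ω)⁻¹ _
    (autJ g (act h Ω) * blkC h), nonsing_inv_mul_cancel_left _ _ hv]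
  simp only [Matrix.mul_assoc]

theorem spQuad_mul {n m : ℕ} (M : Matrix (Fin m) (Fin m) ℂ) (g h : Sp n)
    {p : Matrix (Fin n) (Fin n) ℂ × Matrix (Fin m) (Fin n) ℂ} (hp : p ∈ siegelJacobi n m) :
    spQuad M (g * h) p = spQuad M g (spAct h p) + spQuad M h p := by
  rw [spQuad, autJ_inv_mul_blkC_mul g h hp.1, Matrix.mul_add, bil_add_left, ← Matrix.mul_assoc,
    bil_mul_left, transpose_transpose, ← Matrix.mul_assoc]
  rfl

/-- The automorphy factor `e^{πi σ(M Z (CΩ+D)⁻¹ C ᵗZ)} J_{1/2}^m` of theta series. -/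
def spFactor {n m : ℕ} (M : Matrix (Fin m) (Fin m) ℂ) (x : Mp n)
    (p : Matrix (Fin n) (Fin n) ℂ × Matrix (Fin m) (Fin n) ℂ) : ℂ :=
  Complex.exp (Real.pi * Complex.I * spQuad M x.g p) * Jhalf x p.1 ^ m

theorem spFactor_ne_zero {n m : ℕ} (M : Matrix (Fin m) (Fin m) ℂ) (x : Mp n)
    {p : Matrix (Fin n) (Fin n) ℂ × Matrix (Fin m) (Fin n) ℂ} (hp : p ∈ siegelJacobi n m) :
    spFactor M x p ≠ 0 := mul_ne_zero (Complex.exp_ne_zero _) (pow_ne_zero _ (Jhalf_ne_zero x hp.1))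

theorem spFactor_mul {n m : ℕ} (M : Matrix (Fin m) (Fin m) ℂ) (x y : Mp n)
    {p : Matrix (Fin n) (Fin n) ℂ × Matrix (Fin m) (Fin n) ℂ} (hp : p ∈ siegelJacobi n m) :
    spFactor M (x * y) p = spFactor M x (spAct y.g p) * spFactor M y p := by
  rw [spFactor, spFactor, spFactor, Mp.mul_g, spQuad_mul M _ _ hp, mul_add, Complex.exp_add,
    Jhalf_mul x y hp.1, spAct]
  ring

theorem spFactor_one {n m : ℕ} (M : Matrix (Fin m) (Fin m) ℂ)
    {p : Matrix (Fin n) (Fin n) ℂ × Matrix (Fin m) (Fin n) ℂ} (hp : p ∈ siegelJacobi n m) :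
    spFactor M (1 : Mp n) p = 1 := by
  rw [spFactor, Jhalf_one hp.1, Mp.one_g, spQuad, (blk_one n).2.2.1]
  simp [bil_zero_left]

/-- `c` is the multiplier of `Θ_M` at the element `x` of the metaplectic group. -/
def IsThetaMult {n m : ℕ} (M : Matrix (Fin m) (Fin m) ℤ) (x : Mp n) (c : ℂ) : Prop :=
  ∀ p ∈ siegelJacobi n m, theta M (spAct x.g p) = c * spFactor (intC M) x p * theta M p

namespace IsThetaMult

variable {n m : ℕ} {M : Matrix (Fin m) (Fin m) ℤ} {x y : Mp n} {c d : ℂ}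

theorem mul (hx : IsThetaMult M x c) (hy : IsThetaMult M y d) : IsThetaMult M (x * y) (c * d) := by
  intro p hp
  rw [Mp.mul_g, spAct_mul _ _ hp, hx _ (spAct_mem _ hp), hy p hp, spFactor_mul _ _ _ hp]
  ring

theorem one : IsThetaMult M (1 : Mp n) 1 := by
  intro p hp
  rw [Mp.one_g, spAct_one, spFactor_one _ hp]; ring

theorem unique (hM : (M.map (Int.cast : ℤ → ℝ)).PosDef) (hx : IsThetaMult M x c)
    (hx' : IsThetaMult M x d) : c = d := by
  have hp : ((basePt n, 0) : Matrix (Fin n) (Fin n) ℂ × Matrix (Fin m) (Fin n) ℂ) ∈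
    siegelJacobi n m := ⟨basePt_mem n, Set.mem_univ _⟩
  have h := (hx _ hp).symm.trans (hx' _ hp)
  exact mul_right_cancel₀ (spFactor_ne_zero _ x hp)
    (mul_right_cancel₀ (theta_basePt_ne_zero hM) h)

theorem inv (hx : IsThetaMult M x c) (hc : c ≠ 0) : IsThetaMult M x⁻¹ c⁻¹ := by
  intro p hp
  have h := hx _ (spAct_mem x⁻¹.g hp)
  have h1 := spFactor_mul (intC M) x x⁻¹ hp
  rw [← spAct_mul _ _ hp, ← Mp.mul_g, mul_inv_cancel, Mp.one_g, spAct_one] at h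
  rw [mul_inv_cancel, spFactor_one _ hp] at h1
  rw [h]
  field_simp
  linear_combination (theta M (spAct x⁻¹.g p)) * h1

end IsThetaMult

/-! ### Quadratic Gauss sums in matrix variables -/


/-- The quadratic Gauss sum `∑ e(σ(M r X ᵗr) / q)` over the `m × n` matrices `r` modulo `q`. -/
def gaussSumMat {n m q : ℕ} [NeZero q] (M : Matrix (Fin m) (Fin m) (ZMod q))
    (X : Matrix (Fin n) (Fin n) (ZMod q)) : ℂ :=
  ∑ r : Matrix (Fin m) (Fin n) (ZMod q), stdAddChar (bil M (r * X) r)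

theorem gaussSumMat_neg {n m q : ℕ} [NeZero q] (M : Matrix (Fin m) (Fin m) (ZMod q))
    (X : Matrix (Fin n) (Fin n) (ZMod q)) :
    gaussSumMat M (-X) = (starRingEnd ℂ) (gaussSumMat M X) := by
  rw [gaussSumMat, gaussSumMat, map_sum]
  refine Finset.sum_congr rfl fun r _ => ?_
  rw [Matrix.mul_neg, bil_neg_left, AddChar.map_neg_eq_conj]

/-- Since `-1` is a sum of four squares modulo `q`, four copies of a quadratic form modulo `q` are
isometric to four copies of its negative, through a matrix of quaternion multiplication. Hence the
fourth power of a quadratic Gauss sum is real. -/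
theorem conj_gaussSumMat_pow_four {n m q : ℕ} [NeZero q] (M : Matrix (Fin m) (Fin m) (ZMod q))
    (X : Matrix (Fin n) (Fin n) (ZMod q)) :
    (starRingEnd ℂ) (gaussSumMat M X ^ 4) = gaussSumMat M X ^ 4 := by
  obtain ⟨a, b, c, d, h⟩ := Nat.sum_four_squares (q - 1)
  have hq : 1 ≤ q := NeZero.one_le
  have h' : (a : ZMod q) ^ 2 + (b : ZMod q) ^ 2 + (c : ZMod q) ^ 2 + (d : ZMod q) ^ 2 = -1 := by
    have := congrArg (Nat.cast : ℕ → ZMod q) h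
    rw [Nat.cast_sub hq] at this
    push_cast at this
    rw [this]; simp
  generalize (a : ZMod q) = a, (b : ZMod q) = b, (c : ZMod q) = c, (d : ZMod q) = d at h'
  have key : ∀ Y : Matrix (Fin n) (Fin n) (ZMod q), gaussSumMat M Y ^ 4 =
      ∑ r : Fin 4 → Matrix (Fin m) (Fin n) (ZMod q),
        stdAddChar (∑ i, bil M (r i * Y) (r i)) := fun Y => by
    rw [gaussSumMat, Fintype.sum_pow]
    refine Finset.sum_congr rfl fun r _ => ?_
    simp only [Fin.prod_univ_four, Fin.sum_univ_four, AddChar.map_add_eq_mul]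
  rw [map_pow, ← gaussSumMat_neg, key, key]
  -- multiplication by the quaternion `a + bi + cj + dk` of norm `-1`
  set f : (Fin 4 → Matrix (Fin m) (Fin n) (ZMod q)) → (Fin 4 → Matrix (Fin m) (Fin n) (ZMod q)) :=
    fun r => ![a • r 0 - b • r 1 - c • r 2 - d • r 3, b • r 0 + a • r 1 - d • r 2 + c • r 3,
      c • r 0 + d • r 1 + a • r 2 - b • r 3, d • r 0 - c • r 1 + b • r 2 + a • r 3] with hf
  have hinj : Function.Injective f := by
    refine Function.LeftInverse.injective (g := fun r =>
      ![-(a • r 0 + b • r 1 + c • r 2 + d • r 3), -(-b • r 0 + a • r 1 + d • r 2 - c • r 3),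
        -(-c • r 0 - d • r 1 + a • r 2 + b • r 3), -(-d • r 0 + c • r 1 - b • r 2 + a • r 3)])
      fun r => ?_
    funext i
    ext j k
    fin_cases i
    · simp [hf]; linear_combination (-r 0 j k) * h'
    · simp [hf]; linear_combination (-r 1 j k) * h'
    · simp [hf]; linear_combination (-r 2 j k) * h'
    · simp [hf]; linear_combination (-r 3 j k) * h'
  have hbij : Function.Bijective f := Finite.injective_iff_bijective.1 hinj
  rw [← hbij.sum_comp]
  refine Finset.sum_congr rfl fun r _ => congrArg _ ?_
  simp only [hf, Fin.sum_univ_four, cons_val, Matrix.add_mul, Matrix.sub_mul, Matrix.smul_mul,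
    Matrix.mul_neg, bil_add_left, bil_add_right, bil_sub_left, bil_sub_right, bil_smul_left,
    bil_smul_right, bil_neg_left]
  linear_combination (-(bil M (r 0 * X) (r 0) + bil M (r 1 * X) (r 1) + bil M (r 2 * X) (r 2) +
    bil M (r 3 * X) (r 3))) * h'

theorem gaussSumMat_pow_eight {n m q : ℕ} [NeZero q] (M : Matrix (Fin m) (Fin m) (ZMod q))
    (X : Matrix (Fin n) (Fin n) (ZMod q)) : ∃ t : ℝ, 0 ≤ t ∧ gaussSumMat M X ^ 8 = t := by
  obtain ⟨s, hs⟩ := Complex.conj_eq_iff_real.1 (conj_gaussSumMat_pow_four M X)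
  refine ⟨s ^ 2, sq_nonneg s, ?_⟩
  rw [show (8 : ℕ) = 4 * 2 from rfl, pow_mul, hs]
  push_cast; rfl

/-- The relations between the blocks of an integral symplectic matrix `(A B; C D)` of level two and
a matrix `K` proportional to `C⁻¹` that remain modulo `q`, where `q` is twice the factor of
proportionality. -/
structure GaussRel {R : Type*} [CommRing R] {n : ℕ} (A B C D K : Matrix (Fin n) (Fin n) R) :
    Prop where
  ac : Aᵀ * C = Cᵀ * A
  bd : Bᵀ * D = Dᵀ * B
  ad : Aᵀ * D - Cᵀ * B = 1
  ak : (A * K).IsSymm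
  kd : (K * D).IsSymm
  akd : A * K * D = Kᵀ
  two_kc : (2 : R) • (K * C) = 0
  cakc : Cᵀ * A * (K * C) = 0

/-- The substitution `r ↦ r + η ᵗD` shows that the Fourier transform of the quadratic character at
`2 M η K` is the Gauss sum times a quadratic phase in `η`. -/
theorem GaussRel.sum_shift {n m q : ℕ} [NeZero q] {M : Matrix (Fin m) (Fin m) (ZMod q)}
    (hM : M.IsSymm) {A B C D K : Matrix (Fin n) (Fin n) (ZMod q)} (h : GaussRel A B C D K)
    (η : Matrix (Fin m) (Fin n) (ZMod q)) :
    (∑ r : Matrix (Fin m) (Fin n) (ZMod q), stdAddChar (bil M (r * (A * K)) r - 2 * bil M (η * K) r)) *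
      stdAddChar (bil M (η * (K * D)) η) = gaussSumMat M (A * K) := by
  rw [← Equiv.sum_comp (Equiv.addRight (η * Dᵀ)), Finset.sum_mul, gaussSumMat]
  refine Finset.sum_congr rfl fun r _ => ?_
  rw [← AddChar.map_add_eq_mul]
  congr 1
  have e1 : bil M (r * (A * K)) (η * Dᵀ) = bil M (η * K) r := by
    rw [← bil_mul_left, Matrix.mul_assoc, h.akd, bil_mul_comm _ _ hM, transpose_transpose]
  have e2 : bil M (η * Dᵀ * (A * K)) r = bil M (η * K) r := by
    rw [bil_mul_comm _ _ hM, h.ak.eq, e1]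
  have e3 : bil M (η * Dᵀ * (A * K)) (η * Dᵀ) = bil M (η * (K * D)) η := by
    rw [← bil_mul_left, Matrix.mul_assoc, h.akd, Matrix.mul_assoc, ← transpose_mul, h.kd.eq]
  have e4 : bil M (η * K) (η * Dᵀ) = bil M (η * (K * D)) η := by
    rw [← bil_mul_left, Matrix.mul_assoc]
  simp only [Equiv.coe_addRight, Matrix.add_mul, bil_add_left, bil_add_right, e1, e2, e3, e4]
  ring

/-- Computing `∑ e(σ(M r' A K ᵗr') / q)` over pairs `(r', x')`, where `(r', x')` is the image of `(r, x)`
under a symplectic substitution, gives one Gauss sum in terms of `r'` and the other in terms of `r`.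
The second one is conjugate to the Gauss sum of the inverse matrix. -/
theorem GaussRel.gaussSumMat_eq {n m q : ℕ} [NeZero q] {M : Matrix (Fin m) (Fin m) (ZMod q)}
    (hM : M.IsSymm) {A B C D K : Matrix (Fin n) (Fin n) (ZMod q)} (h : GaussRel A B C D K) :
    gaussSumMat M (A * K) = gaussSumMat M (K * D) := by
  set f : Matrix (Fin m) (Fin n) (ZMod q) × Matrix (Fin m) (Fin n) (ZMod q) →
    Matrix (Fin m) (Fin n) (ZMod q) × Matrix (Fin m) (Fin n) (ZMod q) :=
    fun p => (p.1 * Dᵀ + p.2 * Cᵀ, p.1 * Bᵀ + p.2 * Aᵀ) with hf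
  have had : Dᵀ * A - Bᵀ * C = 1 := by simpa using congrArg Matrix.transpose h.ad
  have hinj : Function.Injective f := by
    refine Function.LeftInverse.injective (g := fun p => (p.1 * A - p.2 * C, p.2 * D - p.1 * B))
      fun p => Prod.ext ?_ ?_
    · calc (p.1 * Dᵀ + p.2 * Cᵀ) * A - (p.1 * Bᵀ + p.2 * Aᵀ) * C =
            p.1 * (Dᵀ * A - Bᵀ * C) + p.2 * (Cᵀ * A - Aᵀ * C) := by
            simp only [Matrix.mul_sub, Matrix.add_mul, Matrix.mul_assoc]; abel
        _ = p.1 := by rw [had, h.ac]; simp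
    · calc (p.1 * Bᵀ + p.2 * Aᵀ) * D - (p.1 * Dᵀ + p.2 * Cᵀ) * B =
            p.1 * (Bᵀ * D - Dᵀ * B) + p.2 * (Aᵀ * D - Cᵀ * B) := by
            simp only [Matrix.mul_sub, Matrix.add_mul, Matrix.mul_assoc]; abel
        _ = p.2 := by rw [h.ad, h.bd]; simp
  have hbij : Function.Bijective f := Finite.injective_iff_bijective.1 hinj
  have h1 : ∑ p : Matrix (Fin m) (Fin n) (ZMod q) × Matrix (Fin m) (Fin n) (ZMod q),
      stdAddChar (bil M ((f p).1 * (A * K)) (f p).1) =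
      Fintype.card (Matrix (Fin m) (Fin n) (ZMod q)) * gaussSumMat M (A * K) := by
    rw [hbij.sum_comp (fun p => stdAddChar (bil M (p.1 * (A * K)) p.1)), Fintype.sum_prod_type_right]
    dsimp only
    rw [Finset.sum_const, gaussSumMat, nsmul_eq_mul, Finset.card_univ]
  have h2 : ∀ p : Matrix (Fin m) (Fin n) (ZMod q) × Matrix (Fin m) (Fin n) (ZMod q),
      bil M ((f p).1 * (A * K)) (f p).1 = bil M (p.1 * (K * D)) p.1 := by
    rintro ⟨r, x⟩
    have e1 : bil M (r * Dᵀ * (A * K)) (r * Dᵀ) = bil M (r * (K * D)) r := by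
      rw [← bil_mul_left, Matrix.mul_assoc, h.akd, Matrix.mul_assoc, ← transpose_mul, h.kd.eq]
    have e2 : bil M (r * Dᵀ * (A * K)) (x * Cᵀ) = bil M (r * Dᵀ * A * (K * C)) x := by
      rw [← bil_mul_left]; simp only [Matrix.mul_assoc]
    have e3 : bil M (x * Cᵀ * (A * K)) (r * Dᵀ) = bil M (r * Dᵀ * A * (K * C)) x := by
      rw [bil_mul_comm _ _ hM, h.ak.eq, e2]
    have e4 : bil M (x * Cᵀ * (A * K)) (x * Cᵀ) = 0 := by
      have : x * Cᵀ * (A * K) * C = x * (Cᵀ * A * (K * C)) := by simp only [Matrix.mul_assoc]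
      rw [← bil_mul_left, this, h.cakc, Matrix.mul_zero, bil_zero_left]
    have e5 : 2 * bil M (r * Dᵀ * A * (K * C)) x = 0 := by
      rw [← bil_smul_left, ← Matrix.mul_smul, h.two_kc, Matrix.mul_zero, bil_zero_left]
    simp only [hf, Matrix.add_mul, bil_add_left, bil_add_right, e1, e2, e3, e4]
    linear_combination e5
  have h3 : ∑ p : Matrix (Fin m) (Fin n) (ZMod q) × Matrix (Fin m) (Fin n) (ZMod q),
      stdAddChar (bil M ((f p).1 * (A * K)) (f p).1) =
      Fintype.card (Matrix (Fin m) (Fin n) (ZMod q)) * gaussSumMat M (K * D) := by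
    simp only [h2]
    rw [Fintype.sum_prod_type_right]
    dsimp only
    rw [Finset.sum_const, gaussSumMat, nsmul_eq_mul, Finset.card_univ]
  have hc : (Fintype.card (Matrix (Fin m) (Fin n) (ZMod q)) : ℂ) ≠ 0 := by
    exact_mod_cast Fintype.card_ne_zero
  exact mul_left_cancel₀ hc (h1.symm.trans h3)

/-- Orthogonality of the characters of the group of matrices modulo `q`. -/
theorem sum_stdAddChar_bil {n m q : ℕ} [NeZero q] (w : Matrix (Fin m) (Fin n) (ZMod q)) :
    ∑ ν : Matrix (Fin m) (Fin n) (ZMod q), stdAddChar (bil 1 w ν) =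
      if w = 0 then (Fintype.card (Matrix (Fin m) (Fin n) (ZMod q)) : ℂ) else 0 := by
  set χ : AddChar (Matrix (Fin m) (Fin n) (ZMod q)) ℂ :=
    { toFun := fun ν => stdAddChar (bil 1 w ν)
      map_zero_eq_one' := by rw [bil_zero_right, AddChar.map_zero_eq_one]
      map_add_eq_mul' := fun x y => by rw [bil_add_right, AddChar.map_add_eq_mul] } with hχ
  have h := AddChar.sum_eq_ite χ
  have h0 : χ = 0 ↔ w = 0 := by
    constructor
    · intro h
      ext i j
      have h1 := DFunLike.congr_fun h (Matrix.single i j 1)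
      have h2 : χ (Matrix.single i j 1) = stdAddChar (w i j) := by
        change stdAddChar (bil 1 w (Matrix.single i j 1)) = _
        congr 1
        simp [bil_one, trace_mul_comm w, trace_single_mul]
      rw [h2, AddChar.zero_apply, ← AddChar.map_zero_eq_one (stdAddChar (N := q))] at h1
      exact ZMod.injective_stdAddChar h1
    · rintro rfl
      ext ν
      change stdAddChar (bil 1 0 ν) = _
      rw [bil_zero_left, AddChar.map_zero_eq_one, AddChar.zero_apply]
  simp only [h0] at h
  exact h

/-! ### Integral symplectic matrices -/

/-- The symplectic relations between integral blocks. -/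
structure SympRel {n : ℕ} (A B C D : Matrix (Fin n) (Fin n) ℤ) : Prop where
  ac : Aᵀ * C = Cᵀ * A
  bd : Bᵀ * D = Dᵀ * B
  ad : Aᵀ * D - Cᵀ * B = 1

namespace SympRel

variable {n : ℕ} {A B C D : Matrix (Fin n) (Fin n) ℤ}

/-- The relations for the transposed matrix: a left inverse is a right inverse. -/
theorem swap (h : SympRel A B C D) :
    A * Bᵀ = B * Aᵀ ∧ C * Dᵀ = D * Cᵀ ∧ A * Dᵀ - B * Cᵀ = 1 := by
  have had : Dᵀ * A - Bᵀ * C = 1 := by simpa using congrArg Matrix.transpose h.ad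
  have h1 : fromBlocks Dᵀ (-Bᵀ) (-Cᵀ) Aᵀ * fromBlocks A B C D = 1 := by
    rw [fromBlocks_multiply, ← fromBlocks_one]
    simp only [Matrix.neg_mul, ← sub_eq_add_neg, had, h.bd, sub_self, neg_add_eq_sub, h.ac, h.ad]
  have h2 := mul_eq_one_comm.1 h1
  rw [fromBlocks_multiply, ← fromBlocks_one, fromBlocks_inj] at h2
  obtain ⟨h3, h4, h5, h6⟩ := h2
  simp only [Matrix.mul_neg, ← sub_eq_add_neg, neg_add_eq_sub, sub_eq_zero] at h3 h4 h5 h6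
  exact ⟨h4.symm, h5, h3⟩

end SympRel

/-- The integral matrix `±` the adjugate of `C`, with the sign of `det C`, so that
`K C = C K = |det C|`. -/
def signedAdj {n : ℕ} (C : Matrix (Fin n) (Fin n) ℤ) : Matrix (Fin n) (Fin n) ℤ :=
  C.det.sign • C.adjugate

theorem signedAdj_mul {n : ℕ} (C : Matrix (Fin n) (Fin n) ℤ) :
    signedAdj C * C = (C.det.natAbs : ℤ) • (1 : Matrix (Fin n) (Fin n) ℤ) := by
  rw [signedAdj, Matrix.smul_mul, adjugate_mul, smul_smul, Int.sign_mul_self_eq_natAbs]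

theorem mul_signedAdj {n : ℕ} (C : Matrix (Fin n) (Fin n) ℤ) :
    C * signedAdj C = (C.det.natAbs : ℤ) • (1 : Matrix (Fin n) (Fin n) ℤ) := by
  rw [signedAdj, Matrix.mul_smul, mul_adjugate, smul_smul, Int.sign_mul_self_eq_natAbs]

/-- With `K = |det C| C⁻¹`: the matrices `A C⁻¹` and `C⁻¹ D` are symmetric, and `A C⁻¹ D = ᵗC⁻¹ + B`. -/
theorem SympRel.signedAdj_rel {n : ℕ} {A B C D : Matrix (Fin n) (Fin n) ℤ} (h : SympRel A B C D)
    (hC : C.det ≠ 0) : (A * signedAdj C).IsSymm ∧ (signedAdj C * D).IsSymm ∧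
      A * signedAdj C * D = (signedAdj C)ᵀ + (C.det.natAbs : ℤ) • B := by
  set K := signedAdj C
  set δ : ℤ := (C.det.natAbs : ℤ) with hδ
  have hδ0 : δ ≠ 0 := by simpa [hδ] using hC
  have hKC : K * C = δ • (1 : Matrix (Fin n) (Fin n) ℤ) := signedAdj_mul C
  have hCK : C * K = δ • (1 : Matrix (Fin n) (Fin n) ℤ) := mul_signedAdj C
  have hKC' : Cᵀ * Kᵀ = δ • (1 : Matrix (Fin n) (Fin n) ℤ) := by
    rw [← transpose_mul, hKC, transpose_smul, transpose_one]
  have hCK' : Kᵀ * Cᵀ = δ • (1 : Matrix (Fin n) (Fin n) ℤ) := by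
    rw [← transpose_mul, hCK, transpose_smul, transpose_one]
  obtain ⟨_, h2, h3⟩ := h.swap
  have hinj : ∀ X Y : Matrix (Fin n) (Fin n) ℤ, δ • X = δ • Y → X = Y := fun X Y hXY =>
    smul_right_injective _ hδ0 hXY
  have ak : (A * K)ᵀ = A * K := by
    apply hinj
    calc δ • (A * K)ᵀ = Kᵀ * Aᵀ * (C * K) := by
          rw [hCK, Matrix.mul_smul, Matrix.mul_one, transpose_mul]
      _ = Kᵀ * (Aᵀ * C) * K := by simp only [Matrix.mul_assoc]
      _ = (Kᵀ * Cᵀ) * (A * K) := by rw [h.ac]; simp only [Matrix.mul_assoc]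
      _ = δ • (A * K) := by rw [hCK', Matrix.smul_mul, Matrix.one_mul]
  have kd : (K * D)ᵀ = K * D := by
    apply hinj
    calc δ • (K * D)ᵀ = (K * C) * (Dᵀ * Kᵀ) := by
          rw [hKC, Matrix.smul_mul, Matrix.one_mul, transpose_mul]
      _ = K * (C * Dᵀ) * Kᵀ := by simp only [Matrix.mul_assoc]
      _ = K * D * (Cᵀ * Kᵀ) := by rw [h2]; simp only [Matrix.mul_assoc]
      _ = δ • (K * D) := by rw [hKC', Matrix.mul_smul, Matrix.mul_one]
  refine ⟨ak, kd, ?_⟩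
  have had : A * Dᵀ = 1 + B * Cᵀ := by rw [← h3]; abel
  calc A * K * D = A * (K * D)ᵀ := by rw [kd, Matrix.mul_assoc]
    _ = (A * Dᵀ) * Kᵀ := by rw [transpose_mul, Matrix.mul_assoc]
    _ = Kᵀ + B * (Cᵀ * Kᵀ) := by rw [had, Matrix.add_mul, Matrix.one_mul, Matrix.mul_assoc]
    _ = _ := by rw [hKC', Matrix.mul_smul, Matrix.mul_one]

/-- Reduction of an integral matrix modulo `q`. -/
def redMod {a b : Type*} (q : ℕ) (X : Matrix a b ℤ) : Matrix a b (ZMod q) :=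
  X.map (Int.cast : ℤ → ZMod q)

theorem redMod_mul {a b c : Type*} [Fintype b] (q : ℕ) (X : Matrix a b ℤ) (Y : Matrix b c ℤ) :
    redMod q (X * Y) = redMod q X * redMod q Y := Matrix.map_mul (f := Int.castRingHom (ZMod q))
theorem redMod_transpose {a b : Type*} (q : ℕ) (X : Matrix a b ℤ) :
    redMod q Xᵀ = (redMod q X)ᵀ := rfl
theorem redMod_add {a b : Type*} (q : ℕ) (X Y : Matrix a b ℤ) :
    redMod q (X + Y) = redMod q X + redMod q Y := by ext; simp [redMod]
theorem redMod_sub {a b : Type*} (q : ℕ) (X Y : Matrix a b ℤ) :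
    redMod q (X - Y) = redMod q X - redMod q Y := by ext; simp [redMod]
theorem redMod_neg {a b : Type*} (q : ℕ) (X : Matrix a b ℤ) :
    redMod q (-X) = -redMod q X := by ext; simp [redMod]
theorem redMod_smul {a b : Type*} (q : ℕ) (k : ℤ) (X : Matrix a b ℤ) :
    redMod q (k • X) = (k : ZMod q) • redMod q X := by ext; simp [redMod]
theorem redMod_one {a : Type*} [DecidableEq a] (q : ℕ) : redMod q (1 : Matrix a a ℤ) = 1 := by
  ext i j; by_cases h : i = j <;> simp [redMod, Matrix.one_apply, h]
theorem redMod_bil {n m : ℕ} (q : ℕ) (M : Matrix (Fin m) (Fin m) ℤ) (X Y : Matrix (Fin m) (Fin n) ℤ) :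
    bil (redMod q M) (redMod q X) (redMod q Y) = ((bil M X Y : ℤ) : ZMod q) :=
  (map_bil M X Y (Int.castRingHom (ZMod q))).symm

/-- The evenness of `B` and `C` is used since `2 |det C|`, but not `|det C|`, vanishes modulo `q`. -/
theorem SympRel.gaussRel {n : ℕ} {A B C D : Matrix (Fin n) (Fin n) ℤ} (h : SympRel A B C D)
    (hC : C.det ≠ 0) (hB : ∃ B', B = (2 : ℤ) • B') (hC2 : ∃ C', C = (2 : ℤ) • C') {q : ℕ}
    (hq : q = 2 * C.det.natAbs) :
    GaussRel (redMod q A) (redMod q B) (redMod q C) (redMod q D) (redMod q (signedAdj C)) := by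
  obtain ⟨h1, h2, h3⟩ := h.signedAdj_rel hC
  have h0 : (C.det.natAbs : ZMod q) * 2 = 0 := by
    have : ((q : ℕ) : ZMod q) = 0 := ZMod.natCast_self q
    rw [mul_comm]
    rw [hq] at this ⊢
    exact_mod_cast this
  have hKC : redMod q (signedAdj C) * redMod q C = (C.det.natAbs : ZMod q) • 1 := by
    rw [← redMod_mul, signedAdj_mul, redMod_smul, redMod_one, Int.cast_natCast]
  constructor
  · simpa only [redMod_mul, redMod_transpose] using congrArg (redMod q) h.ac
  · simpa only [redMod_mul, redMod_transpose] using congrArg (redMod q) h.bd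
  · simpa only [redMod_mul, redMod_transpose, redMod_sub, redMod_one] using congrArg (redMod q) h.ad
  · simpa only [redMod_mul, redMod_transpose, Matrix.IsSymm] using congrArg (redMod q) h1.eq
  · simpa only [redMod_mul, redMod_transpose, Matrix.IsSymm] using congrArg (redMod q) h2.eq
  · obtain ⟨B', rfl⟩ := hB
    have := congrArg (redMod q) h3
    simpa only [redMod_mul, redMod_transpose, redMod_add, redMod_smul, smul_smul, Int.cast_mul, Int.cast_natCast,
      Int.cast_ofNat, h0, zero_smul, add_zero] using this
  · rw [hKC, smul_smul, mul_comm, h0, zero_smul]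
  · obtain ⟨C', hC'⟩ := hC2
    have e : (redMod q C)ᵀ = (2 : ZMod q) • (redMod q C')ᵀ := by
      conv_lhs => rw [hC']
      rw [redMod_smul, transpose_smul, Int.cast_ofNat]
    rw [hKC, e, Matrix.mul_smul, Matrix.smul_mul, Matrix.smul_mul, smul_smul, h0, zero_smul]

/-- The integral matrices `A`, `B`, `C`, `D` are the blocks of `g`. -/
structure HasBlocks {n : ℕ} (g : Sp n) (A B C D : Matrix (Fin n) (Fin n) ℤ) : Prop where
  a : blkA g = intC A
  b : blkB g = intC B
  c : blkC g = intC C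
  d : blkD g = intC D

theorem HasBlocks.rel {n : ℕ} {g : Sp n} {A B C D : Matrix (Fin n) (Fin n) ℤ}
    (h : HasBlocks g A B C D) : SympRel A B C D := by
  obtain ⟨h1, h2, h3⟩ := blk_rel g
  simp only [h.a, h.b, h.c, h.d, ← intC_transpose, ← intC_mul, ← intC_sub, ← intC_one] at h1 h2 h3
  exact ⟨intC_injective h1, intC_injective h2, intC_injective h3⟩

theorem HasBlocks.mul {n : ℕ} {g g' : Sp n} {A B C D A' B' C' D' : Matrix (Fin n) (Fin n) ℤ}
    (h : HasBlocks g A B C D) (h' : HasBlocks g' A' B' C' D') :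
    HasBlocks (g * g') (A * A' + B * C') (A * B' + B * D') (C * A' + D * C') (C * B' + D * D') := by
  obtain ⟨a, b, c, d⟩ := blk_mul g g'
  constructor
  · rw [a, h.a, h.b, h'.a, h'.c, intC_add, intC_mul, intC_mul]
  · rw [b, h.a, h.b, h'.b, h'.d, intC_add, intC_mul, intC_mul]
  · rw [c, h.c, h.d, h'.a, h'.c, intC_add, intC_mul, intC_mul]
  · rw [d, h.c, h.d, h'.b, h'.d, intC_add, intC_mul, intC_mul]

theorem HasBlocks.inv {n : ℕ} {g : Sp n} {A B C D : Matrix (Fin n) (Fin n) ℤ}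
    (h : HasBlocks g A B C D) : HasBlocks g⁻¹ Dᵀ (-Bᵀ) (-Cᵀ) Aᵀ := by
  have e : (g⁻¹).1 = fromBlocks (g.1.toBlocks₂₂)ᵀ (-(g.1.toBlocks₁₂)ᵀ) (-(g.1.toBlocks₂₁)ᵀ)
      (g.1.toBlocks₁₁)ᵀ := by
    rw [show (g⁻¹).1 = (-J (Fin n) ℝ) * (g.1)ᵀ * J (Fin n) ℝ from SymplecticGroup.coe_inv g]
    conv_lhs => rw [← fromBlocks_toBlocks g.1]
    simp [J, fromBlocks_transpose, fromBlocks_neg, fromBlocks_multiply]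
  have hn : ∀ X : Matrix (Fin n) (Fin n) ℝ, (-X).map Complex.ofReal = -X.map Complex.ofReal :=
    fun X => by ext; simp
  constructor
  · rw [blkA, e, toBlocks_fromBlocks₁₁, transpose_map, intC_transpose, ← h.d]; rfl
  · rw [blkB, e, toBlocks_fromBlocks₁₂, hn, transpose_map, intC_neg, intC_transpose, ← h.b]; rfl
  · rw [blkC, e, toBlocks_fromBlocks₂₁, hn, transpose_map, intC_neg, intC_transpose, ← h.c]; rfl
  · rw [blkD, e, toBlocks_fromBlocks₂₂, transpose_map, intC_transpose, ← h.a]; rfl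

/-! ### Splitting a lattice sum into residue classes -/

/-- The standard representatives of the residue classes of matrices modulo `q`. -/
def liftMod {a b : Type*} {q : ℕ} (r : Matrix a b (ZMod q)) : Matrix a b ℤ :=
  r.map fun x => (x.val : ℤ)

theorem redMod_liftMod {a b : Type*} {q : ℕ} [NeZero q] (r : Matrix a b (ZMod q)) :
    redMod q (liftMod r) = r := by
  ext; simp [redMod, liftMod]

/-- Division with remainder by `q`, for integral matrices. -/
def residueEquiv (a b : Type*) (q : ℕ) [NeZero q] :
    Matrix a b (ZMod q) × Matrix a b ℤ ≃ Matrix a b ℤ where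
  toFun p := liftMod p.1 + (q : ℤ) • p.2
  invFun ξ := (redMod q ξ, ξ.map fun x => x / (q : ℤ))
  left_inv p := by
    have hq : (q : ℤ) ≠ 0 := by exact_mod_cast NeZero.ne q
    refine Prod.ext ?_ ?_
    · change redMod q (liftMod p.1 + (q : ℤ) • p.2) = p.1
      rw [redMod_add, redMod_liftMod, redMod_smul]; simp
    · ext i j
      have h1 : ((p.1 i j).val : ℤ) / q = 0 :=
        Int.ediv_eq_zero_of_lt (by positivity) (by exact_mod_cast ZMod.val_lt _)
      change (((p.1 i j).val : ℤ) + q * p.2 i j) / q = p.2 i j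
      rw [Int.add_mul_ediv_left _ _ hq, h1, zero_add]
  right_inv ξ := by
    ext i j
    change (((ξ i j : ZMod q).val : ℤ) + q * (ξ i j / q)) = ξ i j
    rw [ZMod.val_intCast]
    exact Int.emod_add_mul_ediv _ _

theorem tsum_residue {m n : ℕ} (q : ℕ) [NeZero q] {f : Matrix (Fin m) (Fin n) ℤ → ℂ}
    (hf : Summable f) : ∑' ξ, f ξ = ∑ r : Matrix (Fin m) (Fin n) (ZMod q), ∑' y,
      f (liftMod r + (q : ℤ) • y) := by
  have h := hf
  rw [← (residueEquiv (Fin m) (Fin n) q).summable_iff] at h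
  rw [← (residueEquiv (Fin m) (Fin n) q).tsum_eq]
  exact h.tsum_prod.trans (tsum_fintype _)

theorem cexp_eq_stdAddChar {q δ : ℕ} [NeZero q] (hq : q = 2 * δ) (a : ℤ) :
    Complex.exp (Real.pi * Complex.I * (a / δ)) = stdAddChar (a : ZMod q) := by
  rw [ZMod.stdAddChar_coe]
  congr 1
  have : (δ : ℂ) ≠ 0 := by
    have := NeZero.ne q
    rw [hq] at this
    exact_mod_cast right_ne_zero_of_mul this
  rw [hq]; push_cast; field_simp

/-! ### The transformation of the theta series when `C` is invertible -/

section transform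

variable {n m : ℕ} {g : Sp n} {A B C D : Matrix (Fin n) (Fin n) ℤ}

theorem HasBlocks.autJ_eq (h : HasBlocks g A B C D) (Ω : Matrix (Fin n) (Fin n) ℂ) :
    autJ g Ω = intC C * Ω + intC D := by rw [autJ, h.c, h.d]

theorem HasBlocks.autJ_mul_isSymm (h : HasBlocks g A B C D) {Ω : Matrix (Fin n) (Fin n) ℂ}
    (hΩ : Ω.IsSymm) : (autJ g Ω * (intC C)ᵀ).IsSymm := by
  have h2 := congrArg intC h.rel.swap.2.1
  rw [intC_mul, intC_mul, intC_transpose, intC_transpose] at h2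
  rw [h.autJ_eq, Matrix.IsSymm, Matrix.add_mul, transpose_add, transpose_mul, transpose_mul,
    transpose_mul, transpose_transpose, hΩ.eq, h2, Matrix.mul_assoc]

/-- The argument `(-i / q²) (CΩ+D) ᵗC` of the dual theta series. -/
def dualArg (q : ℕ) (g : Sp n) (C : Matrix (Fin n) (Fin n) ℤ) (Ω : Matrix (Fin n) (Fin n) ℂ) :
    Matrix (Fin n) (Fin n) ℂ := (-Complex.I / q ^ 2) • (autJ g Ω * (intC C)ᵀ)

/-- The real part of `(-i / q²) (CΩ+D) ᵗC` is `q⁻² C (Im Ω) ᵗC`. -/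
theorem HasBlocks.dualArg_mem (h : HasBlocks g A B C D) (hC : C.det ≠ 0) (q : ℕ) [NeZero q]
    {Ω : Matrix (Fin n) (Fin n) ℂ} (hΩ : Ω ∈ siegelUpper n) : dualArg q g C Ω ∈ posRe n := by
  refine ⟨(h.autJ_mul_isSymm hΩ.1).smul _, ?_⟩
  set c : Matrix (Fin n) (Fin n) ℝ := C.map (Int.cast : ℤ → ℝ) with hc
  have hq : (0 : ℝ) < ((q : ℝ) ^ 2)⁻¹ := by
    have : (q : ℝ) ≠ 0 := by exact_mod_cast NeZero.ne q
    positivity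
  have e : (dualArg q g C Ω).map Complex.re = ((q : ℝ) ^ 2)⁻¹ • (c * Ω.map Complex.im * cᴴ) := by
    ext i j
    have h1 : (-Complex.I / (q : ℂ) ^ 2) = (((q : ℝ) ^ 2)⁻¹ : ℝ) * (-Complex.I) := by
      push_cast; ring
    have h2 : (intC D * (intC C)ᵀ) i j = ((D * Cᵀ) i j : ℤ) := by
      rw [← intC_transpose, ← intC_mul]; rfl
    have h3 : ((intC C * Ω * (intC C)ᵀ) i j).im = (c * Ω.map Complex.im * cᴴ) i j := by
      simp only [mul_apply, intC, map_apply, transpose_apply, conjTranspose_apply, hc, star_trivial,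
        Complex.im_sum, Finset.sum_mul]
      refine Finset.sum_congr rfl fun k _ => Finset.sum_congr rfl fun l _ => ?_
      rw [mul_comm, ← mul_assoc, ← Int.cast_mul, ← Complex.ofReal_intCast, Complex.im_ofReal_mul]
      push_cast; ring
    rw [map_apply, dualArg, Matrix.smul_apply, h.autJ_eq, Matrix.add_mul, Matrix.add_apply, h2, h1, smul_eq_mul,
      mul_assoc, Complex.re_ofReal_mul, Matrix.smul_apply, ← h3]
    simp
  rw [e]
  refine Matrix.PosDef.smul ?_ hq
  refine hΩ.2.mul_mul_conjTranspose_same ?_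
  have hu : IsUnit c := by
    rw [isUnit_iff_isUnit_det]
    have : c.det = (C.det : ℝ) := (RingHom.map_det (Int.castRingHom ℝ) C).symm
    rw [this]
    exact (Int.cast_ne_zero.2 hC).isUnit
  exact Matrix.vecMul_injective_of_isUnit hu

/-- The decomposition `g·Ω = A C⁻¹ - ((CΩ+D) ᵗC)⁻¹`. -/
theorem HasBlocks.act_eq (h : HasBlocks g A B C D) (hC : C.det ≠ 0)
    {Ω : Matrix (Fin n) (Fin n) ℂ} (hΩ : Ω ∈ siegelUpper n) :
    act g Ω = (C.det.natAbs : ℂ)⁻¹ • intC (A * signedAdj C) - (autJ g Ω * (intC C)ᵀ)⁻¹ := by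
  have hδ : (C.det.natAbs : ℂ) ≠ 0 := by simpa using hC
  have hu := autJ_isUnit g hΩ
  have hCu : IsUnit (intC C).det := by rw [intC_det]; exact (Int.cast_ne_zero.2 hC).isUnit
  have hCu' : IsUnit ((intC C)ᵀ).det := by rwa [det_transpose]
  obtain ⟨_, _, h3⟩ := h.rel.signedAdj_rel hC
  have hKC := congrArg intC (signedAdj_mul C)
  have hKC' : (intC C)ᵀ * (intC (signedAdj C))ᵀ = (C.det.natAbs : ℂ) • 1 := by
    have := congrArg Matrix.transpose hKC
    rw [intC_mul, transpose_mul, intC_smul, intC_one, transpose_smul, transpose_one] at this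
    simpa using this
  have hCi : ((intC C)ᵀ)⁻¹ = (C.det.natAbs : ℂ)⁻¹ • (intC (signedAdj C))ᵀ := by
    apply inv_eq_right_inv
    rw [Matrix.mul_smul, hKC', smul_smul, inv_mul_cancel₀ hδ, one_smul]
  have h3' := congrArg intC h3
  rw [intC_mul, intC_add, intC_smul, intC_transpose] at h3'
  rw [intC_mul, intC_smul, intC_one] at hKC
  have key : ((C.det.natAbs : ℂ)⁻¹ • intC (A * signedAdj C) - (autJ g Ω * (intC C)ᵀ)⁻¹) * autJ g Ω =
      blkA g * Ω + blkB g := by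
    rw [Matrix.sub_mul, Matrix.mul_inv_rev, nonsing_inv_mul_cancel_right _ _ hu, h.autJ_eq, h.a, h.b,
      Matrix.smul_mul, Matrix.mul_add, h3', intC_mul, Matrix.mul_assoc, ← Matrix.mul_assoc _ _ Ω, hKC,
      hCi]
    simp only [Int.cast_natCast, smul_add, smul_smul, Matrix.smul_mul, Matrix.mul_smul,
      inv_mul_cancel₀ hδ, Matrix.one_mul, one_smul]
    abel
  rw [act, ← key, mul_nonsing_inv_cancel_right _ _ hu]

/-- The terms of the transformed theta series, after completing the square. -/
theorem HasBlocks.thetaTerm_spAct (h : HasBlocks g A B C D) (hC : C.det ≠ 0)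
    {M : Matrix (Fin m) (Fin m) ℤ} (hM : M.IsSymm)
    {p : Matrix (Fin n) (Fin n) ℂ × Matrix (Fin m) (Fin n) ℂ} (hp : p ∈ siegelJacobi n m)
    (ξ : Matrix (Fin m) (Fin n) ℤ) :
    thetaTerm M (spAct g p) ξ * Complex.exp (-(Real.pi * Complex.I * spQuad (intC M) g p)) =
      Complex.exp (Real.pi * Complex.I * ((bil M (ξ * (A * signedAdj C)) ξ : ℤ) / C.det.natAbs)) *
      Complex.exp (-(Real.pi * Complex.I * bil (intC M) ((p.2 * (intC C)ᵀ - intC ξ) *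
        (autJ g p.1 * (intC C)ᵀ)⁻¹) (p.2 * (intC C)ᵀ - intC ξ))) := by
  have hMC := intC_isSymm hM
  have hu := autJ_isUnit g hp.1
  have hCu : IsUnit (intC C).det := by rw [intC_det]; exact (Int.cast_ne_zero.2 hC).isUnit
  have hCu' : IsUnit ((intC C)ᵀ).det := by rwa [det_transpose]
  set V := (autJ g p.1 * (intC C)ᵀ)⁻¹ with hV
  have hVs : Vᵀ = V := by rw [hV, transpose_nonsing_inv, (h.autJ_mul_isSymm hp.1.1).eq]
  have hCV : (intC C)ᵀ * V = (autJ g p.1)⁻¹ := by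
    rw [hV, Matrix.mul_inv_rev, mul_nonsing_inv_cancel_left _ _ hCu']
  rw [thetaTerm_eq_bil, ← Complex.exp_add, ← Complex.exp_add]
  congr 1
  have e1 : bil (intC M) (p.2 * (intC C)ᵀ * V) (p.2 * (intC C)ᵀ) = spQuad (intC M) g p := by
    rw [← bil_mul_left, Matrix.mul_assoc, Matrix.mul_assoc, ← Matrix.mul_assoc _ V, hCV, spQuad, h.c]
  have e2 : bil (intC M) (p.2 * (intC C)ᵀ * V) (intC ξ) =
      bil (intC M) (intC ξ) (p.2 * (autJ g p.1)⁻¹) := by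
    rw [Matrix.mul_assoc, hCV, bil_comm _ _ hMC]
  have e3 : bil (intC M) (intC ξ * V) (p.2 * (intC C)ᵀ) =
      bil (intC M) (intC ξ) (p.2 * (autJ g p.1)⁻¹) := by
    rw [bil_mul_comm _ _ hMC, hVs, e2]
  have e4 : bil (intC M) (intC ξ * act g p.1) (intC ξ) =
      ((bil M (ξ * (A * signedAdj C)) ξ : ℤ) : ℂ) / C.det.natAbs -
        bil (intC M) (intC ξ * V) (intC ξ) := by
    rw [h.act_eq hC hp.1, Matrix.mul_sub, bil_sub_left, Matrix.mul_smul, bil_smul_left, ← intC_mul,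
      intC_bil, div_eq_inv_mul]
  simp only [spAct, Matrix.sub_mul, bil_sub_left, bil_sub_right, e1, e2, e3, e4]
  ring

end transform

/-! ### Expansion and periods of the transformed theta series -/

section transform

variable {n m : ℕ} {g : Sp n} {A B C D : Matrix (Fin n) (Fin n) ℤ}

/-- The transformed theta series, up to the factor `J_{1/2}^m`. -/
def thetaSlash (M : Matrix (Fin m) (Fin m) ℤ) (g : Sp n)
    (p : Matrix (Fin n) (Fin n) ℂ × Matrix (Fin m) (Fin n) ℂ) : ℂ :=
  theta M (spAct g p) * Complex.exp (-(Real.pi * Complex.I * spQuad (intC M) g p))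

theorem inv_map_ofReal {M : Matrix (Fin m) (Fin m) ℤ} (hM : (M.map (Int.cast : ℤ → ℝ)).PosDef) :
    ((M.map (Int.cast : ℤ → ℝ))⁻¹).map Complex.ofReal = (intC M)⁻¹ := by
  symm
  apply inv_eq_right_inv
  have h := mul_nonsing_inv _ ((isUnit_iff_isUnit_det _).1 hM.isUnit)
  have h2 := congrArg (fun X : Matrix (Fin m) (Fin m) ℝ => X.map Complex.ofRealHom) h
  simp only [Matrix.map_mul] at h2
  rw [intC_eq_map]
  refine Eq.trans h2 ?_
  rw [Matrix.map_one _ (map_zero _) (map_one _)]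

theorem isUnit_det_intC {M : Matrix (Fin m) (Fin m) ℤ} (hM : M.det ≠ 0) : IsUnit (intC M).det := by
  rw [intC_det]; exact (Int.cast_ne_zero.2 hM).isUnit

theorem dualArg_inv (hC : C.det ≠ 0) (q : ℕ) [NeZero q] {Ω : Matrix (Fin n) (Fin n) ℂ}
    (hΩ : Ω ∈ siegelUpper n) :
    (dualArg q g C Ω)⁻¹ = (Complex.I * q ^ 2) • (autJ g Ω * (intC C)ᵀ)⁻¹ := by
  have hq : (q : ℂ) ≠ 0 := by exact_mod_cast NeZero.ne q
  have hu : IsUnit (autJ g Ω * (intC C)ᵀ).det := by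
    rw [det_mul, det_transpose]
    exact (autJ_isUnit g hΩ).mul (isUnit_det_intC hC)
  apply inv_eq_right_inv
  have e : -Complex.I / (q : ℂ) ^ 2 * (Complex.I * q ^ 2) = 1 := by
    field_simp
    rw [Complex.I_sq, neg_neg]
  rw [dualArg, Matrix.smul_mul, Matrix.mul_smul, smul_smul, e, one_smul, mul_nonsing_inv _ hu]

/-- The completed square is a term of a dual theta series. -/
theorem cexp_eq_matDual (hC : C.det ≠ 0) {M : Matrix (Fin m) (Fin m) ℤ} (hM : M.det ≠ 0)
    (q : ℕ) [NeZero q] {Ω : Matrix (Fin n) (Fin n) ℂ} (hΩ : Ω ∈ siegelUpper n)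
    (w : Matrix (Fin m) (Fin n) ℂ) (y : Matrix (Fin m) (Fin n) ℤ) :
    Complex.exp (-(Real.pi * Complex.I * bil (intC M) ((w - (q : ℂ) • intC y) *
        (autJ g Ω * (intC C)ᵀ)⁻¹) (w - (q : ℂ) • intC y))) =
      matDual (intC M)⁻¹ (dualArg q g C Ω) ((q : ℂ)⁻¹ • w) y := by
  have hq : (q : ℂ) ≠ 0 := by exact_mod_cast NeZero.ne q
  rw [matDual, nonsing_inv_nonsing_inv _ (isUnit_det_intC hM), dualArg_inv hC q hΩ]
  congr 2
  have e : (q : ℂ)⁻¹ • w - intC y = (q : ℂ)⁻¹ • (w - (q : ℂ) • intC y) := by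
    rw [smul_sub, smul_smul, inv_mul_cancel₀ hq, one_smul]
  change _ = Real.pi * bil (intC M) _ _
  rw [e, Matrix.mul_smul, Matrix.smul_mul, bil_smul_left, bil_smul_left, bil_smul_right]
  field_simp

theorem matTerm_add (T : Matrix (Fin m) (Fin m) ℂ) (Y : Matrix (Fin n) (Fin n) ℂ)
    (z w : Matrix (Fin m) (Fin n) ℂ) (x : Matrix (Fin m) (Fin n) ℤ) :
    matTerm T Y (z + w) x = matTerm T Y z x * Complex.exp (2 * Real.pi * Complex.I * bil 1 (intC x) w) := by
  rw [matTerm, matTerm, bil_one, ← Complex.exp_add, transpose_add, Matrix.mul_add, trace_add]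
  congr 1; ring

/-- The finite Fourier transform of the quadratic character `r ↦ e(σ(M r X ᵗr) / q)`. -/
def gaussHat (q : ℕ) [NeZero q] (M : Matrix (Fin m) (Fin m) ℤ) (X : Matrix (Fin n) (Fin n) ℤ)
    (x : Matrix (Fin m) (Fin n) ℤ) : ℂ :=
  ∑ r : Matrix (Fin m) (Fin n) (ZMod q),
    stdAddChar (bil (redMod q M) (r * redMod q X) r - bil 1 (redMod q x) r)

/-- The expansion of the transformed theta series, from the inversion formula applied to each residue
class modulo `2 |det C|`. -/
theorem HasBlocks.thetaSlash_eq_tsum (h : HasBlocks g A B C D) (hC : C.det ≠ 0)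
    {M : Matrix (Fin m) (Fin m) ℤ} (hM : (M.map (Int.cast : ℤ → ℝ)).PosDef) (hMs : M.IsSymm)
    (hMd : M.det ≠ 0) {q : ℕ} [NeZero q] (hq : q = 2 * C.det.natAbs)
    {p : Matrix (Fin n) (Fin n) ℂ × Matrix (Fin m) (Fin n) ℂ} (hp : p ∈ siegelJacobi n m) {d : ℂ}
    (hd : ∀ z, ∑' y, matDual (intC M)⁻¹ (dualArg q g C p.1) z y =
      d * ∑' x, matTerm (intC M)⁻¹ (dualArg q g C p.1) z x) :
    thetaSlash M g p = d * ∑' x, gaussHat q M (A * signedAdj C) x *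
      matTerm (intC M)⁻¹ (dualArg q g C p.1) ((q : ℂ)⁻¹ • (p.2 * (intC C)ᵀ)) x := by
  have hq0 : (q : ℂ) ≠ 0 := by exact_mod_cast NeZero.ne q
  set Y := dualArg q g C p.1 with hY
  have hYm : Y ∈ posRe n := h.dualArg_mem hC q hp.1
  have hs : Summable fun ξ => thetaTerm M (spAct g p) ξ *
      Complex.exp (-(Real.pi * Complex.I * spQuad (intC M) g p)) :=
    (summable_thetaTerm hM (spAct_mem g hp)).of_norm.mul_right _
  have hsum : ∀ z : Matrix (Fin m) (Fin n) ℂ, Summable fun x => matTerm (intC M)⁻¹ Y z x := fun z => by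
    have := summable_matTerm hM.inv hYm z
    rw [inv_map_ofReal hM] at this
    exact this.of_norm
  rw [thetaSlash, theta, ← tsum_mul_right, tsum_residue q hs]
  have h1 : ∀ r : Matrix (Fin m) (Fin n) (ZMod q), ∑' y, thetaTerm M (spAct g p)
      (liftMod r + (q : ℤ) • y) * Complex.exp (-(Real.pi * Complex.I * spQuad (intC M) g p)) =
      d * ∑' x, stdAddChar (bil (redMod q M) (r * redMod q (A * signedAdj C)) r -
        bil 1 (redMod q x) r) * matTerm (intC M)⁻¹ Y ((q : ℂ)⁻¹ • (p.2 * (intC C)ᵀ)) x := by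
    intro r
    have h2 : ∀ y : Matrix (Fin m) (Fin n) ℤ, thetaTerm M (spAct g p) (liftMod r + (q : ℤ) • y) *
        Complex.exp (-(Real.pi * Complex.I * spQuad (intC M) g p)) =
        stdAddChar (bil (redMod q M) (r * redMod q (A * signedAdj C)) r) *
          matDual (intC M)⁻¹ Y ((q : ℂ)⁻¹ • (p.2 * (intC C)ᵀ - intC (liftMod r))) y := by
      intro y
      have e1 : redMod q (liftMod r + (q : ℤ) • y) = r := by
        rw [redMod_add, redMod_liftMod, redMod_smul]; simp
      have e2 : p.2 * (intC C)ᵀ - intC (liftMod r + (q : ℤ) • y) =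
          (p.2 * (intC C)ᵀ - intC (liftMod r)) - (q : ℂ) • intC y := by
        rw [intC_add, intC_smul, Int.cast_natCast]; abel
      rw [h.thetaTerm_spAct hC hMs hp, cexp_eq_stdAddChar hq, ← redMod_bil, redMod_mul, e1, e2,
        cexp_eq_matDual hC hMd q hp.1]
    simp only [h2, tsum_mul_left, hd]
    rw [mul_left_comm, ← tsum_mul_left]
    congr 1
    refine tsum_congr fun x => ?_
    have e3 : (q : ℂ)⁻¹ • (p.2 * (intC C)ᵀ - intC (liftMod r)) = (q : ℂ)⁻¹ • (p.2 * (intC C)ᵀ) +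
        -(q : ℂ)⁻¹ • intC (liftMod r) := by
      rw [smul_sub, sub_eq_add_neg, neg_smul]
    have e4 : Complex.exp (2 * Real.pi * Complex.I * bil 1 (intC x) (-(q : ℂ)⁻¹ • intC (liftMod r))) =
        stdAddChar (-bil 1 (redMod q x) r) := by
      have : -bil 1 (redMod q x) r = ((-(bil 1 x (liftMod r)) : ℤ) : ZMod q) := by
        rw [Int.cast_neg, ← redMod_bil, redMod_one, redMod_liftMod]
      rw [this, ZMod.stdAddChar_coe, bil_smul_right, ← intC_one, intC_bil]
      congr 1
      push_cast; ring
    rw [e3, matTerm_add, e4, sub_eq_add_neg, AddChar.map_add_eq_mul]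
    ring
  simp only [h1, ← Finset.mul_sum]
  congr 1
  rw [← Summable.tsum_finsetSum]
  · exact tsum_congr fun x => by rw [gaussHat, Finset.sum_mul]
  · intro r _
    refine Summable.of_norm ?_
    simp only [norm_mul, AddChar.norm_apply, one_mul]
    exact (hsum _).norm

/-- The transformed theta series is periodic in `Z` with respect to `M⁻¹ ℤ^{(m,n)}`. Indeed a shift by
`μ` in `Z` becomes the shift by `μ (CΩ+D)⁻¹ = μ ᵗA - μ ᵗC (g·Ω)`, and `μ ᵗC` is integral and even
because `C` is divisible by `2 det M`. -/
theorem HasBlocks.thetaSlash_add (h : HasBlocks g A B C D) {M : Matrix (Fin m) (Fin m) ℤ}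
    (hMs : M.IsSymm) {C' : Matrix (Fin n) (Fin n) ℤ} (hC' : C = (2 * M.det) • C')
    {Ω : Matrix (Fin n) (Fin n) ℂ} (hΩ : Ω ∈ siegelUpper n) (Z μ : Matrix (Fin m) (Fin n) ℂ)
    (ν : Matrix (Fin m) (Fin n) ℤ) (hμ : intC M * μ = intC ν) :
    thetaSlash M g (Ω, Z + μ) = thetaSlash M g (Ω, Z) := by
  have hMC := intC_isSymm hMs
  have hu := autJ_isUnit g hΩ
  set l : Matrix (Fin m) (Fin n) ℤ := -((2 : ℤ) • (M.adjugate * ν * C'ᵀ)) with hl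
  have hlμ : intC l = -(μ * (intC C)ᵀ) := by
    have e1 : (M.det : ℂ) • μ = intC (M.adjugate * ν) := by
      have e2 := congrArg intC (adjugate_mul M)
      rw [intC_mul, intC_smul, intC_one] at e2
      rw [intC_mul, ← hμ, ← Matrix.mul_assoc, e2, Matrix.smul_mul, Matrix.one_mul]
    rw [hl, intC_neg, intC_smul, intC_mul, ← e1, hC', intC_smul, transpose_smul, Matrix.mul_smul,
      Matrix.smul_mul, smul_smul, intC_transpose]
    push_cast; rfl
  have hact : (intC A)ᵀ - (intC C)ᵀ * act g Ω = (autJ g Ω)⁻¹ := by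
    symm
    apply inv_eq_left_inv
    have h1 : act g Ω * autJ g Ω = intC A * Ω + intC B := by
      rw [act, nonsing_inv_mul_cancel_right _ _ hu, h.a, h.b]
    obtain ⟨r1, _, r3⟩ := blk_rel g
    rw [h.a, h.c] at r1
    rw [h.a, h.b, h.c, h.d] at r3
    rw [Matrix.sub_mul, Matrix.mul_assoc, h1, h.autJ_eq]
    calc _ = ((intC A)ᵀ * intC C - (intC C)ᵀ * intC A) * Ω +
          ((intC A)ᵀ * intC D - (intC C)ᵀ * intC B) := by noncomm_ring
      _ = 1 := by rw [r1, r3]; simp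
  have hsp : spAct g (Ω, Z + μ) =
      (act g Ω, Z * (autJ g Ω)⁻¹ + intC l * act g Ω + μ * (intC A)ᵀ) := by
    simp only [spAct]
    rw [hlμ, Matrix.add_mul, ← hact]
    congr 1
    simp only [Matrix.mul_sub, Matrix.neg_mul, Matrix.mul_assoc]
    abel
  have hμ' : intC M * (μ * (intC A)ᵀ) = intC (ν * Aᵀ) := by
    rw [← Matrix.mul_assoc, hμ, intC_mul, intC_transpose]
  set S := (autJ g Ω)⁻¹ * intC C with hS
  have hCS : (intC C)ᵀ * act g Ω * intC C = (intC A)ᵀ * intC C - S := by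
    rw [hS, ← hact, Matrix.sub_mul, sub_sub_cancel]
  have hSs : Sᵀ = S := by
    have h1 : S = (intC A)ᵀ * intC C - (intC C)ᵀ * act g Ω * intC C := by rw [hCS, sub_sub_cancel]
    obtain ⟨r1, _, _⟩ := blk_rel g
    rw [h.a, h.c] at r1
    rw [h1]
    simp only [transpose_sub, transpose_mul, transpose_transpose, (act_isSymm g hΩ).eq,
      Matrix.mul_assoc, r1]
  rw [thetaSlash, thetaSlash, hsp, theta_shift hMs (act_isSymm g hΩ) _ _ _ _ hμ', mul_right_comm,
    ← Complex.exp_add, mul_comm, spAct]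
  congr 1
  rw [Complex.exp_eq_exp_iff_exists_int]
  have q1 : spQuad (intC M) g (Ω, Z + μ) = spQuad (intC M) g (Ω, Z) +
      2 * bil (intC M) (μ * S) Z + bil (intC M) (μ * S) μ := by
    have : bil (intC M) (Z * S) μ = bil (intC M) (μ * S) Z := by
      rw [bil_mul_comm _ _ hMC, hSs]
    simp only [spQuad, h.c, ← hS, Matrix.add_mul, bil_add_left, bil_add_right, this]
    ring
  have q2 : bil (intC M) (intC l) (Z * (autJ g Ω)⁻¹) = -bil (intC M) (μ * S) Z := by
    rw [hlμ, bil_neg_left, bil_comm _ _ hMC, ← bil_mul_left, Matrix.mul_assoc, ← hS,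
      bil_mul_comm _ _ hMC, hSs]
  have q3 : bil (intC M) (intC l * act g Ω) (intC l) =
      bil (intC M) (μ * ((intC A)ᵀ * intC C)) μ - bil (intC M) (μ * S) μ := by
    rw [hlμ, Matrix.neg_mul, bil_neg_left, bil_neg_right, neg_neg, ← bil_mul_left, Matrix.mul_assoc,
      Matrix.mul_assoc, ← Matrix.mul_assoc _ _ (intC C), hCS, Matrix.mul_sub, bil_sub_left]
  have q4 : bil (intC M) (μ * ((intC A)ᵀ * intC C)) μ =
      ((2 * bil 1 (ν * Aᵀ) (M.adjugate * ν * C'ᵀ) : ℤ) : ℂ) := by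
    have e : bil (intC M) (μ * ((intC A)ᵀ * intC C)) μ = -bil 1 (intC (ν * Aᵀ)) (intC l) := by
      rw [← Matrix.mul_assoc, bil_mul_left, ← hμ', bil_mul, Matrix.one_mul, hlμ, bil_neg_right,
        neg_neg]
    rw [e, ← intC_one, intC_bil, hl, bil_neg_right, bil_smul_right]
    push_cast; ring
  refine ⟨-bil 1 (ν * Aᵀ) (M.adjugate * ν * C'ᵀ), ?_⟩
  rw [q1, q2, q3, q4]
  push_cast
  ring

end transform

/-! ### Averaging over the periods -/

section transform

variable {n m : ℕ} {g : Sp n} {A B C D : Matrix (Fin n) (Fin n) ℤ}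

theorem adjugate_isSymm {M : Matrix (Fin m) (Fin m) ℤ} (hMs : M.IsSymm) : M.adjugate.IsSymm := by
  rw [Matrix.IsSymm, adjugate_transpose, hMs.eq]

/-- The index `x = 2 M η K` of the dual series that corresponds to `η`. -/
def dualIndex (M : Matrix (Fin m) (Fin m) ℤ) (C : Matrix (Fin n) (Fin n) ℤ)
    (η : Matrix (Fin m) (Fin n) ℤ) : Matrix (Fin m) (Fin n) ℤ := (2 : ℤ) • (M * (η * signedAdj C))

theorem adjugate_mul_dualIndex (M : Matrix (Fin m) (Fin m) ℤ) (C : Matrix (Fin n) (Fin n) ℤ)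
    (η : Matrix (Fin m) (Fin n) ℤ) :
    M.adjugate * (dualIndex M C η * C) = (2 * C.det.natAbs * M.det) • η := by
  rw [dualIndex, Matrix.smul_mul, Matrix.mul_smul, Matrix.mul_assoc M, Matrix.mul_assoc η,
    signedAdj_mul, ← Matrix.mul_assoc, adjugate_mul]
  simp only [Matrix.mul_smul, Matrix.mul_one, Matrix.smul_mul, Matrix.one_mul, smul_smul]
  congr 1; ring

theorem dualIndex_injective {M : Matrix (Fin m) (Fin m) ℤ} {C : Matrix (Fin n) (Fin n) ℤ}
    (hM : M.det ≠ 0) (hC : C.det ≠ 0) : Function.Injective (dualIndex M C) := by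
  intro η η' h
  have h1 := adjugate_mul_dualIndex M C η
  rw [h, adjugate_mul_dualIndex] at h1
  have hc : (2 * C.det.natAbs * M.det : ℤ) ≠ 0 :=
    mul_ne_zero (mul_ne_zero two_ne_zero (by simpa using hC)) hM
  exact smul_right_injective _ hc h1.symm

theorem exists_dualIndex_eq {M : Matrix (Fin m) (Fin m) ℤ} {C : Matrix (Fin n) (Fin n) ℤ}
    (hM : M.det ≠ 0) (hC : C.det ≠ 0) {x η : Matrix (Fin m) (Fin n) ℤ}
    (hx : M.adjugate * (x * C) = (2 * C.det.natAbs * M.det) • η) : dualIndex M C η = x := by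
  have hc : (2 * C.det.natAbs * M.det : ℤ) ≠ 0 :=
    mul_ne_zero (mul_ne_zero two_ne_zero (by simpa using hC)) hM
  refine smul_right_injective _ hc ?_
  have h1 : (2 * C.det.natAbs * M.det : ℤ) • dualIndex M C η =
      (2 : ℤ) • (M * (((2 * C.det.natAbs * M.det : ℤ) • η) * signedAdj C)) := by
    rw [dualIndex, smul_comm, Matrix.smul_mul, Matrix.mul_smul]
  change (2 * C.det.natAbs * M.det : ℤ) • dualIndex M C η = (2 * C.det.natAbs * M.det : ℤ) • x
  rw [h1, ← hx, Matrix.mul_assoc, Matrix.mul_assoc, mul_signedAdj, ← Matrix.mul_assoc, mul_adjugate]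
  simp only [Matrix.mul_smul, Matrix.mul_one, Matrix.smul_mul, Matrix.one_mul, smul_smul]
  congr 1; ring

theorem exists_smul_of_redMod_eq_zero {a b : Type*} {q : ℕ} {X : Matrix a b ℤ}
    (h : redMod q X = 0) : ∃ η, X = (q : ℤ) • η := by
  have h1 : ∀ i j, (q : ℤ) ∣ X i j := fun i j => by
    rw [← ZMod.intCast_zmod_eq_zero_iff_dvd]
    exact congrFun (congrFun h i) j
  choose η hη using h1
  exact ⟨of η, by ext i j; simp [hη i j]⟩

/-- The dual terms that survive are terms of the original theta series. -/
theorem HasBlocks.matTerm_dualIndex (h : HasBlocks g A B C D) (hC : C.det ≠ 0)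
    {M : Matrix (Fin m) (Fin m) ℤ} (hMs : M.IsSymm) (hMd : M.det ≠ 0) {q : ℕ} [NeZero q]
    (hq : q = 2 * C.det.natAbs)
    (p : Matrix (Fin n) (Fin n) ℂ × Matrix (Fin m) (Fin n) ℂ) (η : Matrix (Fin m) (Fin n) ℤ) :
    matTerm (intC M)⁻¹ (dualArg q g C p.1) ((q : ℂ)⁻¹ • (p.2 * (intC C)ᵀ)) (dualIndex M C η) =
      thetaTerm M p η * stdAddChar (bil (redMod q M) (redMod q η * redMod q (signedAdj C * D))
        (redMod q η)) := by
  have hMC := intC_isSymm hMs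
  have hMu := isUnit_det_intC hMd
  set K := signedAdj C with hK
  have hδ : (C.det.natAbs : ℂ) ≠ 0 := by simpa using hC
  have hKC : intC K * intC C = (C.det.natAbs : ℂ) • 1 := by
    have := congrArg intC (signedAdj_mul C)
    rwa [intC_mul, intC_smul, intC_one, Int.cast_natCast] at this
  have hKC' : (intC C)ᵀ * (intC K)ᵀ = (C.det.natAbs : ℂ) • 1 := by
    rw [← transpose_mul, hKC, transpose_smul, transpose_one]
  have hq' : (q : ℂ) = 2 * (C.det.natAbs : ℂ) := by rw [hq]; push_cast; rfl
  have e0 : intC (dualIndex M C η) = (2 : ℂ) • (intC M * (intC η * intC K)) := by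
    rw [dualIndex, intC_smul, intC_mul, intC_mul, Int.cast_ofNat]
  have e1 : bil (intC M)⁻¹ (intC (dualIndex M C η) * (autJ g p.1 * (intC C)ᵀ))
      (intC (dualIndex M C η)) = 4 * (C.det.natAbs) * ((C.det.natAbs) *
        bil (intC M) (intC η * p.1) (intC η) + bil (intC M) (intC η * intC (K * D)) (intC η)) := by
    have e2 : bil (intC M)⁻¹ (intC M * (intC η * intC K) * (autJ g p.1 * (intC C)ᵀ))
        (intC M * (intC η * intC K)) =
        bil (intC M) (intC η * intC K * (autJ g p.1 * (intC C)ᵀ)) (intC η * intC K) := by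
      rw [Matrix.mul_assoc (intC M), bil_mul, nonsing_inv_mul _ hMu, bil_comm _ _ isSymm_one, bil_mul,
        Matrix.one_mul, bil_comm _ _ hMC]
    have e3 : bil (intC M) (intC η * intC K * (autJ g p.1 * (intC C)ᵀ)) (intC η * intC K) =
        C.det.natAbs * bil (intC M) (intC η * (intC K * autJ g p.1)) (intC η) := by
      rw [← transpose_transpose (intC K), ← bil_mul_left]
      rw [transpose_transpose]
      have : intC η * intC K * (autJ g p.1 * (intC C)ᵀ) * (intC K)ᵀ =
          (C.det.natAbs : ℂ) • (intC η * (intC K * autJ g p.1)) := by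
        rw [Matrix.mul_assoc, Matrix.mul_assoc (autJ g p.1), hKC']
        simp only [Matrix.mul_smul, Matrix.mul_one, Matrix.mul_assoc]
      rw [this, bil_smul_left]
    have e4 : intC K * autJ g p.1 = (C.det.natAbs : ℂ) • p.1 + intC (K * D) := by
      rw [h.autJ_eq, Matrix.mul_add, ← Matrix.mul_assoc, hKC, Matrix.smul_mul, Matrix.one_mul,
        intC_mul]
    rw [e0, Matrix.smul_mul, bil_smul_left, bil_smul_right, e2, e3, e4, Matrix.mul_add,
      bil_add_left, Matrix.mul_smul, bil_smul_left]
    ring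
  have e5 : bil 1 (intC (dualIndex M C η)) (p.2 * (intC C)ᵀ) =
      2 * C.det.natAbs * bil (intC M) (intC η) p.2 := by
    rw [← bil_mul_left, e0, Matrix.smul_mul, Matrix.mul_assoc, Matrix.mul_assoc (intC η), hKC,
      Matrix.mul_smul, Matrix.mul_one, Matrix.mul_smul, bil_smul_left, bil_smul_left, bil_mul,
      Matrix.one_mul]
    ring
  have e6 : matTerm (intC M)⁻¹ (dualArg q g C p.1) ((q : ℂ)⁻¹ • (p.2 * (intC C)ᵀ)) (dualIndex M C η) =
      Complex.exp (-(Real.pi * bil (intC M)⁻¹ (intC (dualIndex M C η) * dualArg q g C p.1)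
        (intC (dualIndex M C η))) + 2 * Real.pi * Complex.I *
        bil 1 (intC (dualIndex M C η)) ((q : ℂ)⁻¹ • (p.2 * (intC C)ᵀ))) := by
    rw [matTerm, bil_one]; rfl
  rw [← redMod_mul, redMod_bil, ← cexp_eq_stdAddChar hq, e6, thetaTerm_eq_bil, ← Complex.exp_add,
    dualArg, Matrix.mul_smul, bil_smul_left, bil_smul_right, e1, e5, hq', ← intC_mul, intC_bil]
  congr 1
  field_simp
  ring

/-- On the surviving indices the Fourier coefficient and the phase of `HasBlocks.matTerm_dualIndex`
combine to a constant. -/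
theorem gaussHat_dualIndex {M : Matrix (Fin m) (Fin m) ℤ} (hMs : M.IsSymm) {q : ℕ} [NeZero q]
    (hrel : GaussRel (redMod q A) (redMod q B) (redMod q C) (redMod q D) (redMod q (signedAdj C)))
    (η : Matrix (Fin m) (Fin n) ℤ) :
    gaussHat q M (A * signedAdj C) (dualIndex M C η) *
      stdAddChar (bil (redMod q M) (redMod q η * redMod q (signedAdj C * D)) (redMod q η)) =
      gaussSumMat (n := n) (redMod q M) (redMod q (A * signedAdj C)) := by
  have hMr : (redMod q M).IsSymm := hMs.map _
  rw [redMod_mul, redMod_mul, ← hrel.sum_shift hMr (redMod q η)]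
  congr 1
  rw [gaussHat]
  refine Finset.sum_congr rfl fun r _ => ?_
  rw [dualIndex, redMod_smul, redMod_mul, redMod_mul, redMod_mul, bil_smul_left, bil_mul,
    Matrix.one_mul, Int.cast_ofNat]

/-- Averaging over the periods of the transformed theta series removes all terms outside the image of
`η ↦ 2 M η K`; what is left is a multiple of the original series. -/
theorem HasBlocks.thetaSlash_eq (h : HasBlocks g A B C D) (hC : C.det ≠ 0)
    {M : Matrix (Fin m) (Fin m) ℤ} (hM : (M.map (Int.cast : ℤ → ℝ)).PosDef) (hMs : M.IsSymm)
    (hMd : M.det ≠ 0) {B' C' : Matrix (Fin n) (Fin n) ℤ} (hB' : B = (2 : ℤ) • B')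
    (hC' : C = (2 * M.det) • C') {q : ℕ} [NeZero q] (hq : q = 2 * C.det.natAbs)
    {p : Matrix (Fin n) (Fin n) ℂ × Matrix (Fin m) (Fin n) ℂ} (hp : p ∈ siegelJacobi n m) {d : ℂ}
    (hd : ∀ z, ∑' y, matDual (intC M)⁻¹ (dualArg q g C p.1) z y =
      d * ∑' x, matTerm (intC M)⁻¹ (dualArg q g C p.1) z x) :
    thetaSlash M g p =
      d * gaussSumMat (n := n) (redMod q M) (redMod q (A * signedAdj C)) * theta M p := by
  obtain ⟨Ω, Z⟩ := p
  have hΩ : Ω ∈ siegelUpper n := hp.1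
  have hMC := intC_isSymm hMs
  have hMu := isUnit_det_intC hMd
  set K := signedAdj C with hK
  set Q : ℕ := q * M.det.natAbs with hQ
  have hQ0 : NeZero Q := ⟨mul_ne_zero (NeZero.ne q) (by simpa using hMd)⟩
  have hq0 : (q : ℂ) ≠ 0 := by exact_mod_cast NeZero.ne q
  have hMd0 : (M.det : ℂ) ≠ 0 := Int.cast_ne_zero.2 hMd
  have hrel := h.rel.gaussRel hC ⟨B', hB'⟩ ⟨M.det • C', by rw [smul_smul, hC']⟩ hq
  set T := (intC M)⁻¹ with hT
  set Y := dualArg q g C Ω with hY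
  have hYm : Y ∈ posRe n := h.dualArg_mem hC q hΩ
  set t : Matrix (Fin m) (Fin n) ℤ → ℂ := fun x =>
    gaussHat q M (A * K) x * matTerm T Y ((q : ℂ)⁻¹ • (Z * (intC C)ᵀ)) x with ht
  have hts : Summable t := by
    have h1 := summable_matTerm hM.inv hYm ((q : ℂ)⁻¹ • (Z * (intC C)ᵀ))
    rw [inv_map_ofReal hM] at h1
    refine Summable.of_norm_bounded
      (h1.mul_left (Fintype.card (Matrix (Fin m) (Fin n) (ZMod q)) : ℝ)) fun x => ?_
    rw [ht, norm_mul]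
    refine mul_le_mul_of_nonneg_right ?_ (norm_nonneg _)
    rw [gaussHat]
    refine (norm_sum_le _ _).trans ?_
    simp only [AddChar.norm_apply, Finset.sum_const, Finset.card_univ, nsmul_eq_mul, mul_one, le_refl]
  -- a shift by `M⁻¹ ν` multiplies the term of index `x` by the character `ν ↦ e(σ(w(x) ᵗν) / Q)`;
  -- the sign makes up for the modulus being `|det M|`
  set w : Matrix (Fin m) (Fin n) ℤ → Matrix (Fin m) (Fin n) ℤ :=
    fun x => M.det.sign • (M.adjugate * (x * C)) with hw
  have hper : ∀ ν : Matrix (Fin m) (Fin n) (ZMod Q), thetaSlash M g (Ω, Z) =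
      d * ∑' x, t x * stdAddChar (bil 1 (redMod Q (w x)) ν) := by
    intro ν
    set μ := (intC M)⁻¹ * intC (liftMod ν) with hμ
    have hMμ : intC M * μ = intC (liftMod ν) := by
      rw [hμ, mul_nonsing_inv_cancel_left _ _ hMu]
    rw [← h.thetaSlash_add hMs hC' hΩ Z μ _ hMμ,
      h.thetaSlash_eq_tsum hC hM hMs hMd hq (p := (Ω, Z + μ)) hp hd]
    congr 1
    refine tsum_congr fun x => ?_
    have e1 : (q : ℂ)⁻¹ • ((Z + μ) * (intC C)ᵀ) =
        (q : ℂ)⁻¹ • (Z * (intC C)ᵀ) + (q : ℂ)⁻¹ • (μ * (intC C)ᵀ) := by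
      rw [Matrix.add_mul, smul_add]
    have e2 : bil 1 (intC x) ((q : ℂ)⁻¹ • (μ * (intC C)ᵀ)) =
        ((bil 1 (w x) (liftMod ν) : ℤ) : ℂ) / Q := by
      have e3 : (M.det : ℂ) • μ = intC (M.adjugate * liftMod ν) := by
        have e2 := congrArg intC (adjugate_mul M)
        rw [intC_mul, intC_smul, intC_one] at e2
        rw [intC_mul, ← hMμ, ← Matrix.mul_assoc, e2, Matrix.smul_mul, Matrix.one_mul]
      have e4 : (M.det : ℂ) * bil 1 (intC x) (μ * (intC C)ᵀ) =
          ((bil 1 (M.adjugate * (x * C)) (liftMod ν) : ℤ) : ℂ) := by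
        rw [← bil_mul_left, ← bil_smul_right, e3, ← intC_mul, ← intC_one, intC_bil,
          bil_comm _ _ isSymm_one, bil_mul, Matrix.one_mul, bil_comm _ _ (adjugate_isSymm hMs),
          ← Matrix.one_mul M.adjugate, ← bil_mul, Matrix.one_mul]
      have e5 : ((bil 1 (w x) (liftMod ν) : ℤ) : ℂ) =
          (M.det.sign : ℂ) * (M.det * bil 1 (intC x) (μ * (intC C)ᵀ)) := by
        rw [e4, hw, bil_smul_left, Int.cast_mul]
      have e6 : ((M.det.sign : ℤ) : ℂ) * (M.det : ℂ) = (M.det.natAbs : ℂ) := by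
        rw [← Int.cast_mul, Int.sign_mul_self_eq_natAbs, Int.cast_natCast]
      have hMn : (M.det.natAbs : ℂ) ≠ 0 := by simpa using hMd
      rw [bil_smul_right, e5, ← mul_assoc, e6, hQ]
      push_cast
      field_simp
    rw [e1, matTerm_add, e2, ht]
    have e7 : bil 1 (redMod Q (w x)) ν = ((bil 1 (w x) (liftMod ν) : ℤ) : ZMod Q) := by
      rw [← redMod_bil, redMod_one, redMod_liftMod]
    have e8 : Complex.exp (2 * Real.pi * Complex.I * (((bil 1 (w x) (liftMod ν) : ℤ) : ℂ) / Q)) =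
        Complex.exp (2 * Real.pi * Complex.I * ((bil 1 (w x) (liftMod ν) : ℤ) : ℂ) / Q) := by
      congr 1; ring
    rw [e7, ZMod.stdAddChar_coe, e8]
    exact (mul_assoc _ _ _).symm
  have hcard : (Fintype.card (Matrix (Fin m) (Fin n) (ZMod Q)) : ℂ) ≠ 0 := by
    exact_mod_cast Fintype.card_ne_zero
  refine mul_left_cancel₀ hcard ?_
  have hsupp : (Function.support fun x => t x * (if redMod Q (w x) = 0 then
      (Fintype.card (Matrix (Fin m) (Fin n) (ZMod Q)) : ℂ) else 0)) ⊆ Set.range (dualIndex M C) := by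
    intro x hx
    have h0 : redMod Q (w x) = 0 := by
      by_contra h0
      exact hx (by simp [h0])
    obtain ⟨η, hη⟩ := exists_smul_of_redMod_eq_zero h0
    refine ⟨η, exists_dualIndex_eq hMd hC ?_⟩
    have hs : M.det.sign * M.det.sign = 1 := by
      rcases lt_or_gt_of_ne hMd with h | h
      · rw [Int.sign_eq_neg_one_of_neg h]; rfl
      · rw [Int.sign_eq_one_of_pos h]; rfl
    have e1 : M.adjugate * (x * C) = M.det.sign • w x := by
      rw [hw, smul_smul, hs, one_smul]
    rw [e1, hη, smul_smul]
    congr 1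
    have e2 : (Q : ℤ) = 2 * C.det.natAbs * M.det.natAbs := by rw [hQ, hq]; push_cast; ring
    rw [e2, ← Int.sign_mul_self_eq_natAbs M.det]
    linear_combination (2 * C.det.natAbs * M.det : ℤ) * hs
  have hw0 : ∀ η, redMod Q (w (dualIndex M C η)) = 0 := by
    intro η
    have e2 : (Q : ℤ) = 2 * C.det.natAbs * M.det.natAbs := by rw [hQ, hq]; push_cast; ring
    have e3 : w (dualIndex M C η) = (Q : ℤ) • η := by
      simp only [hw, adjugate_mul_dualIndex, smul_smul]
      congr 1
      rw [e2, ← Int.sign_mul_self_eq_natAbs M.det]; ring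
    rw [e3, redMod_smul]; simp
  calc (Fintype.card (Matrix (Fin m) (Fin n) (ZMod Q)) : ℂ) * thetaSlash M g (Ω, Z)
      = ∑ ν : Matrix (Fin m) (Fin n) (ZMod Q), d * ∑' x, t x *
          stdAddChar (bil 1 (redMod Q (w x)) ν) := by
        simp only [← hper, Finset.sum_const, Finset.card_univ, nsmul_eq_mul]
    _ = d * ∑' x, t x * (if redMod Q (w x) = 0 then
          (Fintype.card (Matrix (Fin m) (Fin n) (ZMod Q)) : ℂ) else 0) := by
        rw [← Finset.mul_sum, ← Summable.tsum_finsetSum]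
        · simp only [← Finset.mul_sum, sum_stdAddChar_bil]
        · intro ν _
          refine Summable.of_norm ?_
          simp only [norm_mul, AddChar.norm_apply, mul_one]
          exact hts.norm
    _ = d * ∑' η, t (dualIndex M C η) * (Fintype.card (Matrix (Fin m) (Fin n) (ZMod Q)) : ℂ) := by
        rw [← (dualIndex_injective hMd hC).tsum_eq hsupp]
        simp only [hw0, if_true]
    _ = _ := by
        have e : ∀ η, t (dualIndex M C η) =
            gaussSumMat (n := n) (redMod q M) (redMod q (A * K)) * thetaTerm M (Ω, Z) η := by
          intro η
          rw [← gaussHat_dualIndex hMs hrel η, ht]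
          have := h.matTerm_dualIndex hC hMs hMd hq (Ω, Z) η
          simp only at this ⊢
          rw [this]; ring
        simp only [e, tsum_mul_right, tsum_mul_left, theta]
        ring

end transform

/-! ### The multiplier is an eighth root of unity -/

theorem siegelUpper_isPreconnected (n : ℕ) : IsPreconnected (siegelUpper n) :=
  (siegelUpper_convex n).isPreconnected

theorem continuous_dualArg {n : ℕ} (q : ℕ) (g : Sp n) (C : Matrix (Fin n) (Fin n) ℤ) :
    Continuous (dualArg q g C) := by
  unfold dualArg autJ; fun_prop

theorem det_dualArg {n : ℕ} (q : ℕ) (g : Sp n) (C : Matrix (Fin n) (Fin n) ℤ)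
    (Ω : Matrix (Fin n) (Fin n) ℂ) :
    (dualArg q g C Ω).det = (-Complex.I / q ^ 2) ^ n * C.det * (autJ g Ω).det := by
  rw [dualArg, det_smul, det_mul, det_transpose, intC_det, Fintype.card_fin]; ring

/-- When `C` is invertible the multiplier exists; it is a Gauss sum times a constant `κ` of known
square, which comes from the comparison of two square roots on the connected space `siegelUpper n`. -/
theorem HasBlocks.exists_isThetaMult {n m : ℕ} {A B C D : Matrix (Fin n) (Fin n) ℤ} {x : Mp n}
    (h : HasBlocks x.g A B C D) (hC : C.det ≠ 0)
    {M : Matrix (Fin m) (Fin m) ℤ} (hM : (M.map (Int.cast : ℤ → ℝ)).PosDef) (hMs : M.IsSymm)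
    (hMd : M.det ≠ 0) {B' C' : Matrix (Fin n) (Fin n) ℤ} (hB' : B = (2 : ℤ) • B')
    (hC' : C = (2 * M.det) • C') {q : ℕ} [NeZero q] (hq : q = 2 * C.det.natAbs) :
    ∃ κ : ℂ, κ ^ 2 = ((M.map (Int.cast : ℤ → ℝ))⁻¹.det : ℂ) ^ n *
        ((-Complex.I / q ^ 2) ^ n * C.det) ^ m ∧
      IsThetaMult M x (κ * gaussSumMat (n := n) (redMod q M) (redMod q (A * signedAdj C))) := by
  obtain ⟨E, h1, h2, h3⟩ := exists_matrix_inversion n hM.inv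
  rw [inv_map_ofReal hM] at h3
  obtain ⟨κ₀, hκ₀⟩ := IsAlgClosed.exists_pow_nat_eq (((M.map (Int.cast : ℤ → ℝ))⁻¹.det : ℂ) ^ n *
        ((-Complex.I / q ^ 2) ^ n * C.det) ^ m) two_pos
  have hκ0 : κ₀ ≠ 0 := by
    have hq0 : (q : ℂ) ≠ 0 := by exact_mod_cast NeZero.ne q
    have hT : ((M.map (Int.cast : ℤ → ℝ))⁻¹.det : ℂ) ≠ 0 := by exact_mod_cast hM.inv.det_pos.ne'
    have hCc : (C.det : ℂ) ≠ 0 := Int.cast_ne_zero.2 hC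
    intro h0
    rw [h0, zero_pow two_ne_zero] at hκ₀
    exact mul_ne_zero (pow_ne_zero _ hT) (pow_ne_zero _ (mul_ne_zero (pow_ne_zero _
      (div_ne_zero (neg_ne_zero.2 Complex.I_ne_zero) (pow_ne_zero _ hq0))) hCc)) hκ₀.symm
  have hkey : ∃ κ : ℂ, κ ^ 2 = κ₀ ^ 2 ∧ ∀ Ω ∈ siegelUpper n,
      E (dualArg q x.g C Ω) = κ * Jhalf x Ω ^ m := by
    rcases (siegelUpper_isPreconnected n).eq_or_eq_neg_of_sq_eq
      (f := fun Ω => E (dualArg q x.g C Ω)) (g := fun Ω => κ₀ * Jhalf x Ω ^ m)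
      (h1.comp (continuous_dualArg q x.g C).continuousOn fun Ω hΩ => h.dualArg_mem hC q hΩ)
      (continuousOn_const.mul ((continuousOn_Jhalf x).pow m))
      (fun Ω hΩ => by
        simp only [Pi.pow_apply]
        rw [h2 _ (h.dualArg_mem hC q hΩ), mul_pow, hκ₀, ← pow_mul, mul_comm m 2, pow_mul,
          Jhalf_sq x hΩ, det_dualArg]
        ring)
      (fun {Ω} hΩ => mul_ne_zero hκ0 (pow_ne_zero _ (Jhalf_ne_zero x hΩ))) with h4 | h4
    · exact ⟨κ₀, rfl, h4⟩
    · exact ⟨-κ₀, neg_sq κ₀, fun Ω hΩ => (h4 hΩ).trans (neg_mul _ _).symm⟩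
  obtain ⟨κ, hκ, hE⟩ := hkey
  refine ⟨κ, hκ.trans hκ₀, fun p hp => ?_⟩
  have h4 := h.thetaSlash_eq hC hM hMs hMd hB' hC' hq hp (h3 _ (h.dualArg_mem hC q hp.1))
  rw [thetaSlash, hE _ hp.1, Complex.exp_neg] at h4
  have h5 := Complex.exp_ne_zero (Real.pi * Complex.I * spQuad (intC M) x.g p)
  rw [spFactor]
  field_simp at h4
  rw [h4]; ring

theorem natAbs_det_neg_transpose {n : ℕ} (C : Matrix (Fin n) (Fin n) ℤ) :
    (-Cᵀ).det.natAbs = C.det.natAbs := by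
  rw [det_neg, det_transpose, Int.natAbs_mul, Int.natAbs_pow]; simp

theorem signedAdj_neg_transpose {n : ℕ} {C : Matrix (Fin n) (Fin n) ℤ} (hC : C.det ≠ 0) :
    signedAdj (-Cᵀ) = -(signedAdj C)ᵀ := by
  have h1 := signedAdj_mul (-Cᵀ)
  have h2 : -(signedAdj C)ᵀ * -Cᵀ = (C.det.natAbs : ℤ) • (1 : Matrix (Fin n) (Fin n) ℤ) := by
    rw [Matrix.neg_mul, Matrix.mul_neg, neg_neg, ← transpose_mul, mul_signedAdj, transpose_smul, transpose_one]
  rw [natAbs_det_neg_transpose, ← h2] at h1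
  have h3 := congrArg (· * signedAdj (-Cᵀ)) h1
  simp only [Matrix.mul_assoc, mul_signedAdj, natAbs_det_neg_transpose, Matrix.mul_smul,
    Matrix.mul_one] at h3
  exact smul_right_injective _ (show (C.det.natAbs : ℤ) ≠ 0 by simpa using hC) h3

/-- The eighth power of the multiplier is a non-negative real number, and its absolute value is one by
comparison with the multiplier of `x⁻¹`. -/
theorem HasBlocks.exists_isThetaMult_pow_eight {n m : ℕ} {A B C D : Matrix (Fin n) (Fin n) ℤ}
    {x : Mp n} (h : HasBlocks x.g A B C D) (hC : C.det ≠ 0)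
    {M : Matrix (Fin m) (Fin m) ℤ} (hM : (M.map (Int.cast : ℤ → ℝ)).PosDef) (hMs : M.IsSymm)
    (hMd : M.det ≠ 0) {B' C' : Matrix (Fin n) (Fin n) ℤ} (hB' : B = (2 : ℤ) • B')
    (hC' : C = (2 * M.det) • C') : ∃ c, IsThetaMult M x c ∧ c ^ 8 = 1 := by
  set q := 2 * C.det.natAbs with hq
  have : NeZero q := ⟨mul_ne_zero two_ne_zero (by simpa using hC)⟩
  have hC2 : (-Cᵀ).det.natAbs = C.det.natAbs := natAbs_det_neg_transpose C
  have hCi : (-Cᵀ).det ≠ 0 := by rwa [← Int.natAbs_ne_zero, hC2, Int.natAbs_ne_zero]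
  obtain ⟨κ, hκ, hx⟩ := h.exists_isThetaMult hC hM hMs hMd hB' hC' hq
  obtain ⟨κ', hκ', hx'⟩ := HasBlocks.exists_isThetaMult (x := x⁻¹) h.inv hCi hM hMs hMd
    (B' := -B'ᵀ) (C' := -C'ᵀ) (by rw [hB', transpose_smul, smul_neg])
    (by rw [hC', transpose_smul, smul_neg]) (hq.trans (by rw [hC2]))
  set G := gaussSumMat (n := n) (redMod q M) (redMod q (A * signedAdj C)) with hG
  have hG' : ‖gaussSumMat (n := n) (redMod q M) (redMod q (Dᵀ * signedAdj (-Cᵀ)))‖ = ‖G‖ := by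
    have hrel := h.rel.gaussRel hC ⟨B', hB'⟩ ⟨M.det • C', by rw [smul_smul, hC']⟩ hq
    have e : Dᵀ * signedAdj (-Cᵀ) = -(signedAdj C * D) := by
      rw [signedAdj_neg_transpose hC, Matrix.mul_neg, ← transpose_mul,
        (h.rel.signedAdj_rel hC).2.1.eq]
    rw [e, redMod_neg, gaussSumMat_neg, Complex.norm_conj, hG, redMod_mul, redMod_mul,
      ← hrel.gaussSumMat_eq (M := redMod q M) (hMs.map _)]
  have hκn : ‖κ'‖ = ‖κ‖ := by
    have e : ‖((-Cᵀ).det : ℂ)‖ = ‖(C.det : ℂ)‖ := by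
      rw [Complex.norm_intCast, Complex.norm_intCast, ← Int.cast_abs, ← Int.cast_abs,
        Int.abs_eq_natAbs, Int.abs_eq_natAbs, hC2]
    have h1 := congrArg norm hκ
    have h2 := congrArg norm hκ'
    simp only [norm_mul, norm_pow, e] at h1 h2
    exact (pow_left_inj₀ (norm_nonneg _) (norm_nonneg _) two_ne_zero).1 (h2.trans h1.symm)
  refine ⟨_, hx, ?_⟩
  have hprod := IsThetaMult.unique hM (mul_inv_cancel x ▸ hx.mul hx') IsThetaMult.one
  have hn : ‖κ * G‖ = 1 := by
    have h1 := congrArg norm hprod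
    rw [norm_mul, norm_mul κ', hκn, hG', ← norm_mul, norm_one] at h1
    nlinarith [norm_nonneg (κ * G)]
  -- `κ⁸` and the eighth power of the Gauss sum are non-negative real numbers
  obtain ⟨t, ht, hGt⟩ := gaussSumMat_pow_eight (n := n) (redMod q M) (redMod q (A * signedAdj C))
  rw [← hG] at hGt
  have hκ8 : κ ^ 8 = ((((M.map (Int.cast : ℤ → ℝ))⁻¹.det ^ n) ^ 4 *
      ((((q : ℝ) ^ 8)⁻¹ ^ n * (C.det : ℝ) ^ 4) ^ m) : ℝ) : ℂ) := by
    have hI : (-Complex.I / (q : ℂ) ^ 2) ^ 4 = ((q : ℂ) ^ 8)⁻¹ := by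
      rw [div_pow, neg_pow, Complex.I_pow_four, ← pow_mul]; norm_num
    have h1 : κ ^ 8 = (κ ^ 2) ^ 4 := by rw [← pow_mul]
    have h2 : ∀ a b c : ℂ, (a ^ n * (b ^ n * c) ^ m) ^ 4 = (a ^ n) ^ 4 * ((b ^ 4) ^ n * c ^ 4) ^ m :=
      fun a b c => by ring
    rw [h1, hκ, h2, hI]
    simp only [Complex.ofReal_mul, Complex.ofReal_pow, Complex.ofReal_inv, Complex.ofReal_natCast,
      Complex.ofReal_intCast]
  have h8 : (κ * G) ^ 8 = (((((M.map (Int.cast : ℤ → ℝ))⁻¹.det ^ n) ^ 4 *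
      ((((q : ℝ) ^ 8)⁻¹ ^ n * (C.det : ℝ) ^ 4) ^ m)) * t : ℝ) : ℂ) := by
    rw [mul_pow, hκ8, hGt, ← Complex.ofReal_mul]
  have h9 := congrArg norm h8
  rw [norm_pow, hn, one_pow, Complex.norm_of_nonneg (by positivity)] at h9
  rw [h8, ← h9, Complex.ofReal_one]

/-! ### Reduction to invertible `C` -/

/-- The lower unipotent symplectic matrix with `C = s`. -/
def lowerUnip (n : ℕ) (s : ℤ) : Sp n :=
  ⟨fromBlocks 1 0 ((s : ℝ) • 1) 1, by rw [SymplecticGroup.fromBlocks_mem_iff]; simp⟩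

theorem hasBlocks_lowerUnip (n : ℕ) (s : ℤ) : HasBlocks (lowerUnip n s) 1 0 (s • 1) 1 := by
  constructor
  · simp [blkA, lowerUnip, intC_one]
  · ext; simp [blkB, lowerUnip, intC]
  · rw [intC_smul, intC_one, blkC, lowerUnip, toBlocks_fromBlocks₂₁]
    ext i j; by_cases hij : i = j <;> simp [hij]
  · simp [blkD, lowerUnip, intC_one]

theorem Mp.exists_lift {n : ℕ} (g : Sp n) : ∃ x : Mp n, x.g = g := by
  obtain ⟨ε, hε⟩ := IsAlgClosed.exists_pow_nat_eq ((alpha (basePt n) g)⁻¹) two_pos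
  exact ⟨⟨g, ε, hε⟩, rfl⟩

theorem HasBlocks.exists_det_ne_zero {n : ℕ} {g : Sp n} {A B C D : Matrix (Fin n) (Fin n) ℤ}
    (h : HasBlocks g A B C D) {N : ℤ} (hN : N ≠ 0) : ∃ s : ℤ, s ≠ 0 ∧ (C + (N * s) • D).det ≠ 0 := by
  set P : Polynomial ℂ := det ((Polynomial.X : Polynomial ℂ) • (intC D).map Polynomial.C +
    (intC C).map Polynomial.C) with hP
  have hev : ∀ t : ℂ, P.eval t = (t • intC D + intC C).det := fun t => by
    rw [hP, ← Polynomial.coe_evalRingHom, RingHom.map_det]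
    congr 1
    ext i j
    simp only [RingHom.mapMatrix_apply, Matrix.map_apply, Matrix.add_apply, Matrix.smul_apply,
      smul_eq_mul, Polynomial.coe_evalRingHom, Polynomial.eval_add, Polynomial.eval_mul,
      Polynomial.eval_X, Polynomial.eval_C]
  have hP0 : P ≠ 0 := by
    intro h0
    -- `-iD + C` is invertible, being `-i (Ci + D)`
    have h1 := hev (-Complex.I)
    have h2 := autJ_det_ne_zero g (basePt_mem n)
    have h3 : autJ g (basePt n) = Complex.I • (-Complex.I • intC D + intC C) := by
      rw [autJ, h.c, h.d, basePt, smul_add, smul_smul]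
      simp [add_comm]
    rw [h3, det_smul, ← h1, h0] at h2
    simp at h2
  by_contra! hs
  apply hP0
  apply Polynomial.eq_zero_of_infinite_isRoot
  refine Set.infinite_of_injective_forall_mem (f := fun k : ℕ => ((N * (k + 1) : ℤ) : ℂ)) ?_ ?_
  · intro a b hab
    simp only [Int.cast_inj] at hab
    have := mul_left_cancel₀ hN hab
    omega
  · intro k
    have h1 := hs (k + 1) (by omega)
    change P.eval _ = 0
    rw [hev, ← intC_smul, ← intC_add, intC_det, add_comm, h1, Int.cast_zero]

/-- Multiplication by a lower unipotent element on the right makes `C` invertible. -/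
theorem HasBlocks.exists_isThetaMult_of_level {n m : ℕ} {A B C D : Matrix (Fin n) (Fin n) ℤ}
    {x : Mp n} (h : HasBlocks x.g A B C D)
    {M : Matrix (Fin m) (Fin m) ℤ} (hM : (M.map (Int.cast : ℤ → ℝ)).PosDef) (hMs : M.IsSymm)
    (hMd : M.det ≠ 0) {B' C' : Matrix (Fin n) (Fin n) ℤ} (hB' : B = (2 : ℤ) • B')
    (hC' : C = (2 * M.det) • C') : ∃ c, IsThetaMult M x c ∧ c ^ 8 = 1 := by
  obtain ⟨s, hs, hdet⟩ := h.exists_det_ne_zero (mul_ne_zero two_ne_zero hMd)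
  obtain ⟨y, hy⟩ := Mp.exists_lift (lowerUnip n (2 * M.det * s))
  have hyb := hasBlocks_lowerUnip n (2 * M.det * s)
  rw [← hy] at hyb
  obtain ⟨c, hc, hc8⟩ := hyb.exists_isThetaMult_pow_eight (by
    rw [det_smul, det_one, mul_one]
    exact pow_ne_zero _ (mul_ne_zero (mul_ne_zero two_ne_zero hMd) hs)) hM hMs hMd
    (B' := 0) (C' := s • 1) (by simp) (by rw [smul_smul])
  obtain ⟨d, hd, hd8⟩ := HasBlocks.exists_isThetaMult_pow_eight (x := x * y) (h.mul hyb) (by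
    rw [Matrix.mul_one, Matrix.mul_smul, Matrix.mul_one]; exact hdet) hM hMs hMd
    (B' := B') (C' := C' + s • D) (by simp [hB'])
    (by rw [hC', Matrix.mul_one, Matrix.mul_smul, Matrix.mul_one, smul_add, smul_smul])
  have hc0 : c ≠ 0 := by
    rintro rfl
    norm_num at hc8
  refine ⟨d * c⁻¹, ?_, by rw [mul_pow, inv_pow, hc8, hd8]; simp⟩
  have := hd.mul (hc.inv hc0)
  rwa [mul_inv_cancel_right] at this

/-! ### Principal congruence subgroups -/

/-- The integral matrix underlying an element of the Siegel modular group. -/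
def intMat {n : ℕ} (g : siegelModular n) : Matrix (Fin n ⊕ Fin n) (Fin n ⊕ Fin n) ℤ :=
  Classical.choose g.2

theorem map_intMat {n : ℕ} (g : siegelModular n) : (intMat g).map Int.cast = g.1.1 :=
  (Classical.choose_spec g.2).symm

theorem map_intCast_injective {a b : Type*} :
    Function.Injective fun X : Matrix a b ℤ => X.map (Int.cast : ℤ → ℝ) :=
  Matrix.map_injective Int.cast_injective

theorem intMat_one (n : ℕ) : intMat (1 : siegelModular n) = 1 := by
  apply map_intCast_injective
  change (intMat (1 : siegelModular n)).map _ = _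
  rw [map_intMat]
  exact (Matrix.map_one _ Int.cast_zero Int.cast_one).symm

theorem intMat_mul {n : ℕ} (g h : siegelModular n) : intMat (g * h) = intMat g * intMat h := by
  apply map_intCast_injective
  change (intMat (g * h)).map _ = (intMat g * intMat h).map (Int.castRingHom ℝ)
  rw [Matrix.map_mul, map_intMat]
  change _ = (intMat g).map Int.cast * (intMat h).map Int.cast
  rw [map_intMat, map_intMat]; rfl

/-- Reduction of the Siegel modular group modulo `N`. -/
def modReduction (n N : ℕ) : siegelModular n →* Matrix (Fin n ⊕ Fin n) (Fin n ⊕ Fin n) (ZMod N) where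
  toFun g := redMod N (intMat g)
  map_one' := by rw [intMat_one, redMod_one]
  map_mul' g h := by rw [intMat_mul, redMod_mul]

/-- The principal congruence subgroup of level `N` of the Siegel modular group. -/
def principalCongruence (n N : ℕ) : Subgroup (siegelModular n) := (modReduction n N).toHomUnits.ker

instance principalCongruence_finiteIndex (n N : ℕ) [NeZero N] :
    (principalCongruence n N).FiniteIndex := by
  unfold principalCongruence
  infer_instance

theorem exists_hasBlocks {n N : ℕ} {x : Mp n} (hx : x ∈ metaLift (principalCongruence n N)) :
    ∃ A B C D, HasBlocks x.g A ((N : ℤ) • B) ((N : ℤ) • C) D := by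
  obtain ⟨g, hg, hgx⟩ := hx
  have hg' : redMod N (intMat g) = 1 := congrArg Units.val (MonoidHom.mem_ker.1 hg)
  have hgx' : g.1 = x.g := hgx
  obtain ⟨B, hB⟩ := exists_smul_of_redMod_eq_zero (q := N) (X := (intMat g).toBlocks₁₂) (by
    change (redMod N (intMat g)).toBlocks₁₂ = 0
    rw [hg']; ext; simp [toBlocks₁₂])
  obtain ⟨C, hC⟩ := exists_smul_of_redMod_eq_zero (q := N) (X := (intMat g).toBlocks₂₁) (by
    change (redMod N (intMat g)).toBlocks₂₁ = 0
    rw [hg']; ext; simp [toBlocks₂₁])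
  refine ⟨(intMat g).toBlocks₁₁, B, C, (intMat g).toBlocks₂₂, ?_⟩
  rw [← hB, ← hC, ← hgx']
  constructor
  · rw [blkA, ← map_intMat]; ext; simp [intC, toBlocks₁₁]
  · rw [blkB, ← map_intMat]; ext; simp [intC, toBlocks₁₂]
  · rw [blkC, ← map_intMat]; ext; simp [intC, toBlocks₂₁]
  · rw [blkD, ← map_intMat]; ext; simp [intC, toBlocks₂₂]

/-! ### Discreteness -/

theorem IsInt.eq_of_abs_sub_lt {a b : Type*} {X Y : Matrix a b ℝ} (hX : IsInt X) (hY : IsInt Y)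
    (h : ∀ i j, |X i j - Y i j| < 1) : X = Y := by
  obtain ⟨N, rfl⟩ := hX
  obtain ⟨K, rfl⟩ := hY
  ext i j
  have h1 := h i j
  simp only [Matrix.map_apply] at h1 ⊢
  rw [← Int.cast_sub, ← Int.cast_abs] at h1
  have h2 : |N i j - K i j| < 1 := by exact_mod_cast h1
  rw [Int.abs_lt_one_iff, sub_eq_zero] at h2
  rw [h2]

theorem isOpen_setOf_abs_sub_lt {X a b : Type*} [TopologicalSpace X] [Finite a] [Finite b]
    {f : X → Matrix a b ℝ} (hf : Continuous f) (Y : Matrix a b ℝ) :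
    IsOpen {x | ∀ i j, |f x i j - Y i j| < 1} := by
  simp only [Set.ofPred_forall]
  refine isOpen_iInter_of_finite fun i => isOpen_iInter_of_finite fun j => ?_
  exact isOpen_lt ((hf.matrix_elem i j).sub continuous_const).abs continuous_const

theorem jacobiLift_discreteTopology {n : ℕ} (m : ℕ) (Γ : Subgroup (siegelModular n)) :
    DiscreteTopology (jacobiLift m Γ) := by
  have hc : Continuous fun x : JacobiMp n m => (x.g, x.lam, x.mu, x.kap) := continuous_induced_dom
  have hc' : Continuous fun x : Mp n => (x.g, x.ε) := continuous_induced_dom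
  have hg : Continuous fun x : JacobiMp n m => x.g.g.1 :=
    continuous_subtype_val.comp ((continuous_fst.comp hc').comp (continuous_fst.comp hc))
  have hε : Continuous fun x : JacobiMp n m => x.g.ε :=
    (continuous_snd.comp hc').comp (continuous_fst.comp hc)
  have hl : Continuous fun x : JacobiMp n m => x.lam :=
    continuous_fst.comp (continuous_snd.comp hc)
  have hu : Continuous fun x : JacobiMp n m => x.mu :=
    continuous_fst.comp (continuous_snd.comp (continuous_snd.comp hc))
  have hk : Continuous fun x : JacobiMp n m => x.kap :=
    continuous_snd.comp (continuous_snd.comp (continuous_snd.comp hc))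
  refine discreteTopology_iff_isOpen_singleton.2 fun x => isOpen_induced_iff.2
    ⟨{y | ∀ i j, |y.g.g.1 i j - x.1.g.g.1 i j| < 1} ∩ {y | ‖y.g.ε - x.1.g.ε‖ < ‖x.1.g.ε‖} ∩
      {y | ∀ i j, |y.lam i j - x.1.lam i j| < 1} ∩ {y | ∀ i j, |y.mu i j - x.1.mu i j| < 1} ∩
      {y | ∀ i j, |y.kap i j - x.1.kap i j| < 1}, ?_, ?_⟩
  · exact ((((isOpen_setOf_abs_sub_lt hg _).inter (isOpen_lt (hε.sub continuous_const).norm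
      continuous_const)).inter (isOpen_setOf_abs_sub_lt hl _)).inter
      (isOpen_setOf_abs_sub_lt hu _)).inter (isOpen_setOf_abs_sub_lt hk _)
  · obtain ⟨x, hx1, hx2, hx3, hx4⟩ := x
    ext ⟨y, hy1, hy2, hy3, hy4⟩
    simp only [Set.mem_preimage, Set.mem_inter_iff, Set.mem_ofPred_eq, Set.mem_singleton_iff]
    constructor
    · rintro ⟨⟨⟨⟨h1, h2⟩, h3⟩, h4⟩, h5⟩
      have e1 : y.g.g = x.g.g :=
        Subtype.ext ((metaLift_isInt hy1).eq_of_abs_sub_lt (metaLift_isInt hx1) h1)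
      -- the two points of the fibre over `x.g.g` differ by the sign of `ε`
      have e2 : y.g.ε = x.g.ε := by
        rcases sq_eq_sq_iff_eq_or_eq_neg.1 ((e1 ▸ y.g.sq).trans x.g.sq.symm) with h | h
        · exact h
        · rw [h, ← neg_add', norm_neg, ← two_mul, norm_mul, Complex.norm_two] at h2
          linarith [norm_nonneg x.g.ε]
      exact Subtype.ext (JacobiMp.ext (Mp.ext e1 e2) (hy2.eq_of_abs_sub_lt hx2 h3)
        (hy3.eq_of_abs_sub_lt hx3 h4) (hy4.eq_of_abs_sub_lt hx4 h5))
    · intro h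
      obtain rfl : y = x := congrArg Subtype.val h
      simpa using y.g.ε_ne_zero

/-! ### The functional equation under the Jacobi group -/

theorem isSymm_of_posDef {m : ℕ} {M : Matrix (Fin m) (Fin m) ℤ}
    (hM : (M.map (Int.cast : ℤ → ℝ)).PosDef) : M.IsSymm := by
  ext i j
  have h := congrFun (congrFun hM.1 i) j
  simpa using h

theorem det_pos_of_posDef {m : ℕ} {M : Matrix (Fin m) (Fin m) ℤ}
    (hM : (M.map (Int.cast : ℤ → ℝ)).PosDef) : 0 < M.det := by
  have h := hM.det_pos
  have e : (M.map (Int.cast : ℤ → ℝ)).det = (M.det : ℝ) :=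
    (RingHom.map_det (Int.castRingHom ℝ) M).symm
  rw [e] at h
  exact_mod_cast h

/-- The action of the Jacobi group is the symplectic action after the translation `Z ↦ Z + λΩ + μ`. The
sign `heisSign` cancels the part of the automorphy factor that depends on `κ`. -/
theorem IsThetaMult.theta_jact {n m : ℕ} {M : Matrix (Fin m) (Fin m) ℤ} (hMs : M.IsSymm)
    {x : JacobiMp n m} {c : ℂ} (hc : IsThetaMult M x.g c) (hl : IsInt x.lam) (hu : IsInt x.mu)
    {p : Matrix (Fin n) (Fin n) ℂ × Matrix (Fin m) (Fin n) ℂ} (hp : p ∈ siegelJacobi n m) :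
    theta M (jact x p) = c * heisSign M x * jStar (intC M) x p * theta M p := by
  obtain ⟨L, hL⟩ := hl
  obtain ⟨U, hU⟩ := hu
  have hL' : x.lam.map Complex.ofReal = intC L := by rw [hL]; ext; simp [intC]
  have hU' : x.mu.map Complex.ofReal = intC U := by rw [hU]; ext; simp [intC]
  have h1 := hc (p.1, shift x p) ⟨hp.1, Set.mem_univ _⟩
  have h2 := theta_shift hMs hp.1.1 p.2 (intC U) L (M * U) (intC_mul M U).symm
  have h3 : shift x p = p.2 + intC L * p.1 + intC U := by rw [shift, hL', hU']
  have h4 : spQuad (intC M) x.g.g (p.1, shift x p) = quadA (intC M) x p := by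
    simp only [spQuad, quadA, bil, Matrix.mul_assoc]
  have h5 : quadB (intC M) x p = bil (intC M) (intC L * p.1) (intC L) +
      2 * bil (intC M) (intC L) p.2 +
      (intC M * (x.kap + x.mu * x.lamᵀ).map Complex.ofReal).trace := by
    rw [quadB, hL', bil, bil, Matrix.mul_add, Matrix.mul_add, trace_add, trace_add,
      Matrix.mul_smul, trace_smul, smul_eq_mul]
  change theta M (spAct x.g.g (p.1, shift x p)) = _
  rw [h1, spFactor, h4, h3, h2, jStar, h5, heisSign]
  set w := (intC M * (x.kap + x.mu * x.lamᵀ).map Complex.ofReal).trace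
  have h6 : Complex.exp (Real.pi * Complex.I * w) * Complex.exp (-(Real.pi * Complex.I * w)) = 1 := by
    rw [← Complex.exp_add, add_neg_cancel, Complex.exp_zero]
  rw [mul_add (Real.pi * Complex.I : ℂ) (_ + _) w, neg_add, Complex.exp_add]
  linear_combination (-(c * Complex.exp (Real.pi * Complex.I * quadA (intC M) x p) *
    Jhalf x.g p.1 ^ m * Complex.exp (-(Real.pi * Complex.I * (bil (intC M) (intC L * p.1) (intC L) +
      2 * bil (intC M) (intC L) p.2))) * theta M p)) * h6

/-- The off-diagonal terms of the trace come in equal pairs. -/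
theorem even_trace_mul {m : ℕ} {M S : Matrix (Fin m) (Fin m) ℤ} (hM : M.IsSymm) (hS : S.IsSymm)
    (he : ∀ i, Even (M i i)) : Even (M * S).trace := by
  rw [← ZMod.intCast_eq_zero_iff_even]
  simp only [trace, diag_apply, Matrix.mul_apply, Int.cast_sum, Int.cast_mul]
  rw [← Finset.sum_product']
  refine Finset.sum_involution (fun a _ => a.swap) ?_ ?_ (by simp) (by simp)
  · rintro ⟨i, j⟩ -
    simp only [Prod.swap_prod_mk]
    rw [hM.apply, hS.apply, CharTwo.add_self_eq_zero]
  · rintro ⟨i, j⟩ - h0 h1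
    have hij : i = j := (congrArg Prod.snd h1 : _)
    subst hij
    apply h0
    have := (ZMod.intCast_eq_zero_iff_even).2 (he i)
    simp [this]

theorem heisSign_eq_one {n m : ℕ} {M : Matrix (Fin m) (Fin m) ℤ} (hM : M.IsSymm)
    (he : ∀ i, Even (M i i)) {x : JacobiMp n m} (hl : IsInt x.lam) (hu : IsInt x.mu)
    (hk : IsInt x.kap) : heisSign M x = 1 := by
  obtain ⟨S, hS⟩ := hk.add (hu.mul hl.transpose)
  have hSs : S.IsSymm := by
    have h := x.symm
    rw [hS] at h
    exact map_intCast_injective h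
  have hS' : (S.map (Int.cast : ℤ → ℝ)).map Complex.ofReal = intC S := by ext; simp [intC]
  obtain ⟨k, hk⟩ := even_trace_mul hM hSs he
  have e : (intC M * intC S).trace = ((M * S).trace : ℤ) := by
    rw [← intC_mul, trace, trace, Int.cast_sum]; rfl
  rw [heisSign, hS, hS', e, hk, Complex.exp_eq_one_iff]
  exact ⟨k, by push_cast; ring⟩

theorem jacobiFactor_half {n m : ℕ} (M : Matrix (Fin m) (Fin m) ℤ) (x : JacobiMp n m)
    (p : Matrix (Fin n) (Fin n) ℂ × Matrix (Fin m) (Fin n) ℂ) :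
    jacobiFactor m (((1 / 2 : ℝ) • M.map (Int.cast : ℤ → ℝ)).map Complex.ofReal) x p =
      jStar (intC M) x p := by
  have e : ((1 / 2 : ℝ) • M.map (Int.cast : ℤ → ℝ)).map Complex.ofReal = (1 / 2 : ℂ) • intC M := by
    ext; simp [intC]
  have h1 : quadA ((1 / 2 : ℂ) • intC M) x p = 1 / 2 * quadA (intC M) x p := by
    rw [quadA, quadA, Matrix.smul_mul, trace_smul, smul_eq_mul]
  have h2 : quadB ((1 / 2 : ℂ) • intC M) x p = 1 / 2 * quadB (intC M) x p := by
    rw [quadB, quadB, Matrix.smul_mul, trace_smul, smul_eq_mul]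
  rw [jacobiFactor, jStar, e, h1, h2, zpow_natCast]
  congr 3 <;> ring

/-! ### The character -/

theorem exists_isThetaMult_pow_eight {n m : ℕ} {M : Matrix (Fin m) (Fin m) ℤ}
    (hM : (M.map (Int.cast : ℤ → ℝ)).PosDef) {x : Mp n}
    (hx : x ∈ metaLift (principalCongruence n (2 * M.det.natAbs))) :
    ∃ c, IsThetaMult M x c ∧ c ^ 8 = 1 := by
  obtain ⟨A, B, C, D, h⟩ := exists_hasBlocks hx
  refine h.exists_isThetaMult_of_level hM (isSymm_of_posDef hM) (det_pos_of_posDef hM).ne'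
    (B' := (M.det.natAbs : ℤ) • B) (C' := C) ?_ ?_
  · rw [smul_smul]; push_cast; rfl
  · push_cast [Int.natAbs_of_nonneg (det_pos_of_posDef hM).le]; rfl

/-- The multipliers of `Θ_M` form a character of order dividing eight on the preimage of a principal
congruence subgroup. -/
theorem exists_thetaCharacter {n m : ℕ} {M : Matrix (Fin m) (Fin m) ℤ}
    (hM : (M.map (Int.cast : ℤ → ℝ)).PosDef) :
    ∃ ρ : metaLift (principalCongruence n (2 * M.det.natAbs)) →* Circle,
      IsOfFinOrder ρ ∧ ∀ x, IsThetaMult M x.1 (ρ x) := by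
  choose c hc hc8 using fun x : metaLift (principalCongruence n (2 * M.det.natAbs)) =>
    exists_isThetaMult_pow_eight hM x.2
  have hn : ∀ x, ‖c x‖ = 1 := fun x => Complex.norm_eq_one_of_pow_eq_one (hc8 x) (by norm_num)
  let ρ : metaLift (principalCongruence n (2 * M.det.natAbs)) →* Circle :=
    MonoidHom.mk' (fun x => ⟨c x, mem_sphere_zero_iff_norm.2 (hn x)⟩) fun x y =>
      Circle.ext (IsThetaMult.unique hM (hc (x * y)) ((hc x).mul (hc y)))
  refine ⟨ρ, isOfFinOrder_iff_pow_eq_one.2 ⟨8, by norm_num, MonoidHom.ext fun x =>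
    Circle.ext ?_⟩, hc⟩
  exact hc8 x

end
end JacobiTheta

open JacobiTheta
theorem theorem7p2 (n m : ℕ) (hn : 0 < n) (hm : 0 < m) (M : Matrix (Fin m) (Fin m) ℤ)
    (hM : (M.map (Int.cast : ℤ → ℝ)).PosDef) :
    -- the theta series converges absolutely and is holomorphic on the Siegel-Jacobi space
    (∀ p ∈ siegelJacobi n m, Summable (fun ξ => ‖thetaTerm M p ξ‖)) ∧
    DifferentiableOn ℂ (theta M) (siegelJacobi n m) ∧
    ∃ Γ : Subgroup (siegelModular n), Γ.FiniteIndex ∧ DiscreteTopology (jacobiLift m Γ) ∧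
      ∃ ρ : metaLift Γ →* Circle, IsOfFinOrder ρ ∧
        -- the functional equation for all integral `M`
        (∀ (x : JacobiMp n m) (hx : x ∈ jacobiLift m Γ), ∀ p ∈ siegelJacobi n m,
          theta M (jact x p) =
            ρ ⟨x.g, hx.1⟩ * heisSign M x * jStar (intC M) x p * theta M p) ∧
        -- for even `M` (that is, `M / 2` half-integral) the sign disappears
        ((∀ i, Even (M i i)) →
          (∀ (x : JacobiMp n m) (hx : x ∈ jacobiLift m Γ), ∀ p ∈ siegelJacobi n m,
            theta M (jact x p) = ρ ⟨x.g, hx.1⟩ * jStar (intC M) x p * theta M p) ∧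
          IsJacobiForm m ((1 / 2 : ℝ) • M.map (Int.cast : ℤ → ℝ)) Γ ρ (theta M)) := by
  have hMs := isSymm_of_posDef hM
  have hN : NeZero (2 * M.det.natAbs) :=
    ⟨mul_ne_zero two_ne_zero (by simpa using (det_pos_of_posDef hM).ne')⟩
  obtain ⟨ρ, hρ, hmult⟩ := exists_thetaCharacter (n := n) hM
  have hfun := fun (x : JacobiMp n m)
    (hx : x ∈ jacobiLift m (principalCongruence n (2 * M.det.natAbs)))
    (p) (hp : p ∈ siegelJacobi n m) => (hmult ⟨x.g, hx.1⟩).theta_jact hMs hx.2.1 hx.2.2.1 hp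
  refine ⟨fun p hp => summable_thetaTerm hM hp, differentiableOn_theta hM,
    principalCongruence n (2 * M.det.natAbs), inferInstance, jacobiLift_discreteTopology m _, ρ, hρ,
    hfun, fun he => ?_⟩
  have heven : ∀ (x : JacobiMp n m)
      (hx : x ∈ jacobiLift m (principalCongruence n (2 * M.det.natAbs))), ∀ p ∈ siegelJacobi n m,
      theta M (jact x p) = ρ ⟨x.g, hx.1⟩ * jStar (intC M) x p * theta M p := fun x hx p hp => by
    rw [hfun x hx p hp, heisSign_eq_one hMs he hx.2.1 hx.2.2.1 hx.2.2.2, mul_one]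
  refine ⟨heven, ?_, fun i => ?_, ⟨M, ?_⟩, inferInstance, hρ, differentiableOn_theta hM,
    fun x hx p hp => ?_⟩
  · exact (hM.smul (by norm_num : (0 : ℝ) < 1 / 2)).posSemidef
  · obtain ⟨k, hk⟩ := he i
    exact ⟨k, by simp [hk]; ring⟩
  · rw [smul_smul]; norm_num
  · rw [jacobiFactor_half, heven x hx p hp]
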